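/- **Theorem 3.2 (asymptotic normality of the local linear estimator of the mean surface).** *Sampling.* For each $n$, subjects $i=1,\dots,n$ are independent. Subject $i$ has a covariate $Z_i\in\mathbb R$ and measurements $(T_{ij},Y_{ij})$, $j=1,\dots,N_i(n)$, which may be dependent within a subject. Every $(T_{ij},Z_i,Y_{ij})$ has density $f_3(t,z,y)$ and, for $j\ne k$, every $(T_{ij},T_{ik},Z_i,Y_{ij},Y_{ik})$ has density $f_5(t_1,t_2,z,y_1,y_2)$. The positive integer-valued numbers $N_1(n),\dots,N_n(n)$ are i.i.d. copies of a random variable $N=N(n)$ and are independent of all $(T_{ij},Z_i,Y_{ij})$; $E N(n)^4<\infty$, and $\limsup_n E N(n)^2/(E N(n))^2$ and $\limsup_n E N(n)^4/(E N(n)^2)^2$ are finite. Write $f_2(t,z)=\int f_3(t,z,y)\,dy$ for the density of $(T,Z)$, $\mu(t,z)=E(Y\mid T=t,Z=z)=\int y f_3(t,z,y)\,dy/f_2(t,z)$ and $\mathrm{Var}(Y\mid t,z)=\int (y-\mu(t,z))^2f_3(t,z,y)\,dy/f_2(t,z)$. *Kernel.* $K_2:\mathbb R^2\to\mathbb R$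 is measurable and square integrable with compact support, $\int K_2=1$, $\int uK_2(u,v)\,du\,dv=\int vK_2(u,v)\,du\,dv=0$, and its matrix of second moments is positive definite (as it is for every nonnegative kernel with these properties). *Regularity at a fixed point $(t,z)$.* $f_2(t,z)>0$. The second-order partial derivatives of $f_2$ and $\mu$ exist near $(t,z)$ and are continuous at $(t,z)$. The density $f_3(\cdot,\cdot,y)$ is continuous at $(t,z)$ uniformly in $y\in\mathbb R$; its second-order partial derivatives in the first two variables exist near $(t,z)$, in a neighbourhood not depending on $y$, and are continuous at $(t,z)$ uniformly in $y$. The density $f_5(\cdot,\cdot,\cdot,y_1,y_2)$ is continuous at $(t,t,z)$ uniformly in $(y_1,y_2)\in\mathbb R^2$. Moreover $\int y^2f_3(t',z',y)\,dy<\infty$ for $(t',z')$ near $(t,z)$, $\mathrm{Var}(Y\mid\cdot,\cdot)$ is continuous at $(t,z)$, and the functions $\int\!\!\int f_5(t_1,t_2,z',y_1,y_2)\,dy_1dy_2$ and $\int\!\!\int (y_1-\mu(t_1,z'))(y_2-\mu(t_2,z'))f_5(t_1,t_2,z',y_1,y_2)\,dy_1dy_2$ are bounded for $(t_1,t_2,z')$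 near $(t,t,z)$. *Bandwidths.* $h_{\mu,t},h_{\mu,z}>0$ depend on $n$, and as $n\to\infty$: $h_{\mu,t}\to0$, $nE(N)h_{\mu,t}^2\to\infty$, $E(N)h_{\mu,t}\to0$, $h_{\mu,z}/h_{\mu,t}\to\rho_\mu$ and $nE(N)h_{\mu,t}^6\to\tau_\mu^2$ for some $0<\rho_\mu,\tau_\mu<\infty$. *Estimator.* $\hat\mu_L(t,z)=\hat\beta_0$, where $\hat\beta=(\hat\beta_0,\hat\beta_1,\hat\beta_2)$ is a random vector which almost surely minimizes $$\sum_{i=1}^n\sum_{j=1}^{N_i(n)}K_2\Big(\frac{t-T_{ij}}{h_{\mu,t}},\frac{z-Z_i}{h_{\mu,z}}\Big)\big[Y_{ij}-\beta_0-\beta_1(T_{ij}-t)-\beta_2(Z_i-z)\big]^2$$ over $\beta\in\mathbb R^3$ whenever a minimizer exists (and is arbitrary otherwise). *Conclusion.* With $\bar N=\frac1n\sum_{i=1}^nN_i(n)$, $$\sqrt{n\bar N h_{\mu,t}h_{\mu,z}}\,\big[\hat\mu_L(t,z)-\mu(t,z)\big]\xrightarrow{\ \mathcal D\ }N(\beta_L,\Sigma_L),$$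 where $$\beta_L=\sum_{k_1+k_2=2}\frac1{k_1!k_2!}\Big[\int s_1^{k_1}s_2^{k_2}K_2(s_1,s_2)\,ds_1ds_2\Big]\frac{\partial^2\mu}{\partial t^{k_1}\partial z^{k_2}}(t,z)\;\tau_\mu\sqrt{\rho_\mu^{2k_2+1}},\qquad \Sigma_L=\frac{\mathrm{Var}(Y\mid t,z)\,\|K_2\|^2}{f_2(t,z)},\quad \|K_2\|^2=\int K_2^2 .$$ -/

import Mathlib

open MeasureTheory ProbabilityTheory Filter Topology

noncomputable section

namespace MeanSurface

/-! ### Partial derivatives and uniform continuity at a point -/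

/-- The mixed partial derivative `∂^(k₁+k₂) f / ∂t^k₁ ∂z^k₂` at `(t, z)`. -/
def pderiv (k₁ k₂ : ℕ) (f : ℝ → ℝ → ℝ) (t z : ℝ) : ℝ :=
  iteratedDeriv k₁ (fun s => iteratedDeriv k₂ (fun w => f s w) z) t

/-- The first partial derivatives of `f` exist at `p` and so do the derivatives of these that give
`∂²f/∂t²`, `∂²f/∂t∂z` and `∂²f/∂z²` at `p`. -/
def SecondPartialsExistAt (f : ℝ → ℝ → ℝ) (p : ℝ × ℝ) : Prop :=
  DifferentiableAt ℝ (fun s => f s p.2) p.1 ∧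
  DifferentiableAt ℝ (fun w => f p.1 w) p.2 ∧
  DifferentiableAt ℝ (fun s => pderiv 1 0 f s p.2) p.1 ∧
  DifferentiableAt ℝ (fun s => pderiv 0 1 f s p.2) p.1 ∧
  DifferentiableAt ℝ (fun w => pderiv 0 1 f p.1 w) p.2

/-- The second-order partial derivatives of `f` exist around `(t, z)` and are continuous
at `(t, z)`. -/
def HasContSecondPartials (f : ℝ → ℝ → ℝ) (t z : ℝ) : Prop :=
  (∀ᶠ p in 𝓝 (t, z), SecondPartialsExistAt f p) ∧
  ∀ k₁ k₂ : ℕ, k₁ + k₂ = 2 → ContinuousAt (fun p : ℝ × ℝ => pderiv k₁ k₂ f p.1 p.2) (t, z)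

/-- `F x y` is continuous in `x` at the point `a`, uniformly in the parameter `y`. -/
def ContAtUniformly {E Y : Type*} [TopologicalSpace E] (F : E → Y → ℝ) (a : E) : Prop :=
  ∀ ε : ℝ, 0 < ε → ∀ᶠ x in 𝓝 a, ∀ y : Y, |F x y - F a y| < ε

/-! ### The kernel -/

/-- Compactly supported, square integrable kernels on `ℝ²` of order `((0,0), 2)`: total mass one,
vanishing first moments, nondegenerate second moments. The second moment matrix is asked to be
positive definite, which is automatic for a nonnegative kernel. -/
structure IsKernelOfOrderTwo (K : ℝ → ℝ → ℝ) : Prop where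
  measurable : Measurable (fun p : ℝ × ℝ => K p.1 p.2)
  compactSupport : HasCompactSupport (fun p : ℝ × ℝ => K p.1 p.2)
  memLp_two : MemLp (fun p : ℝ × ℝ => K p.1 p.2) 2 volume
  mass : ∫ p : ℝ × ℝ, K p.1 p.2 = 1
  first_t : ∫ p : ℝ × ℝ, p.1 * K p.1 p.2 = 0
  first_z : ∫ p : ℝ × ℝ, p.2 * K p.1 p.2 = 0
  second_pos : 0 < ∫ p : ℝ × ℝ, p.1 ^ 2 * K p.1 p.2
  second_det : (∫ p : ℝ × ℝ, p.1 * p.2 * K p.1 p.2) ^ 2 <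
    (∫ p : ℝ × ℝ, p.1 ^ 2 * K p.1 p.2) * ∫ p : ℝ × ℝ, p.2 ^ 2 * K p.1 p.2

/-- `‖K‖² = ∫ K²`. -/
def kernelNormSq (K : ℝ → ℝ → ℝ) : ℝ := ∫ p : ℝ × ℝ, K p.1 p.2 ^ 2

/-- The moment `∫ s₁^k₁ s₂^k₂ K(s₁, s₂) ds₁ ds₂`. -/
def kernelMoment (K : ℝ → ℝ → ℝ) (k₁ k₂ : ℕ) : ℝ :=
  ∫ p : ℝ × ℝ, p.1 ^ k₁ * p.2 ^ k₂ * K p.1 p.2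

/-! ### Quantities determined by the joint densities

`f₃` is the density of `(T, Z, Y)`, and `f₅` the density of `(T₁, T₂, Z, Y₁, Y₂)` for two
measurements on one subject. -/

/-- The density `f₂` of `(T, Z)`. -/
def designDensity (f₃ : ℝ → ℝ → ℝ → ℝ) (t z : ℝ) : ℝ := ∫ y, f₃ t z y

/-- The mean surface `μ(t, z) = E(Y | T = t, Z = z)`. -/
def condMean (f₃ : ℝ → ℝ → ℝ → ℝ) (t z : ℝ) : ℝ :=
  (∫ y, y * f₃ t z y) / designDensity f₃ t z

/-- The conditional variance `Var(Y | T = t, Z = z)`. -/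
def condVar (f₃ : ℝ → ℝ → ℝ → ℝ) (t z : ℝ) : ℝ :=
  (∫ y, (y - condMean f₃ t z) ^ 2 * f₃ t z y) / designDensity f₃ t z

/-- The density `g₃` of `(T₁, T₂, Z)`. -/
def pairDesignDensity (f₅ : ℝ → ℝ → ℝ → ℝ → ℝ → ℝ) (t₁ t₂ z : ℝ) : ℝ :=
  ∫ y : ℝ × ℝ, f₅ t₁ t₂ z y.1 y.2

/-- The within-subject covariance `Cov(Y₁, Y₂ | T₁ = t₁, T₂ = t₂, Z = z)` multiplied by the design
density `g₃(t₁, t₂, z)`. -/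
def pairCovDensity (f₃ : ℝ → ℝ → ℝ → ℝ) (f₅ : ℝ → ℝ → ℝ → ℝ → ℝ → ℝ) (t₁ t₂ z : ℝ) : ℝ :=
  ∫ y : ℝ × ℝ, (y.1 - condMean f₃ t₁ z) * (y.2 - condMean f₃ t₂ z) * f₅ t₁ t₂ z y.1 y.2

/-- Local regularity of the densities, the mean surface and the second moments at `(t, z)`. -/
structure Regularity (f₃ : ℝ → ℝ → ℝ → ℝ) (f₅ : ℝ → ℝ → ℝ → ℝ → ℝ → ℝ) (t z : ℝ) : Prop where
  f₂_smooth : HasContSecondPartials (designDensity f₃) t z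
  f₂_pos : 0 < designDensity f₃ t z
  f₃_cont : ContAtUniformly (fun (p : ℝ × ℝ) (y : ℝ) => f₃ p.1 p.2 y) (t, z)
  f₃_partials : ∀ᶠ p in 𝓝 (t, z), ∀ y : ℝ, SecondPartialsExistAt (fun s w => f₃ s w y) p
  f₃_partials_cont : ∀ k₁ k₂ : ℕ, k₁ + k₂ = 2 →
    ContAtUniformly (fun (p : ℝ × ℝ) (y : ℝ) => pderiv k₁ k₂ (fun s w => f₃ s w y) p.1 p.2) (t, z)
  f₅_cont : ContAtUniformly
    (fun (q : ℝ × ℝ × ℝ) (y : ℝ × ℝ) => f₅ q.1 q.2.1 q.2.2 y.1 y.2) (t, t, z)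
  mean_smooth : HasContSecondPartials (condMean f₃) t z
  /-- The conditional second moment of `Y` is finite around `(t, z)`. -/
  second_moment : ∀ᶠ p in 𝓝 (t, z), Integrable (fun y : ℝ => y ^ 2 * f₃ p.1 p.2 y)
  /-- The conditional variance is continuous at `(t, z)`. -/
  var_cont : ContinuousAt (fun p : ℝ × ℝ => condVar f₃ p.1 p.2) (t, z)
  /-- The design density and the covariance of pairs are bounded around `(t, t, z)`. -/
  pair_bdd : ∃ C : ℝ, ∀ᶠ q in 𝓝 (t, t, z),
    |pairDesignDensity f₅ q.1 q.2.1 q.2.2| ≤ C ∧ |pairCovDensity f₃ f₅ q.1 q.2.1 q.2.2| ≤ C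

/-! ### The sampling scheme -/

variable {Ω : Type*} [MeasurableSpace Ω]

/-- Random design with repeated measurements. Subject `i` has the covariate `Z i` and the
potential measurement times and responses `T i j`, `Y i j`; in a sample of `n` subjects
`i = 0, …, n - 1`, the first `N n i` of these are observed. Measurements on one subject
may be dependent; subjects are independent. -/
structure SamplingModel (P : Measure Ω) (T Y : ℕ → ℕ → Ω → ℝ) (Z : ℕ → Ω → ℝ)
    (N : ℕ → ℕ → Ω → ℕ) (f₃ : ℝ → ℝ → ℝ → ℝ) (f₅ : ℝ → ℝ → ℝ → ℝ → ℝ → ℝ) : Prop where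
  measurable_T : ∀ i j, Measurable (T i j)
  measurable_Y : ∀ i j, Measurable (Y i j)
  measurable_Z : ∀ i, Measurable (Z i)
  measurable_N : ∀ n i, Measurable (N n i)
  measurable_f₃ : Measurable (fun p : ℝ × ℝ × ℝ => f₃ p.1 p.2.1 p.2.2)
  measurable_f₅ : Measurable
    (fun p : ℝ × ℝ × ℝ × ℝ × ℝ => f₅ p.1 p.2.1 p.2.2.1 p.2.2.2.1 p.2.2.2.2)
  f₃_nonneg : ∀ t z y, 0 ≤ f₃ t z y
  f₅_nonneg : ∀ t₁ t₂ z y₁ y₂, 0 ≤ f₅ t₁ t₂ z y₁ y₂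
  law₃ : ∀ i j, P.map (fun ω => (T i j ω, Z i ω, Y i j ω)) =
    (volume : Measure (ℝ × ℝ × ℝ)).withDensity
      (fun p => ENNReal.ofReal (f₃ p.1 p.2.1 p.2.2))
  law₅ : ∀ i j k, j ≠ k →
    P.map (fun ω => (T i j ω, T i k ω, Z i ω, Y i j ω, Y i k ω)) =
      (volume : Measure (ℝ × ℝ × ℝ × ℝ × ℝ)).withDensity
        (fun p => ENNReal.ofReal (f₅ p.1 p.2.1 p.2.2.1 p.2.2.2.1 p.2.2.2.2))
  /-- The subjects are independent of each other. -/
  indep_subjects : iIndepFun (fun (i : ℕ) (ω : Ω) => (Z i ω, fun j : ℕ => (T i j ω, Y i j ω))) P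
  /-- For each `n`, the numbers of measurements are i.i.d. and positive. -/
  indep_N : ∀ n, iIndepFun (fun i : ℕ => N n i) P
  ident_N : ∀ n i, IdentDistrib (N n i) (N n 0) P P
  pos_N : ∀ n i, ∀ᵐ ω ∂P, 1 ≤ N n i ω
  /-- The numbers of measurements are independent of all other variables. -/
  indep_N_data : ∀ n, IndepFun (fun (ω : Ω) (i : ℕ) => N n i ω)
    (fun (ω : Ω) (i : ℕ) => (Z i ω, fun j : ℕ => (T i j ω, Y i j ω))) P

/-- The moment `E N(n)^k`, where `N(n)` is distributed as each of the `N n i`. -/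
def momentN (P : Measure Ω) (N : ℕ → ℕ → Ω → ℕ) (k n : ℕ) : ℝ := ∫ ω, (N n 0 ω : ℝ) ^ k ∂P

/-- Moment conditions on the number of measurements: `E N⁴` is finite and
`limsup E N²/(E N)²` and `limsup E N⁴/(E N²)²` are finite. -/
structure CountMoments (P : Measure Ω) (N : ℕ → ℕ → Ω → ℕ) : Prop where
  integrable : ∀ n, Integrable (fun ω => (N n 0 ω : ℝ) ^ 4) P
  second : IsBoundedUnder (· ≤ ·) atTop (fun n => momentN P N 2 n / momentN P N 1 n ^ 2)
  fourth : IsBoundedUnder (· ≤ ·) atTop (fun n => momentN P N 4 n / momentN P N 2 n ^ 2)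

/-- Bandwidth conditions. Comparability of the two bandwidths and boundedness of
`n E(N) h⁶` are contained in the last two fields. -/
structure BandwidthConditions (P : Measure Ω) (N : ℕ → ℕ → Ω → ℕ) (ht hz : ℕ → ℝ)
    (ρ τ : ℝ) : Prop where
  ht_pos : ∀ n, 0 < ht n
  hz_pos : ∀ n, 0 < hz n
  ht_tendsto : Tendsto ht atTop (𝓝 0)
  effective_size : Tendsto (fun n : ℕ => n * momentN P N 1 n * ht n ^ 2) atTop atTop
  sparse : Tendsto (fun n : ℕ => momentN P N 1 n * ht n) atTop (𝓝 0)
  ratio : Tendsto (fun n => hz n / ht n) atTop (𝓝 ρ)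
  rate : Tendsto (fun n : ℕ => n * momentN P N 1 n * ht n ^ 6) atTop (𝓝 (τ ^ 2))

/-! ### The local linear estimator -/

/-- The kernel weighted least squares criterion at `b = (β₀, β₁, β₂)`. -/
def localCriterion (K : ℝ → ℝ → ℝ) (T Y : ℕ → ℕ → Ω → ℝ) (Z : ℕ → Ω → ℝ)
    (N : ℕ → ℕ → Ω → ℕ) (ht hz : ℕ → ℝ) (t z : ℝ) (n : ℕ) (ω : Ω) (b : ℝ × ℝ × ℝ) : ℝ :=
  ∑ i ∈ Finset.range n, ∑ j ∈ Finset.range (N n i ω),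
    K ((t - T i j ω) / ht n) ((z - Z i ω) / hz n) *
      (Y i j ω - b.1 - b.2.1 * (T i j ω - t) - b.2.2 * (Z i ω - z)) ^ 2

/-- `βhat n` is a random vector that almost surely minimizes the local least squares criterion
whenever a minimizer exists. The local linear estimator of `μ(t, z)` is its first component. -/
structure IsLocalLinearFit (P : Measure Ω) (K : ℝ → ℝ → ℝ) (T Y : ℕ → ℕ → Ω → ℝ) (Z : ℕ → Ω → ℝ)
    (N : ℕ → ℕ → Ω → ℕ) (ht hz : ℕ → ℝ) (t z : ℝ) (βhat : ℕ → Ω → ℝ × ℝ × ℝ) : Prop where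
  aemeasurable : ∀ n, AEMeasurable (βhat n) P
  minimizes : ∀ n, ∀ᵐ ω ∂P,
    (∃ b, IsMinOn (localCriterion K T Y Z N ht hz t z n ω) Set.univ b) →
      IsMinOn (localCriterion K T Y Z N ht hz t z n ω) Set.univ (βhat n ω)

/-- The average number `N̄` of measurements per subject. -/
def averageN (N : ℕ → ℕ → Ω → ℕ) (n : ℕ) (ω : Ω) : ℝ :=
  (∑ i ∈ Finset.range n, (N n i ω : ℝ)) / n

/-! ### The limit -/

/-- The asymptotic bias `β_L`. -/
def biasL (K : ℝ → ℝ → ℝ) (f₃ : ℝ → ℝ → ℝ → ℝ) (ρ τ t z : ℝ) : ℝ :=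
  ∑ k ∈ Finset.HasAntidiagonal.antidiagonal (2 : ℕ),
    1 / ((k.1.factorial : ℝ) * (k.2.factorial : ℝ)) * kernelMoment K k.1 k.2 *
      pderiv k.1 k.2 (condMean f₃) t z * τ * √(ρ ^ (2 * k.2 + 1))

/-- The asymptotic variance `Σ_L`. -/
def varL (K : ℝ → ℝ → ℝ) (f₃ : ℝ → ℝ → ℝ → ℝ) (t z : ℝ) : ℝ :=
  condVar f₃ t z * kernelNormSq K / designDensity f₃ t z

end MeanSurface

end

namespace MeanSurface

/-! ### The Lindeberg central limit theorem -/

/-! Write `q = n E(N) h_t h_z` for the expected effective sample size. In the coordinates `√q (β₀ -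
μ)`, `-√q h_t (β₁ - ∂_t μ)`, `-√q h_z (β₂ - ∂_z μ)` the least squares criterion is a constant minus
twice a linear form plus a quadratic form (`localCriterion_eq`). The matrix of the quadratic form
consists of normalized sums of the kernel times monomials. The linear form has coefficients that
split into a part built from the Taylor remainder of `μ`, which depends on the design only, and a
part built from the residuals `Y - μ(T, Z)`. Where the matrix is positive definite, Cramer's rule
gives the first coordinate of the minimizer (`quadratic_minimizer`).

The matrix converges in probability to `f₂(t, z)` times the moment matrix of the kernel. As the
first moments vanish, the first row of the limiting inverse is `(1/f₂, 0, 0)`, so only the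
coefficient with the unweighted kernel survives. Its remainder part tends to a constant because `√q
h_t²` tends to `τ √ρ`; this is the bias `β_L`. Its residual part is asymptotically normal by
Lindeberg's theorem over subjects. Slutsky's lemma combines the pieces, and `N̄ / E N → 1` in
probability permits the random normalization.

Dependence within a subject does not matter, because two measurements count together only if both
times lie in a window of width of order `h_t`. The expectation of a pair product is therefore
smaller by a factor `h_t` than that of a square (`SamplingModel.abs_pairMean_le`), and relative to
the diagonal the pairs contribute a multiple of `(E N² / E N) h_t`, which tends to zero
(`BandwidthConditions.count_ratio_mul_tendsto`). Second moments thus behave as if all measurements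
were independent.

Only second moments of `Y` are available, so the Lindeberg condition cannot come from a higher
moment. A subject sum is large only if one of its terms is large or at least two are nonzero
(`sq_sum_tail_le`). The second case is again a pair term. For the first, the rescaled squared noise
converges in `L¹` by Scheffé's lemma and is therefore uniformly integrable
(`SamplingModel.exists_noise_tail_le`). -/

lemma norm_prod_sub_prod_le {ι : Type*} (s : Finset ι) (f g : ι → ℂ)
    (hf : ∀ i ∈ s, ‖f i‖ ≤ 1) (hg : ∀ i ∈ s, ‖g i‖ ≤ 1) :
    ‖∏ i ∈ s, f i - ∏ i ∈ s, g i‖ ≤ ∑ i ∈ s, ‖f i - g i‖ := by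
  classical
  induction s using Finset.induction_on with
  | empty => simp
  | insert a s ha ih =>
    rw [Finset.prod_insert ha, Finset.prod_insert ha, Finset.sum_insert ha]
    have h1 : f a * ∏ i ∈ s, f i - g a * ∏ i ∈ s, g i =
        (f a - g a) * ∏ i ∈ s, f i + g a * (∏ i ∈ s, f i - ∏ i ∈ s, g i) := by ring
    have h2 : ‖∏ i ∈ s, f i‖ ≤ 1 := by
      rw [norm_prod]
      exact Finset.prod_le_one (fun _ _ => norm_nonneg _)
        fun i hi => hf i (Finset.mem_insert_of_mem hi)
    have h3 := ih (fun i hi => hf i (Finset.mem_insert_of_mem hi))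
      fun i hi => hg i (Finset.mem_insert_of_mem hi)
    have h4 := hg a (Finset.mem_insert_self a s)
    rw [h1]
    refine (norm_add_le _ _).trans (add_le_add ?_ ?_)
    · rw [norm_mul]
      exact mul_le_of_le_one_right (norm_nonneg _) h2
    · rw [norm_mul]
      exact (mul_le_of_le_one_left (norm_nonneg _) h4).trans h3

lemma norm_exp_mul_I_sub_taylor_le_cube {x : ℝ} (hx : |x| ≤ 1) :
    ‖Complex.exp (x * Complex.I) - (1 + x * Complex.I - x ^ 2 / 2)‖ ≤ 3 * |x| ^ 3 := by
  have h := Complex.norm_exp_sub_sum_le_norm_mul_exp (x * Complex.I) 3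
  have h0 : ∑ m ∈ Finset.range 3, (x * Complex.I) ^ m / m.factorial =
      1 + x * Complex.I - (x : ℂ) ^ 2 / 2 := by
    simp [Finset.sum_range_succ, Nat.factorial, mul_pow]
    ring
  have h1 : ‖(x * Complex.I : ℂ)‖ = |x| := by simp
  rw [h0, h1] at h
  refine h.trans ?_
  rw [mul_comm]
  gcongr
  calc Real.exp |x| ≤ Real.exp 1 := Real.exp_le_exp.2 hx
    _ ≤ 3 := by linarith [Real.exp_one_lt_d9]

lemma norm_exp_mul_I_sub_taylor_le_sq (x : ℝ) :
    ‖Complex.exp (x * Complex.I) - (1 + x * Complex.I - x ^ 2 / 2)‖ ≤ 4 * x ^ 2 := by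
  rcases le_total |x| 1 with hx | hx
  · refine (norm_exp_mul_I_sub_taylor_le_cube hx).trans ?_
    rw [← sq_abs x]
    nlinarith [abs_nonneg x, sq_nonneg |x|, pow_le_one₀ (n := 1) (abs_nonneg x) hx,
      mul_le_mul_of_nonneg_left hx (sq_nonneg |x|)]
  · have h1 : ‖Complex.exp (x * Complex.I)‖ = 1 := Complex.norm_exp_ofReal_mul_I x
    have h2 : ‖(1 + x * Complex.I - x ^ 2 / 2 : ℂ)‖ ≤ 1 + |x| + x ^ 2 / 2 := by
      refine (norm_sub_le _ _).trans (add_le_add ((norm_add_le _ _).trans ?_) ?_)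
      · simp
      · simp
    refine (norm_sub_le _ _).trans ?_
    rw [h1]
    rw [← sq_abs x] at h2 ⊢
    nlinarith

/-- Truncation at level `ε`: below it the cubic bound applies and one factor `|w|` is traded for
`ε`; above it the quadratic bound, valid everywhere, is used. The condition on `|u| * ε` keeps the
argument of the cubic bound in its range. -/
lemma norm_exp_mul_I_sub_taylor_le {u w ε : ℝ} (h0 : 0 ≤ ε) (hε : |u| * ε ≤ 1) :
    ‖Complex.exp ((u * w : ℝ) * Complex.I) - (1 + (u * w : ℝ) * Complex.I - (u * w : ℝ) ^ 2 / 2)‖ ≤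
      3 * |u| ^ 3 * ε * w ^ 2 + 4 * u ^ 2 * (w ^ 2 * (if ε < |w| then 1 else 0)) := by
  split_ifs with h
  · refine (norm_exp_mul_I_sub_taylor_le_sq _).trans ?_
    have : 0 ≤ 3 * |u| ^ 3 * ε * w ^ 2 := by positivity
    nlinarith
  · push Not at h
    have h1 : |u * w| ≤ 1 := by
      rw [abs_mul]
      exact (mul_le_mul_of_nonneg_left h (abs_nonneg u)).trans hε
    refine (norm_exp_mul_I_sub_taylor_le_cube h1).trans ?_
    rw [abs_mul, mul_pow, ← sq_abs w]
    have : |w| ^ 3 ≤ ε * |w| ^ 2 := by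
      rw [pow_succ, mul_comm]
      gcongr
    nlinarith [mul_le_mul_of_nonneg_left this (pow_nonneg (abs_nonneg u) 3)]

variable {Ω : Type*} [MeasurableSpace Ω]

lemma integrable_mul_ite_one_zero {P : Measure Ω} {f : Ω → ℝ} {p : Ω → Prop} [DecidablePred p]
    (hf : Integrable f P) (hp : NullMeasurableSet {ω | p ω} P) :
    Integrable (fun ω => f ω * (if p ω then 1 else 0)) P := by
  have : (fun ω => f ω * (if p ω then 1 else 0)) = {ω | p ω}.indicator f := by
    ext ω
    by_cases h : p ω <;> simp [h]
  rw [this]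
  exact hf.indicator₀ hp

lemma nullMeasurableSet_lt_abs {P : Measure Ω} {f : Ω → ℝ} (hf : AEMeasurable f P) (c : ℝ) :
    NullMeasurableSet {ω | c < |f ω|} P :=
  nullMeasurableSet_lt aemeasurable_const hf.abs

lemma norm_charFun_map_sub_le {P : Measure Ω} [IsProbabilityMeasure P] {X : Ω → ℝ}
    (hX : MemLp X 2 P) (h0 : ∫ ω, X ω ∂P = 0) {u ε : ℝ} (hε0 : 0 ≤ ε) (hε : |u| * ε ≤ 1) :
    ‖charFun (P.map X) u - (1 - (u ^ 2 * ∫ ω, X ω ^ 2 ∂P : ℝ) / 2)‖ ≤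
      3 * |u| ^ 3 * ε * (∫ ω, X ω ^ 2 ∂P) +
        4 * u ^ 2 * ∫ ω, X ω ^ 2 * (if ε < |X ω| then 1 else 0) ∂P := by
  have hm : AEMeasurable X P := hX.aemeasurable
  have hX1 : Integrable X P := hX.integrable (by norm_num)
  have hX2 : Integrable (fun ω => X ω ^ 2) P := hX.integrable_sq
  have hX3 := integrable_mul_ite_one_zero hX2 (nullMeasurableSet_lt_abs hm ε)
  have e1 : charFun (P.map X) u = ∫ ω, Complex.exp ((u * X ω : ℝ) * Complex.I) ∂P := by
    rw [charFun_apply_real, integral_map hm (by fun_prop)]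
    simp
  have i1 : Integrable (fun ω => Complex.exp ((u * X ω : ℝ) * Complex.I)) P := by
    refine (integrable_const (1 : ℝ)).mono' (by fun_prop) (ae_of_all _ fun ω => ?_)
    rw [Complex.norm_exp_ofReal_mul_I]
  have i2 : Integrable (fun ω => (1 + (u * X ω : ℝ) * Complex.I - (u * X ω : ℝ) ^ 2 / 2 : ℂ)) P := by
    refine ((integrable_const _).add ?_).sub ?_
    · exact (hX1.const_mul u).ofReal.mul_const _
    · have : Integrable (fun ω => (((u * X ω) ^ 2 / 2 : ℝ) : ℂ)) P := by
        refine Integrable.ofReal ?_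
        simp_rw [mul_pow]
        exact (hX2.const_mul _).div_const _
      simpa using this
  have e2 : ∫ ω, (1 + (u * X ω : ℝ) * Complex.I - (u * X ω : ℝ) ^ 2 / 2 : ℂ) ∂P =
      1 - (u ^ 2 * ∫ ω, X ω ^ 2 ∂P : ℝ) / 2 := by
    have j1 : Integrable (fun ω => ((u * X ω : ℝ) * Complex.I : ℂ)) P :=
      (hX1.const_mul u).ofReal.mul_const _
    have j2 : Integrable (fun ω => (((u * X ω) ^ 2 / 2 : ℝ) : ℂ)) P := by
      refine Integrable.ofReal ?_
      simp_rw [mul_pow]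
      exact (hX2.const_mul _).div_const _
    have : (fun ω => (1 + (u * X ω : ℝ) * Complex.I - (u * X ω : ℝ) ^ 2 / 2 : ℂ)) =
        fun ω => (1 + (u * X ω : ℝ) * Complex.I - (((u * X ω) ^ 2 / 2 : ℝ) : ℂ)) := by
      ext ω; push_cast; ring
    have j0 : Integrable (fun ω => (1 + (u * X ω : ℝ) * Complex.I : ℂ)) P :=
      (integrable_const _).add j1
    rw [this, integral_sub j0 j2, integral_add (integrable_const _) j1,
      integral_mul_const, integral_complex_ofReal, integral_complex_ofReal, integral_const_mul, h0, integral_div]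
    simp_rw [mul_pow]
    rw [integral_const_mul]
    simp
  rw [e1, ← e2, ← integral_sub i1 i2, ← integral_const_mul, ← integral_const_mul,
    ← integral_add (hX2.const_mul _) (hX3.const_mul _)]
  exact norm_integral_le_of_norm_le ((hX2.const_mul _).add (hX3.const_mul _))
    (ae_of_all _ fun ω => norm_exp_mul_I_sub_taylor_le hε0 hε)

/-- Under the Lindeberg condition this makes every single variance small, uniformly over the row of
the array. -/
lemma integral_sq_le_of_tail {P : Measure Ω} [IsProbabilityMeasure P] {X : Ω → ℝ}
    (hX : MemLp X 2 P) {ε : ℝ} (hε0 : 0 ≤ ε) :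
    ∫ ω, X ω ^ 2 ∂P ≤ ε ^ 2 + ∫ ω, X ω ^ 2 * (if ε < |X ω| then 1 else 0) ∂P := by
  have hX2 : Integrable (fun ω => X ω ^ 2) P := hX.integrable_sq
  have hX3 := integrable_mul_ite_one_zero hX2 (nullMeasurableSet_lt_abs hX.aemeasurable ε)
  have : ε ^ 2 = ∫ _, ε ^ 2 ∂P := by simp
  rw [this, ← integral_add (integrable_const _) hX3]
  refine integral_mono hX2 ((integrable_const _).add hX3) fun ω => ?_
  simp only
  split_ifs with h
  · nlinarith [sq_nonneg ε]
  · rw [← sq_abs]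
    push Not at h
    nlinarith [abs_nonneg (X ω)]

/-- The **Lindeberg central limit theorem** for a triangular array of independent centered
variables. -/
theorem tendstoInDistribution_sum_of_lindeberg {P : Measure Ω} [IsProbabilityMeasure P]
    {W : ℕ → ℕ → Ω → ℝ} (hm : ∀ n i, AEMeasurable (W n i) P) (hind : ∀ n, iIndepFun (W n) P)
    (hL2 : ∀ᶠ n in atTop, ∀ i < n, MemLp (W n i) 2 P)
    (hmean : ∀ᶠ n in atTop, ∀ i < n, ∫ ω, W n i ω ∂P = 0) {v : NNReal}
    (hvar : Tendsto (fun n => ∑ i ∈ Finset.range n, ∫ ω, W n i ω ^ 2 ∂P) atTop (𝓝 (v : ℝ)))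
    (hlind : ∀ ε : ℝ, 0 < ε → Tendsto (fun n => ∑ i ∈ Finset.range n,
      ∫ ω, W n i ω ^ 2 * (if ε < |W n i ω| then 1 else 0) ∂P) atTop (𝓝 0)) :
    TendstoInDistribution (fun n ω => ∑ i ∈ Finset.range n, W n i ω) atTop (id : ℝ → ℝ)
      (fun _ => P) (gaussianReal 0 v) where
  forall_aemeasurable n := Finset.aemeasurable_fun_sum _ fun i _ => hm n i
  tendsto := by
    -- Lévy's continuity theorem; the product of characteristic functions is compared, factor by
    -- factor, with the product of the Gaussian ones of the same variances.
    refine ProbabilityMeasure.tendsto_iff_tendsto_charFun.2 fun u => ?_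
    simp only [ProbabilityMeasure.coe_mk, Measure.map_id, charFun_gaussianReal]
    have e1 : ∀ n, charFun (P.map fun ω => ∑ i ∈ Finset.range n, W n i ω) u =
        ∏ i ∈ Finset.range n, charFun (P.map (W n i)) u := by
      intro n
      rw [((hind n).restrict _).charFun_map_fun_finsetSum_eq_prod (fun i _ => hm n i)]
      simp
    simp_rw [e1]
    set S := fun n => ∑ i ∈ Finset.range n, ∫ ω, W n i ω ^ 2 ∂P with hS
    set L := fun (ε : ℝ) n => ∑ i ∈ Finset.range n,
      ∫ ω, W n i ω ^ 2 * (if ε < |W n i ω| then 1 else 0) ∂P with hL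
    have lim : Tendsto (fun n => Complex.exp ((-(u ^ 2 * S n / 2) : ℝ) : ℂ)) atTop
        (𝓝 (Complex.exp (u * (0 : ℝ) * Complex.I - v * u ^ 2 / 2))) := by
      have : (u * (0 : ℝ) * Complex.I - v * u ^ 2 / 2 : ℂ) = ((-(u ^ 2 * v / 2) : ℝ) : ℂ) := by
        push_cast; ring
      rw [this]
      refine (Complex.continuous_exp.tendsto _).comp ((Complex.continuous_ofReal.tendsto _).comp ?_)
      exact ((hvar.const_mul _).div_const _).neg
    refine (tendsto_iff_norm_sub_tendsto_zero.2 ?_ :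
      Tendsto (fun n => (∏ i ∈ Finset.range n, charFun (P.map (W n i)) u) -
        Complex.exp ((-(u ^ 2 * S n / 2) : ℝ) : ℂ)) atTop (𝓝 0)).add lim |>.congr
          (fun n => by ring) |>.trans (by rw [zero_add])
    simp_rw [sub_zero]
    -- The three error terms are the small part of the Taylor expansion, its tail part, and the
    -- error of replacing `1 - x` by `exp (-x)`.
    have key : ∀ ε : ℝ, 0 < ε → |u| * ε ≤ 1 → ∀ᶠ n in atTop, (u ^ 2 / 2) * (ε ^ 2 + L ε n) ≤ 1 →
        ‖(∏ i ∈ Finset.range n, charFun (P.map (W n i)) u) -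
        Complex.exp ((-(u ^ 2 * S n / 2) : ℝ) : ℂ)‖ ≤
        3 * |u| ^ 3 * ε * S n + 4 * u ^ 2 * L ε n +
          (u ^ 2 / 2) ^ 2 * (ε ^ 2 + L ε n) * S n := by
      intro ε hε0 hε
      filter_upwards [hL2, hmean] with n h2 h3 hsmall
      have e2 : Complex.exp ((-(u ^ 2 * S n / 2) : ℝ) : ℂ) = ∏ i ∈ Finset.range n,
          Complex.exp ((-(u ^ 2 * (∫ ω, W n i ω ^ 2 ∂P) / 2) : ℝ) : ℂ) := by
        rw [← Complex.exp_sum, ← Complex.ofReal_sum]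
        congr 2
        rw [hS, Finset.mul_sum, Finset.sum_div, Finset.sum_neg_distrib]
      rw [e2]
      refine (norm_prod_sub_prod_le _ _ _ (fun i _ => ?_) fun i _ => ?_).trans ?_
      · have := Measure.isProbabilityMeasure_map (μ := P) (hm n i)
        exact norm_charFun_le_one u
      · rw [Complex.norm_exp_ofReal, Real.exp_le_one_iff, neg_nonpos]
        have : 0 ≤ ∫ ω, W n i ω ^ 2 ∂P := integral_nonneg fun _ => sq_nonneg _
        positivity
      · have hbd : ∀ i ∈ Finset.range n, ‖charFun (P.map (W n i)) u -
            Complex.exp ((-(u ^ 2 * (∫ ω, W n i ω ^ 2 ∂P) / 2) : ℝ) : ℂ)‖ ≤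
            3 * |u| ^ 3 * ε * (∫ ω, W n i ω ^ 2 ∂P) + 4 * u ^ 2 *
              (∫ ω, W n i ω ^ 2 * (if ε < |W n i ω| then 1 else 0) ∂P) +
            (u ^ 2 / 2) ^ 2 * (ε ^ 2 + L ε n) * ∫ ω, W n i ω ^ 2 ∂P := by
          intro i hi
          have hi' := Finset.mem_range.1 hi
          have a1 := norm_charFun_map_sub_le (h2 i hi') (h3 i hi') hε0.le hε
          set s := ∫ ω, W n i ω ^ 2 ∂P with hs
          have s0 : 0 ≤ s := integral_nonneg fun _ => sq_nonneg _
          -- A single tail integral is at most the whole Lindeberg sum. In the quadratic error of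
          -- the exponential, one factor `s` is later replaced by this bound and the other is summed
          -- to `S n`.
          have s1 : s ≤ ε ^ 2 + L ε n := by
            refine (integral_sq_le_of_tail (h2 i hi') hε0.le).trans ?_
            gcongr
            refine Finset.single_le_sum (f := fun i =>
              ∫ ω, W n i ω ^ 2 * (if ε < |W n i ω| then 1 else 0) ∂P) (fun j _ => ?_) hi
            refine integral_nonneg fun ω => ?_
            simp only [Pi.zero_apply]
            positivity
          have s2 : |(-(u ^ 2 * s / 2))| ≤ 1 := by
            rw [abs_neg, abs_of_nonneg (by positivity)]
            refine le_trans ?_ hsmall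
            rw [mul_div_right_comm]
            gcongr
          have a2 := Real.abs_exp_sub_one_sub_id_le s2
          have a3 : ‖(1 - (u ^ 2 * s : ℝ) / 2 : ℂ) - Complex.exp ((-(u ^ 2 * s / 2) : ℝ) : ℂ)‖ ≤
              (u ^ 2 / 2) ^ 2 * (ε ^ 2 + L ε n) * s := by
            have : (1 - (u ^ 2 * s : ℝ) / 2 : ℂ) - Complex.exp ((-(u ^ 2 * s / 2) : ℝ) : ℂ) =
                ((-(Real.exp (-(u ^ 2 * s / 2)) - 1 - -(u ^ 2 * s / 2)) : ℝ) : ℂ) := by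
              push_cast; ring
            rw [this, Complex.norm_real, norm_neg, Real.norm_eq_abs]
            refine a2.trans ?_
            have : (-(u ^ 2 * s / 2)) ^ 2 = (u ^ 2 / 2) ^ 2 * s * s := by ring
            rw [this]
            gcongr
          refine (norm_sub_le_norm_sub_add_norm_sub _ _ _).trans (add_le_add a1 a3)
        refine (Finset.sum_le_sum hbd).trans (le_of_eq ?_)
        rw [Finset.sum_add_distrib, Finset.sum_add_distrib, ← Finset.mul_sum, ← Finset.mul_sum,
          ← Finset.mul_sum]
    refine tendsto_order.2 ⟨fun a ha => Eventually.of_forall fun n => ha.trans_le (norm_nonneg _),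
      fun η hη => ?_⟩
    -- `ε` is fixed before `n` grows: the limit in `n` of the bound is continuous in `ε` and
    -- vanishes at `ε = 0`.
    obtain ⟨ε, hε0, c1, c2, c3⟩ : ∃ ε : ℝ, 0 < ε ∧ |u| * ε < 1 ∧ (u ^ 2 / 2) * (ε ^ 2 + 0) < 1 ∧
        3 * |u| ^ 3 * ε * v + 4 * u ^ 2 * 0 + (u ^ 2 / 2) ^ 2 * (ε ^ 2 + 0) * v < η := by
      have h1 : ∀ᶠ ε in 𝓝[>] (0 : ℝ), |u| * ε < 1 :=
        nhdsWithin_le_nhds ((by fun_prop : Continuous fun ε : ℝ => |u| * ε).tendsto' 0 0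
          (by simp) |>.eventually_lt_const one_pos)
      have h2 : ∀ᶠ ε in 𝓝[>] (0 : ℝ), (u ^ 2 / 2) * (ε ^ 2 + 0) < 1 :=
        nhdsWithin_le_nhds ((by fun_prop : Continuous fun ε : ℝ => (u ^ 2 / 2) * (ε ^ 2 + 0)).tendsto'
          0 0 (by simp) |>.eventually_lt_const one_pos)
      have h3 : ∀ᶠ ε in 𝓝[>] (0 : ℝ),
          3 * |u| ^ 3 * ε * v + 4 * u ^ 2 * 0 + (u ^ 2 / 2) ^ 2 * (ε ^ 2 + 0) * v < η :=
        nhdsWithin_le_nhds ((by fun_prop : Continuous fun ε : ℝ =>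
          3 * |u| ^ 3 * ε * v + 4 * u ^ 2 * 0 + (u ^ 2 / 2) ^ 2 * (ε ^ 2 + 0) * v).tendsto' 0 0
          (by simp) |>.eventually_lt_const hη)
      have h0 : ∀ᶠ ε in 𝓝[>] (0 : ℝ), 0 < ε := self_mem_nhdsWithin
      obtain ⟨ε, ⟨⟨a1, a2⟩, a3⟩, a4⟩ := (((h0.and h1).and h2).and h3).exists
      exact ⟨ε, a1, a2, a3, a4⟩
    have t1 : Tendsto (L ε) atTop (𝓝 0) := hlind ε hε0
    have t2 : Tendsto (fun n => (u ^ 2 / 2) * (ε ^ 2 + L ε n)) atTop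
        (𝓝 ((u ^ 2 / 2) * (ε ^ 2 + 0))) := (t1.const_add _).const_mul _
    have t3 : Tendsto (fun n => 3 * |u| ^ 3 * ε * S n + 4 * u ^ 2 * L ε n +
        (u ^ 2 / 2) ^ 2 * (ε ^ 2 + L ε n) * S n) atTop
        (𝓝 (3 * |u| ^ 3 * ε * v + 4 * u ^ 2 * 0 + (u ^ 2 / 2) ^ 2 * (ε ^ 2 + 0) * v)) :=
      ((hvar.const_mul _).add (t1.const_mul _)).add (((t1.const_add _).const_mul _).mul hvar)
    filter_upwards [key ε hε0 c1.le, t2.eventually_lt_const c2, t3.eventually_lt_const c3]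
      with n k1 k2 k3
    exact (k1 k2.le).trans_lt k3


/-! ### Second-order Taylor expansion at a point -/

lemma abs_sub_sub_mul_le_of_deriv {f : ℝ → ℝ} {x b c ε : ℝ}
    (hf : ∀ s ∈ Set.uIcc x (x + b), DifferentiableAt ℝ f s)
    (hc : ∀ s ∈ Set.uIcc x (x + b), |deriv f s - c| ≤ ε) :
    |f (x + b) - f x - b * c| ≤ ε * |b| := by
  have h := (convex_uIcc x (x + b)).norm_image_sub_le_of_norm_deriv_le (𝕜 := ℝ)
    (f := fun s => f s - s * c) (C := ε)
    (fun s hs => (hf s hs).sub (by fun_prop)) (fun s hs => ?_)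
    (Set.left_mem_uIcc) (Set.right_mem_uIcc)
  · rw [Real.norm_eq_abs, Real.norm_eq_abs, add_sub_cancel_left] at h
    convert h using 2
    ring
  · rw [deriv_fun_sub (hf s hs) (by fun_prop)]
    simpa using hc s hs

/-- The mean value inequality is applied to `f` minus its candidate quadratic polynomial, and the
derivative of the difference is controlled by the same inequality one order lower. Closeness of the
second derivative to `c` suffices; its continuity along the segment is not needed. -/
lemma abs_taylor_two_le_of_deriv_deriv {f : ℝ → ℝ} {x b c ε : ℝ}
    (hf : ∀ s ∈ Set.uIcc x (x + b), DifferentiableAt ℝ f s)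
    (hf' : ∀ s ∈ Set.uIcc x (x + b), DifferentiableAt ℝ (deriv f) s)
    (hc : ∀ s ∈ Set.uIcc x (x + b), |deriv (deriv f) s - c| ≤ ε) :
    |f (x + b) - f x - b * deriv f x - b ^ 2 / 2 * c| ≤ ε * b ^ 2 := by
  have hε : 0 ≤ ε := (abs_nonneg _).trans (hc x Set.left_mem_uIcc)
  have h := (convex_uIcc x (x + b)).norm_image_sub_le_of_norm_deriv_le (𝕜 := ℝ)
    (f := fun s => f s - (s - x) * deriv f x - (s - x) ^ 2 / 2 * c) (C := ε * |b|)
    (fun s hs => ((hf s hs).sub (by fun_prop)).sub (by fun_prop)) (fun s hs => ?_)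
    (Set.left_mem_uIcc) (Set.right_mem_uIcc)
  · rw [Real.norm_eq_abs, Real.norm_eq_abs, add_sub_cancel_left, mul_assoc, ← sq, sq_abs] at h
    convert h using 2
    ring
  · have hd : deriv (fun s => f s - (s - x) * deriv f x - (s - x) ^ 2 / 2 * c) s =
        deriv f s - deriv f x - (s - x) * c := by
      have h1 : HasDerivAt f (deriv f s) s := (hf s hs).hasDerivAt
      have h2 : HasDerivAt (fun s : ℝ => s - x) 1 s := (hasDerivAt_id s).sub_const x
      have h3 := (h1.sub (h2.mul_const (deriv f x))).sub (((h2.pow 2).div_const 2).mul_const c)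
      refine (HasDerivAt.deriv h3).trans ?_
      simp only [Nat.cast_ofNat]
      ring
    rw [hd]
    have hsub : Set.uIcc x (x + (s - x)) ⊆ Set.uIcc x (x + b) := by
      rw [add_sub_cancel]
      exact Set.uIcc_subset_uIcc Set.left_mem_uIcc hs
    have h4 := abs_sub_sub_mul_le_of_deriv (f := deriv f) (x := x) (b := s - x) (c := c) (ε := ε)
      (fun r hr => hf' r (hsub hr)) (fun r hr => hc r (hsub hr))
    rw [add_sub_cancel] at h4
    refine h4.trans (mul_le_mul_of_nonneg_left ?_ hε)
    have := Set.abs_sub_left_of_mem_uIcc hs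
    rwa [add_sub_cancel_left] at this

lemma pderiv_one_zero (f : ℝ → ℝ → ℝ) (s w : ℝ) :
    pderiv 1 0 f s w = deriv (fun r => f r w) s := by
  simp [pderiv, iteratedDeriv_one]

lemma pderiv_zero_one (f : ℝ → ℝ → ℝ) (s w : ℝ) :
    pderiv 0 1 f s w = deriv (fun r => f s r) w := by
  simp [pderiv, iteratedDeriv_one]

lemma pderiv_two_zero (f : ℝ → ℝ → ℝ) (s w : ℝ) :
    pderiv 2 0 f s w = deriv (deriv fun r => f r w) s := by
  simp [pderiv, iteratedDeriv_succ]

lemma pderiv_one_one (f : ℝ → ℝ → ℝ) (s w : ℝ) :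
    pderiv 1 1 f s w = deriv (fun r => deriv (fun x => f r x) w) s := by
  simp [pderiv, iteratedDeriv_one]

lemma pderiv_zero_two (f : ℝ → ℝ → ℝ) (s w : ℝ) :
    pderiv 0 2 f s w = deriv (deriv fun r => f s r) w := by
  simp [pderiv, iteratedDeriv_succ]

/-- The quadratic part of the Taylor expansion of `f` at `(t, z)`. -/
noncomputable def taylorQuad (f : ℝ → ℝ → ℝ) (t z a b : ℝ) : ℝ :=
  a ^ 2 / 2 * pderiv 2 0 f t z + a * b * pderiv 1 1 f t z + b ^ 2 / 2 * pderiv 0 2 f t z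

/-- The error of the first-order Taylor polynomial of `f` at `(t, z)` in the point `(s, w)`. -/
noncomputable def linRemainder (f : ℝ → ℝ → ℝ) (t z s w : ℝ) : ℝ :=
  f s w - f t z - (s - t) * pderiv 1 0 f t z - (w - z) * pderiv 0 1 f t z

theorem HasContSecondPartials.taylor {f : ℝ → ℝ → ℝ} {t z : ℝ} (h : HasContSecondPartials f t z)
    {ε : ℝ} (hε : 0 < ε) : ∀ᶠ p in 𝓝 (t, z),
      |linRemainder f t z p.1 p.2 - taylorQuad f t z (p.1 - t) (p.2 - z)| ≤
        ε * ((p.1 - t) ^ 2 + (p.2 - z) ^ 2) := by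
  obtain ⟨h1, h2⟩ := h
  have hc : ∀ k₁ k₂ : ℕ, k₁ + k₂ = 2 → ∀ᶠ p in 𝓝 (t, z),
      |pderiv k₁ k₂ f p.1 p.2 - pderiv k₁ k₂ f t z| ≤ ε / 2 := by
    intro k₁ k₂ hk
    have := (Metric.continuousAt_iff'.1 (h2 k₁ k₂ hk)) (ε / 2) (by positivity)
    filter_upwards [this] with p hp
    exact hp.le
  have hall := h1.and ((hc 2 0 rfl).and ((hc 1 1 rfl).and (hc 0 2 rfl)))
  obtain ⟨δ, hδ, hball⟩ := Metric.eventually_nhds_iff.1 hall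
  refine Metric.eventually_nhds_iff.2 ⟨δ, hδ, fun p hp => ?_⟩
  obtain ⟨s, w⟩ := p
  rw [Prod.dist_eq, max_lt_iff, Real.dist_eq, Real.dist_eq] at hp
  obtain ⟨hs, hw⟩ := hp
  simp only at hs hw
  have hb : ∀ r x, |r - t| < δ → |x - z| < δ → _ := fun r x hr hx =>
    @hball (r, x) (by rw [Prod.dist_eq, max_lt_iff]; exact ⟨hr, hx⟩)
  simp only [SecondPartialsExistAt, pderiv_two_zero, pderiv_one_one, pderiv_zero_two,
    pderiv_one_zero, pderiv_zero_one] at hb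
  have hsm : ∀ r ∈ Set.uIcc t (t + (s - t)), |r - t| < δ := fun r hr =>
    (Set.abs_sub_left_of_mem_uIcc hr).trans_lt (by rwa [add_sub_cancel])
  have hwm : ∀ r ∈ Set.uIcc z (z + (w - z)), |r - z| < δ := fun r hr =>
    (Set.abs_sub_left_of_mem_uIcc hr).trans_lt (by rwa [add_sub_cancel])
  have hz : |z - z| < δ := by simpa using hδ
  -- The path from `(t, z)` to `(s, w)` runs first in `s` at height `z`, then in `w` at abscissa
  -- `s`. The second leg starts with slope `∂_z f (s, z)`, which `k3` compares with the slope at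
  -- `(t, z)`; this is where the mixed derivative `∂_t ∂_z`, in this order, enters.
  have k1 := abs_taylor_two_le_of_deriv_deriv (f := fun r => f r z) (x := t) (b := s - t)
    (c := pderiv 2 0 f t z) (ε := ε / 2)
    (fun r hr => (hb r z (hsm r hr) hz).1.1)
    (fun r hr => (hb r z (hsm r hr) hz).1.2.2.1)
    (fun r hr => by rw [pderiv_two_zero]; exact (hb r z (hsm r hr) hz).2.1)
  have k2 := abs_taylor_two_le_of_deriv_deriv (f := fun r => f s r) (x := z) (b := w - z)
    (c := pderiv 0 2 f t z) (ε := ε / 2)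
    (fun r hr => (hb s r hs (hwm r hr)).1.2.1)
    (fun r hr => (hb s r hs (hwm r hr)).1.2.2.2.2)
    (fun r hr => by rw [pderiv_zero_two]; exact (hb s r hs (hwm r hr)).2.2.2)
  have k3 := abs_sub_sub_mul_le_of_deriv (f := fun r => deriv (fun x => f r x) z) (x := t)
    (b := s - t) (c := pderiv 1 1 f t z) (ε := ε / 2)
    (fun r hr => (hb r z (hsm r hr) hz).1.2.2.2.1)
    (fun r hr => by rw [pderiv_one_one]; exact (hb r z (hsm r hr) hz).2.2.1)
  rw [add_sub_cancel] at k1 k2 k3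
  simp only [linRemainder, taylorQuad, pderiv_one_zero, pderiv_zero_one]
  set A := s - t
  set B := w - z
  have k4 : |B * (deriv (fun x => f s x) z - deriv (fun x => f t x) z - A * pderiv 1 1 f t z)| ≤
      ε / 2 * (|A| * |B|) := by
    rw [abs_mul]
    calc _ ≤ |B| * (ε / 2 * |A|) := by gcongr
      _ = _ := by ring
  have k5 : |A| * |B| ≤ (A ^ 2 + B ^ 2) / 2 := by
    rw [← sq_abs A, ← sq_abs B]
    nlinarith [sq_nonneg (|A| - |B|)]
  have k6 : ε / 2 * (|A| * |B|) ≤ ε / 2 * ((A ^ 2 + B ^ 2) / 2) := by gcongr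
  have k7 : 0 ≤ ε * A ^ 2 := by positivity
  have k8 : 0 ≤ ε * B ^ 2 := by positivity
  rw [abs_le] at k1 k2 k4 ⊢
  constructor
  · nlinarith
  · nlinarith

theorem HasContSecondPartials.exists_linRemainder_le {f : ℝ → ℝ → ℝ} {t z : ℝ}
    (h : HasContSecondPartials f t z) : ∃ C : ℝ, 0 ≤ C ∧ ∀ᶠ p in 𝓝 (t, z),
      |linRemainder f t z p.1 p.2| ≤ C * ((p.1 - t) ^ 2 + (p.2 - z) ^ 2) := by
  -- The three coefficients bound the quadratic part; the added `1` is the Taylor error with `ε =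
  -- 1`.
  refine ⟨|pderiv 2 0 f t z| + |pderiv 1 1 f t z| + |pderiv 0 2 f t z| + 1, by positivity, ?_⟩
  filter_upwards [h.taylor one_pos] with p hp
  set A := p.1 - t
  set B := p.2 - z
  have hq : |taylorQuad f t z A B| ≤ (|pderiv 2 0 f t z| + |pderiv 1 1 f t z| + |pderiv 0 2 f t z|)
      * (A ^ 2 + B ^ 2) := by
    unfold taylorQuad
    refine (abs_add_three _ _ _).trans ?_
    rw [abs_mul (A ^ 2 / 2), abs_mul (A * B), abs_mul (B ^ 2 / 2), abs_of_nonneg (by positivity : 0 ≤ A ^ 2 / 2),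
      abs_of_nonneg (by positivity : 0 ≤ B ^ 2 / 2), add_mul, add_mul]
    have k5 : |A * B| ≤ A ^ 2 + B ^ 2 := by
      rw [abs_mul, ← sq_abs A, ← sq_abs B]
      nlinarith [sq_nonneg (|A| - |B|), sq_nonneg (|A| + |B|)]
    have h1 : A ^ 2 / 2 ≤ A ^ 2 + B ^ 2 := by nlinarith [sq_nonneg A, sq_nonneg B]
    have h2 : B ^ 2 / 2 ≤ A ^ 2 + B ^ 2 := by nlinarith [sq_nonneg A, sq_nonneg B]
    refine add_le_add (add_le_add ?_ ?_) ?_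
    · rw [mul_comm]; gcongr
    · rw [mul_comm]; gcongr
    · rw [mul_comm]; gcongr
  have := abs_sub_abs_le_abs_sub (linRemainder f t z p.1 p.2) (taylorQuad f t z A B)
  nlinarith

/-- Existence of partial derivatives alone would not give joint continuity; the quadratic bound on
the remainder does. -/
theorem HasContSecondPartials.continuousAt {f : ℝ → ℝ → ℝ} {t z : ℝ}
    (h : HasContSecondPartials f t z) : ContinuousAt (fun p : ℝ × ℝ => f p.1 p.2) (t, z) := by
  obtain ⟨C, hC, hb⟩ := h.exists_linRemainder_le
  have h1 : Tendsto (fun p : ℝ × ℝ => linRemainder f t z p.1 p.2) (𝓝 (t, z)) (𝓝 0) := by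
    refine squeeze_zero_norm' hb ?_
    exact (by fun_prop : Continuous fun p : ℝ × ℝ =>
      C * ((p.1 - t) ^ 2 + (p.2 - z) ^ 2)).tendsto' _ _ (by simp)
  have h2 : Tendsto (fun p : ℝ × ℝ => f t z + (p.1 - t) * pderiv 1 0 f t z +
      (p.2 - z) * pderiv 0 1 f t z) (𝓝 (t, z)) (𝓝 (f t z)) :=
    (by fun_prop : Continuous fun p : ℝ × ℝ => f t z + (p.1 - t) * pderiv 1 0 f t z +
      (p.2 - z) * pderiv 0 1 f t z).tendsto' _ _ (by simp)
  have h3 := h1.add h2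
  rw [zero_add] at h3
  refine h3.congr fun p => ?_
  unfold linRemainder
  ring


/-! ### Independence of pairs -/

variable {Ω : Type*} [MeasurableSpace Ω]

/-- Rectangles form a generating π-system. On them an intersection of pair events splits into an
event of the whole family `X` and one of the whole family `Y`, and each of these factors by the
independence inside its family. -/
theorem iIndepFun_prodMk_of_indepFun {ι α β : Type*} [MeasurableSpace α] [MeasurableSpace β]
    {P : Measure Ω} {X : ι → Ω → α} {Y : ι → Ω → β}
    (hXm : ∀ i, Measurable (X i)) (hYm : ∀ i, Measurable (Y i))
    (hX : iIndepFun X P) (hY : iIndepFun Y P)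
    (hXY : IndepFun (fun ω i => X i ω) (fun ω i => Y i ω) P) :
    iIndepFun (fun i ω => (X i ω, Y i ω)) P := by
  have := hX.isProbabilityMeasure
  rw [iIndepFun_iff_iIndep]
  refine iIndepSets.iIndep (fun i => ((hXm i).prodMk (hYm i)).comap_le)
    (fun i => {s | ∃ t ∈ Set.image2 (· ×ˢ ·) {s : Set α | MeasurableSet s} {t : Set β |
      MeasurableSet t}, (fun ω => (X i ω, Y i ω)) ⁻¹' t = s})
    (fun i => isPiSystem_prod.comap _) (fun i => ?_) ?_
  · rw [← generateFrom_prod, MeasurableSpace.comap_generateFrom]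
    rfl
  · rw [iIndepSets_iff]
    intro s f hf
    have hf' : ∀ i, ∃ u : Set α, ∃ v : Set β, i ∈ s → MeasurableSet u ∧ MeasurableSet v ∧
        f i = X i ⁻¹' u ∩ Y i ⁻¹' v := by
      intro i
      by_cases hi : i ∈ s
      · obtain ⟨_, ⟨u, hu, v, hv, rfl⟩, h⟩ := hf i hi
        exact ⟨u, v, fun _ => ⟨hu, hv, h.symm⟩⟩
      · exact ⟨∅, ∅, fun h => absurd h hi⟩
    choose u v huv using hf'
    have e1 : ⋂ i ∈ s, f i = (fun ω i => X i ω) ⁻¹' (⋂ i ∈ s, (fun x => x i) ⁻¹' u i) ∩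
        (fun ω i => Y i ω) ⁻¹' (⋂ i ∈ s, (fun x => x i) ⁻¹' v i) := by
      ext ω
      simp only [Set.mem_iInter, Set.mem_inter_iff, Set.mem_preimage]
      constructor
      · intro h
        refine ⟨fun i hi => ?_, fun i hi => ?_⟩
        · have := h i hi
          rw [(huv i hi).2.2] at this
          exact this.1
        · have := h i hi
          rw [(huv i hi).2.2] at this
          exact this.2
      · rintro ⟨h1, h2⟩ i hi
        rw [(huv i hi).2.2]
        exact ⟨h1 i hi, h2 i hi⟩
    have m1 : MeasurableSet (⋂ i ∈ s, (fun x : ι → α => x i) ⁻¹' u i) :=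
      Finset.measurableSet_biInter _ fun i hi => measurable_pi_apply i (huv i hi).1
    have m2 : MeasurableSet (⋂ i ∈ s, (fun x : ι → β => x i) ⁻¹' v i) :=
      Finset.measurableSet_biInter _ fun i hi => measurable_pi_apply i (huv i hi).2.1
    rw [e1, hXY.measure_inter_preimage_eq_mul _ _ m1 m2]
    have e2 : (fun ω i => X i ω) ⁻¹' (⋂ i ∈ s, (fun x => x i) ⁻¹' u i) =
        ⋂ i ∈ s, X i ⁻¹' u i := by ext; simp
    have e3 : (fun ω i => Y i ω) ⁻¹' (⋂ i ∈ s, (fun x => x i) ⁻¹' v i) =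
        ⋂ i ∈ s, Y i ⁻¹' v i := by ext; simp
    rw [e2, e3, hX.meas_biInter fun i hi => ⟨u i, (huv i hi).1, rfl⟩,
      hY.meas_biInter fun i hi => ⟨v i, (huv i hi).2.1, rfl⟩, ← Finset.prod_mul_distrib]
    refine Finset.prod_congr rfl fun i hi => ?_
    rw [(huv i hi).2.2]
    refine (IndepFun.measure_inter_preimage_eq_mul ?_ _ _ (huv i hi).1 (huv i hi).2.1).symm
    exact hXY.comp (measurable_pi_apply i) (measurable_pi_apply i)

/-! ### Sums with an independent random number of terms -/

variable {E : Type*} [MeasurableSpace E] {P : Measure Ω} [IsProbabilityMeasure P]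
  {ν : Ω → ℕ} {X : Ω → E}

lemma measurable_randomIndex {F : Type*} [MeasurableSpace F] {g : ℕ → E → F}
    (hg : ∀ m, Measurable (g m)) : Measurable fun q : ℕ × E => g q.1 q.2 :=
  measurable_from_prod_countable_right hg

/-- Fubini for the product law of `(ν, X)`. The majorant `c` of the inner `L¹` norms, integrated
against the law of `ν`, supplies the joint integrability. -/
theorem integrable_randomIndex (hν : Measurable ν) (hX : Measurable X) (hind : IndepFun ν X P)
    {g : ℕ → E → ℝ} (hg : ∀ m, Measurable (g m)) (hi : ∀ m, Integrable (fun ω => g m (X ω)) P)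
    {c : ℕ → ℝ} (hc : ∀ m, ∫ ω, |g m (X ω)| ∂P ≤ c m) (hci : Integrable (fun ω => c (ν ω)) P) :
    Integrable (fun ω => g (ν ω) (X ω)) P ∧
      ∫ ω, g (ν ω) (X ω) ∂P = ∫ ω, ∫ ω', g (ν ω) (X ω') ∂P ∂P := by
  have hmap := hind.map_prod_eq_prod_map_map hν.aemeasurable hX.aemeasurable
  have hpair : Measurable fun ω => (ν ω, X ω) := hν.prodMk hX
  have hgm := measurable_randomIndex hg
  have h1 : Integrable (fun q : ℕ × E => g q.1 q.2) ((P.map ν).prod (P.map X)) := by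
    rw [integrable_prod_iff hgm.aestronglyMeasurable]
    refine ⟨ae_of_all _ fun m => ?_, ?_⟩
    · exact (integrable_map_measure (hg m).aestronglyMeasurable hX.aemeasurable).2 (hi m)
    · have : ∀ m, ∫ x, ‖g m x‖ ∂(P.map X) = ∫ ω, |g m (X ω)| ∂P := fun m =>
        integral_map hX.aemeasurable (hg m).norm.aestronglyMeasurable
      simp_rw [this]
      refine Integrable.mono' (g := c) ?_ (measurable_from_nat.aestronglyMeasurable)
        (ae_of_all _ fun m => ?_)
      · exact (integrable_map_measure measurable_from_nat.aestronglyMeasurable hν.aemeasurable).2 hci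
      · rw [Real.norm_eq_abs, abs_of_nonneg (integral_nonneg fun _ => abs_nonneg _)]
        exact hc m
  constructor
  · rw [← hmap] at h1
    exact (integrable_map_measure hgm.aestronglyMeasurable hpair.aemeasurable).1 h1
  · have e1 : ∫ ω, g (ν ω) (X ω) ∂P = ∫ q, g q.1 q.2 ∂(P.map fun ω => (ν ω, X ω)) :=
      (integral_map hpair.aemeasurable hgm.aestronglyMeasurable).symm
    rw [e1, hmap, integral_prod _ h1]
    have e2 : ∀ m, ∫ x, g m x ∂(P.map X) = ∫ ω, g m (X ω) ∂P := fun m =>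
      integral_map hX.aemeasurable (hg m).aestronglyMeasurable
    simp_rw [e2]
    exact integral_map hν.aemeasurable measurable_from_nat.aestronglyMeasurable

lemma sq_sum_eq_sum_sq_add (s : Finset ℕ) (x : ℕ → ℝ) :
    (∑ j ∈ s, x j) ^ 2 = ∑ j ∈ s, x j ^ 2 + ∑ j ∈ s, ∑ k ∈ s.erase j, x j * x k := by
  rw [sq, Finset.sum_mul_sum, ← Finset.sum_add_distrib]
  refine Finset.sum_congr rfl fun j hj => ?_
  rw [sq, Finset.add_sum_erase s (fun k => x j * x k) hj]

/-- A sum that is dominated by its single terms, unless two of them do not vanish. -/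
lemma sq_sum_tail_le (s : Finset ℕ) (x : ℕ → ℝ) {M c : ℝ} (hMc : M ≤ c) :
    (∑ j ∈ s, x j) ^ 2 * (if c < |∑ j ∈ s, x j| then 1 else 0) ≤
      ∑ j ∈ s, x j ^ 2 * (if M < |x j| then 1 else 0) +
        ∑ j ∈ s, ∑ k ∈ s.erase j,
          (M ^ 2 * (if x j ≠ 0 ∧ x k ≠ 0 then 1 else 0) + x j * x k) := by
  by_cases h : ∃ j ∈ s, ∃ k ∈ s, j ≠ k ∧ x j ≠ 0 ∧ x k ≠ 0
  · obtain ⟨j₀, hj₀, k₀, hk₀, hne, hj, hk⟩ := h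
    have h1 : (∑ j ∈ s, x j) ^ 2 * (if c < |∑ j ∈ s, x j| then 1 else 0) ≤ (∑ j ∈ s, x j) ^ 2 := by
      split_ifs <;> nlinarith [sq_nonneg (∑ j ∈ s, x j)]
    refine h1.trans ?_
    rw [sq_sum_eq_sum_sq_add]
    simp_rw [Finset.sum_add_distrib]
    -- The cross terms are the same on both sides. What remains is to bound each square by its tail
    -- part plus the pair indicators of its row.
    rw [← add_assoc]
    gcongr
    rw [← Finset.sum_add_distrib]
    refine Finset.sum_le_sum fun j hjs => ?_
    have hnn : ∀ k ∈ s.erase j, 0 ≤ M ^ 2 * (if x j ≠ 0 ∧ x k ≠ 0 then (1 : ℝ) else 0) := by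
      intro k _
      positivity
    by_cases hxj : x j = 0
    · simp [hxj]
    -- Every nonzero term has a nonzero partner, one of the two given indices. A square below the
    -- truncation level is at most `M ^ 2` and is charged to the indicator of that pair.
    · obtain ⟨k, hks, hkj⟩ : ∃ k ∈ s.erase j, x k ≠ 0 := by
        by_cases hjj : j = j₀
        · exact ⟨k₀, Finset.mem_erase.2 ⟨by rw [hjj]; exact hne.symm, hk₀⟩, hk⟩
        · exact ⟨j₀, Finset.mem_erase.2 ⟨fun h => hjj h.symm, hj₀⟩, hj⟩
      have h2 := Finset.single_le_sum hnn hks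
      rw [if_pos ⟨hxj, hkj⟩, mul_one] at h2
      split_ifs with hM
      · have := Finset.sum_nonneg hnn
        linarith
      · push Not at hM
        rw [mul_zero, zero_add]
        refine le_trans ?_ h2
        exact sq_le_sq' (by linarith [neg_abs_le (x j)]) (by linarith [le_abs_self (x j)])
  -- Now at most one term is nonzero: all pair contributions vanish and the sum equals that term, so
  -- `M ≤ c` transfers the truncation.
  · push Not at h
    have hcross : ∑ j ∈ s, ∑ k ∈ s.erase j,
          (M ^ 2 * (if x j ≠ 0 ∧ x k ≠ 0 then 1 else 0) + x j * x k) = 0 := by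
      refine Finset.sum_eq_zero fun j hj => Finset.sum_eq_zero fun k hk => ?_
      obtain ⟨hkj, hks⟩ := Finset.mem_erase.1 hk
      by_cases hxj : x j = 0
      · simp [hxj]
      · have := h j hj k hks hkj.symm hxj
        simp [this]
    rw [hcross, add_zero]
    have hnn : ∀ k ∈ s, 0 ≤ x k ^ 2 * (if M < |x k| then (1 : ℝ) else 0) := by
      intro k _
      positivity
    by_cases h0 : ∃ j ∈ s, x j ≠ 0
    · obtain ⟨j, hj, hxj⟩ := h0
      have e : ∑ j ∈ s, x j = x j := by
        refine Finset.sum_eq_single_of_mem j hj fun k hk hkj => ?_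
        exact h j hj k hk hkj.symm hxj
      rw [e]
      refine le_trans ?_ (Finset.single_le_sum hnn hj)
      gcongr
      split_ifs with a1 a2
      · exact le_rfl
      · exact absurd (hMc.trans_lt a1) a2
      · exact zero_le_one
      · exact le_rfl
    · push Not at h0
      rw [Finset.sum_eq_zero h0]
      simpa using Finset.sum_nonneg hnn


/-! ### Moments and tails of a random sum -/

section randomSum

set_option linter.unusedSectionVars false

variable {ψ : ℕ → E → ℝ} {a b e : ℝ}

lemma integrable_mul_of_memLp_two {f g : Ω → ℝ} (hf : MemLp f 2 P) (hg : MemLp g 2 P) :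
    Integrable (fun ω => f ω * g ω) P := hf.integrable_mul hg

/-- A crude Cauchy–Schwarz bound that ignores the correlation of the terms. It serves only as a
majorant for Fubini, which is why a second moment of the count is enough. -/
lemma integral_sq_sum_range_le (hL2 : ∀ j, MemLp (fun ω => ψ j (X ω)) 2 P)
    (ha : ∀ j, ∫ ω, ψ j (X ω) ^ 2 ∂P = a) (m : ℕ) :
    ∫ ω, (∑ j ∈ Finset.range m, ψ j (X ω)) ^ 2 ∂P ≤ m ^ 2 * a := by
  have h1 : ∀ ω, (∑ j ∈ Finset.range m, ψ j (X ω)) ^ 2 ≤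
      m * ∑ j ∈ Finset.range m, ψ j (X ω) ^ 2 := by
    intro ω
    have := sq_sum_le_card_mul_sum_sq (s := Finset.range m) (f := fun j => ψ j (X ω))
    simpa using this
  have hi : ∀ j ∈ Finset.range m, Integrable (fun ω => ψ j (X ω) ^ 2) P :=
    fun j _ => (hL2 j).integrable_sq
  refine (integral_mono (MemLp.integrable_sq (memLp_finsetSum _ fun j _ => hL2 j))
    ((integrable_finsetSum _ hi).const_mul (m : ℝ)) h1).trans (le_of_eq ?_)
  rw [integral_const_mul, integral_finsetSum _ hi]
  simp [ha]
  ring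

theorem integrable_sq_randomSum (hν : Measurable ν) (hX : Measurable X) (hind : IndepFun ν X P)
    (hν2 : MemLp (fun ω => (ν ω : ℝ)) 2 P) (hψ : ∀ j, Measurable (ψ j))
    (hL2 : ∀ j, MemLp (fun ω => ψ j (X ω)) 2 P) (ha : ∀ j, ∫ ω, ψ j (X ω) ^ 2 ∂P = a) :
    Integrable (fun ω => (∑ j ∈ Finset.range (ν ω), ψ j (X ω)) ^ 2) P ∧
      ∫ ω, (∑ j ∈ Finset.range (ν ω), ψ j (X ω)) ^ 2 ∂P =
        ∫ ω, ∫ ω', (∑ j ∈ Finset.range (ν ω), ψ j (X ω')) ^ 2 ∂P ∂P := by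
  refine integrable_randomIndex hν hX hind
    (g := fun m x => (∑ j ∈ Finset.range m, ψ j x) ^ 2) (fun m => ?_) (fun m => ?_)
    (c := fun m => m ^ 2 * a) (fun m => ?_) ?_
  · exact (Finset.measurable_fun_sum _ fun j _ => hψ j).pow_const 2
  · exact MemLp.integrable_sq (memLp_finsetSum _ fun j _ => hL2 j)
  · simp_rw [abs_sq]
    exact integral_sq_sum_range_le hL2 ha m
  · exact hν2.integrable_sq.mul_const a

theorem measurable_randomSum (hν : Measurable ν) (hX : Measurable X)
    (hψ : ∀ j, Measurable (ψ j)) :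
    Measurable fun ω => ∑ j ∈ Finset.range (ν ω), ψ j (X ω) :=
  (measurable_randomIndex (g := fun m x => ∑ j ∈ Finset.range m, ψ j x) fun _ =>
    Finset.measurable_fun_sum _ fun j _ => hψ j).comp (hν.prodMk hX)

theorem memLp_randomSum (hν : Measurable ν) (hX : Measurable X) (hind : IndepFun ν X P)
    (hν2 : MemLp (fun ω => (ν ω : ℝ)) 2 P) (hψ : ∀ j, Measurable (ψ j))
    (hL2 : ∀ j, MemLp (fun ω => ψ j (X ω)) 2 P) (ha : ∀ j, ∫ ω, ψ j (X ω) ^ 2 ∂P = a) :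
    MemLp (fun ω => ∑ j ∈ Finset.range (ν ω), ψ j (X ω)) 2 P :=
  (memLp_two_iff_integrable_sq (measurable_randomSum hν hX hψ).aestronglyMeasurable).2
    (integrable_sq_randomSum hν hX hind hν2 hψ hL2 ha).1

theorem integral_randomSum (hν : Measurable ν) (hX : Measurable X) (hind : IndepFun ν X P)
    (hν2 : MemLp (fun ω => (ν ω : ℝ)) 2 P) (hψ : ∀ j, Measurable (ψ j))
    (hL2 : ∀ j, MemLp (fun ω => ψ j (X ω)) 2 P) (ha : ∀ j, ∫ ω, ψ j (X ω) ^ 2 ∂P = a)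
    (he : ∀ j, ∫ ω, ψ j (X ω) ∂P = e) :
    ∫ ω, ∑ j ∈ Finset.range (ν ω), ψ j (X ω) ∂P = (∫ ω, (ν ω : ℝ) ∂P) * e := by
  have hi : ∀ j, Integrable (fun ω => ψ j (X ω)) P := fun j => (hL2 j).integrable (by norm_num)
  -- The majorant comes from `|x| ≤ 1 + x ^ 2` and the bound on the second moment.
  have h := (integrable_randomIndex hν hX hind (g := fun m x => ∑ j ∈ Finset.range m, ψ j x)
    (fun m => Finset.measurable_fun_sum _ fun j _ => hψ j)
    (fun m => integrable_finsetSum _ fun j _ => hi j) (c := fun m => 1 + m ^ 2 * a) (fun m => ?_)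
    ((integrable_const _).add (hν2.integrable_sq.mul_const a))).2
  · rw [h]
    have : ∀ m : ℕ, ∫ ω', ∑ j ∈ Finset.range m, ψ j (X ω') ∂P = m * e := by
      intro m
      rw [integral_finsetSum _ fun j _ => hi j]
      simp [he]
    simp_rw [this]
    rw [integral_mul_const]
  · have hm2 : MemLp (fun ω => ∑ j ∈ Finset.range m, ψ j (X ω)) 2 P :=
      memLp_finsetSum _ fun j _ => hL2 j
    have h1 : ∫ ω, |∑ j ∈ Finset.range m, ψ j (X ω)| ∂P ≤
        ∫ ω, (1 + (∑ j ∈ Finset.range m, ψ j (X ω)) ^ 2) ∂P := by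
      refine integral_mono (hm2.integrable (by norm_num)).abs
        ((integrable_const _).add hm2.integrable_sq) fun ω => ?_
      simp only
      rw [← sq_abs]
      nlinarith [sq_nonneg (|∑ j ∈ Finset.range m, ψ j (X ω)| - 1)]
    refine h1.trans ?_
    rw [integral_add (integrable_const _) hm2.integrable_sq]
    have := integral_sq_sum_range_le hL2 ha m
    simpa using this

lemma sum_sum_erase_const (m : ℕ) (c : ℝ) :
    ∑ j ∈ Finset.range m, ∑ _k ∈ (Finset.range m).erase j, c = ((m : ℝ) ^ 2 - m) * c := by
  have : ∀ j ∈ Finset.range m, ∑ _k ∈ (Finset.range m).erase j, c = ((m : ℝ) - 1) * c := by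
    intro j hj
    have hm : 1 ≤ m := Nat.one_le_of_lt (Finset.mem_range.1 hj)
    rw [Finset.sum_const, Finset.card_erase_of_mem hj, Finset.card_range, nsmul_eq_mul,
      Nat.cast_sub hm, Nat.cast_one]
  rw [Finset.sum_congr rfl this, Finset.sum_const, Finset.card_range, nsmul_eq_mul]
  ring

/-- Given the count `m`, the square has `m` diagonal terms and `m ^ 2 - m` ordered pairs. -/
theorem integral_sq_randomSum (hν : Measurable ν) (hX : Measurable X) (hind : IndepFun ν X P)
    (hν2 : MemLp (fun ω => (ν ω : ℝ)) 2 P) (hψ : ∀ j, Measurable (ψ j))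
    (hL2 : ∀ j, MemLp (fun ω => ψ j (X ω)) 2 P) (ha : ∀ j, ∫ ω, ψ j (X ω) ^ 2 ∂P = a)
    (hb : ∀ j k, j ≠ k → ∫ ω, ψ j (X ω) * ψ k (X ω) ∂P = b) :
    ∫ ω, (∑ j ∈ Finset.range (ν ω), ψ j (X ω)) ^ 2 ∂P =
      (∫ ω, (ν ω : ℝ) ∂P) * a + ((∫ ω, (ν ω : ℝ) ^ 2 ∂P) - ∫ ω, (ν ω : ℝ) ∂P) * b := by
  rw [(integrable_sq_randomSum hν hX hind hν2 hψ hL2 ha).2]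
  have h1 : ∀ m : ℕ, ∫ ω', (∑ j ∈ Finset.range m, ψ j (X ω')) ^ 2 ∂P =
      m * a + ((m : ℝ) ^ 2 - m) * b := by
    intro m
    simp_rw [sq_sum_eq_sum_sq_add]
    have i1 : ∀ j ∈ Finset.range m, Integrable (fun ω => ψ j (X ω) ^ 2) P :=
      fun j _ => (hL2 j).integrable_sq
    have i2 : ∀ j ∈ Finset.range m, ∀ k ∈ (Finset.range m).erase j,
        Integrable (fun ω => ψ j (X ω) * ψ k (X ω)) P :=
      fun j _ k _ => integrable_mul_of_memLp_two (hL2 j) (hL2 k)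
    rw [integral_add (integrable_finsetSum _ i1)
      (integrable_finsetSum _ fun j hj => integrable_finsetSum _ (i2 j hj)),
      integral_finsetSum _ i1,
      integral_finsetSum _ fun j hj => integrable_finsetSum _ (i2 j hj), ← sum_sum_erase_const]
    congr 1
    · simp [ha]
    · refine Finset.sum_congr rfl fun j hj => ?_
      rw [integral_finsetSum _ (i2 j hj)]
      exact Finset.sum_congr rfl fun k hk => hb j k (Finset.ne_of_mem_erase hk).symm
  simp_rw [h1]
  have j1 : Integrable (fun ω => (ν ω : ℝ)) P := hν2.integrable (by norm_num)
  have j2 := hν2.integrable_sq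
  have j3 : Integrable (fun ω => (ν ω : ℝ) ^ 2 - ν ω) P := j2.sub j1
  rw [integral_add (j1.mul_const _) (j3.mul_const _), integral_mul_const,
    integral_mul_const, integral_sub j2 j1]

/-- The deterministic bound `sq_sum_tail_le` averaged over the data for each fixed count and then
over the count. Here `p` controls the probability that two given terms are both nonzero. -/
theorem integral_sq_tail_randomSum_le (hν : Measurable ν) (hX : Measurable X)
    (hind : IndepFun ν X P)
    (hν2 : MemLp (fun ω => (ν ω : ℝ)) 2 P) (hψ : ∀ j, Measurable (ψ j))
    (hL2 : ∀ j, MemLp (fun ω => ψ j (X ω)) 2 P) (ha : ∀ j, ∫ ω, ψ j (X ω) ^ 2 ∂P = a)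
    (hb : ∀ j k, j ≠ k → ∫ ω, ψ j (X ω) * ψ k (X ω) ∂P = b) {M c η p : ℝ} (hMc : M ≤ c)
    (hη : ∀ j, ∫ ω, ψ j (X ω) ^ 2 * (if M < |ψ j (X ω)| then 1 else 0) ∂P ≤ η)
    (hp : ∀ j k, j ≠ k → ∫ ω, (if ψ j (X ω) ≠ 0 ∧ ψ k (X ω) ≠ 0 then 1 else 0) ∂P ≤ p) :
    ∫ ω, (∑ j ∈ Finset.range (ν ω), ψ j (X ω)) ^ 2 *
        (if c < |∑ j ∈ Finset.range (ν ω), ψ j (X ω)| then 1 else 0) ∂P ≤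
      (∫ ω, (ν ω : ℝ) ∂P) * η +
        ((∫ ω, (ν ω : ℝ) ^ 2 ∂P) - ∫ ω, (ν ω : ℝ) ∂P) * (M ^ 2 * p + b) := by
  have j1 : Integrable (fun ω => (ν ω : ℝ)) P := hν2.integrable (by norm_num)
  have j2 := hν2.integrable_sq
  have hSm : ∀ m : ℕ, Measurable fun x => ∑ j ∈ Finset.range m, ψ j x := fun m =>
    Finset.measurable_fun_sum _ fun j _ => hψ j
  have hS2 : ∀ m : ℕ, Integrable (fun ω => (∑ j ∈ Finset.range m, ψ j (X ω)) ^ 2) P := fun m =>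
    MemLp.integrable_sq (memLp_finsetSum _ fun j _ => hL2 j)
  have hgm : ∀ m : ℕ, Measurable fun x => (∑ j ∈ Finset.range m, ψ j x) ^ 2 *
      (if c < |∑ j ∈ Finset.range m, ψ j x| then (1 : ℝ) else 0) := fun m =>
    ((hSm m).pow_const 2).mul (Measurable.ite
      (measurableSet_lt measurable_const (hSm m).abs) measurable_const measurable_const)
  have hgi : ∀ m : ℕ, Integrable (fun ω => (∑ j ∈ Finset.range m, ψ j (X ω)) ^ 2 *
      (if c < |∑ j ∈ Finset.range m, ψ j (X ω)| then (1 : ℝ) else 0)) P := fun m =>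
    integrable_mul_ite_one_zero (hS2 m)
      (nullMeasurableSet_lt_abs ((hSm m).comp hX).aemeasurable c)
  have h := (integrable_randomIndex hν hX hind
    (g := fun m x => (∑ j ∈ Finset.range m, ψ j x) ^ 2 *
      (if c < |∑ j ∈ Finset.range m, ψ j x| then 1 else 0))
    hgm hgi (c := fun m => m ^ 2 * a) (fun m => ?_) (j2.mul_const a)).2
  · rw [h]
    have hbd : ∀ m : ℕ, ∫ ω', (∑ j ∈ Finset.range m, ψ j (X ω')) ^ 2 *
        (if c < |∑ j ∈ Finset.range m, ψ j (X ω')| then 1 else 0) ∂P ≤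
        m * η + ((m : ℝ) ^ 2 - m) * (M ^ 2 * p + b) := by
      intro m
      have i1 : ∀ j ∈ Finset.range m,
          Integrable (fun ω => ψ j (X ω) ^ 2 * (if M < |ψ j (X ω)| then (1 : ℝ) else 0)) P :=
        fun j _ => integrable_mul_ite_one_zero (hL2 j).integrable_sq
          (nullMeasurableSet_lt_abs (hL2 j).aemeasurable M)
      have i3 : ∀ j k, Integrable
          (fun ω => (if ψ j (X ω) ≠ 0 ∧ ψ k (X ω) ≠ 0 then (1 : ℝ) else 0)) P := by
        intro j k
        refine (integrable_const (1 : ℝ)).mono' ?_ (ae_of_all _ fun ω => ?_)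
        · refine (Measurable.ite ?_ measurable_const measurable_const).aestronglyMeasurable
          exact ((hψ j).comp hX (measurableSet_singleton 0).compl).inter
            ((hψ k).comp hX (measurableSet_singleton 0).compl)
        · split_ifs <;> simp
      have i4 : ∀ j k, Integrable (fun ω => ψ j (X ω) * ψ k (X ω)) P :=
        fun j k => integrable_mul_of_memLp_two (hL2 j) (hL2 k)
      have i2 : ∀ j k, Integrable (fun ω =>
          M ^ 2 * (if ψ j (X ω) ≠ 0 ∧ ψ k (X ω) ≠ 0 then (1 : ℝ) else 0) +
            ψ j (X ω) * ψ k (X ω)) P := fun j k => ((i3 j k).const_mul _).add (i4 j k)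
      refine (integral_mono (hgi m) ((integrable_finsetSum _ i1).add
        (integrable_finsetSum _ fun j _ => integrable_finsetSum _ fun k _ => i2 j k))
        fun ω => sq_sum_tail_le (Finset.range m) (fun j => ψ j (X ω)) hMc).trans ?_
      simp only [Pi.add_apply]
      rw [integral_add (integrable_finsetSum _ i1)
        (integrable_finsetSum _ fun j _ => integrable_finsetSum _ fun k _ => i2 j k),
        integral_finsetSum _ i1,
        integral_finsetSum _ fun j _ => integrable_finsetSum _ fun k _ => i2 j k,
        ← sum_sum_erase_const]
      refine add_le_add ?_ ?_
      · refine (Finset.sum_le_sum fun j _ => hη j).trans ?_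
        simp
      · refine Finset.sum_le_sum fun j _ => ?_
        rw [integral_finsetSum _ fun k _ => i2 j k]
        refine Finset.sum_le_sum fun k hk => ?_
        have hjk := (Finset.ne_of_mem_erase hk).symm
        rw [integral_add ((i3 j k).const_mul _) (i4 j k), integral_const_mul, hb j k hjk]
        gcongr
        exact hp j k hjk
    have hri : Integrable (fun ω => (ν ω : ℝ) * η + ((ν ω : ℝ) ^ 2 - ν ω) * (M ^ 2 * p + b)) P :=
      (j1.mul_const _).add ((j2.sub j1).mul_const _)
    refine (integral_mono_of_nonneg (ae_of_all _ fun ω => ?_) hri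
      (ae_of_all _ fun ω => hbd (ν ω))).trans (le_of_eq ?_)
    · refine integral_nonneg fun ω' => ?_
      simp only [Pi.zero_apply]
      positivity
    · have j3 : Integrable (fun ω => (ν ω : ℝ) ^ 2 - ν ω) P := j2.sub j1
      rw [integral_add (j1.mul_const _) (j3.mul_const _), integral_mul_const,
        integral_mul_const, integral_sub j2 j1]
  · refine le_trans (integral_mono (hgi m).abs (hS2 m) fun ω => ?_)
      (integral_sq_sum_range_le hL2 ha m)
    simp only
    rw [abs_of_nonneg (by positivity)]
    split_ifs <;> nlinarith [sq_nonneg (∑ j ∈ Finset.range m, ψ j (X ω))]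

end randomSum


/-! ### Sums over all measurements -/

section sums

set_option linter.unusedSectionVars false

variable {Ω : Type*} [MeasurableSpace Ω]

/-- The sum of `g(T, Z, Y)` over the measurements on subject `i`. -/
noncomputable def subjectSum (T Y : ℕ → ℕ → Ω → ℝ) (Z : ℕ → Ω → ℝ) (N : ℕ → ℕ → Ω → ℕ)
    (g : ℝ → ℝ → ℝ → ℝ) (n i : ℕ) (ω : Ω) : ℝ :=
  ∑ j ∈ Finset.range (N n i ω), g (T i j ω) (Z i ω) (Y i j ω)

/-- The sum of `g(T, Z, Y)` over all measurements in a sample of `n` subjects. -/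
noncomputable def totalSum (T Y : ℕ → ℕ → Ω → ℝ) (Z : ℕ → Ω → ℝ) (N : ℕ → ℕ → Ω → ℕ)
    (g : ℝ → ℝ → ℝ → ℝ) (n : ℕ) (ω : Ω) : ℝ :=
  ∑ i ∈ Finset.range n, subjectSum T Y Z N g n i ω

variable {P : Measure Ω} [IsProbabilityMeasure P] {T Y : ℕ → ℕ → Ω → ℝ} {Z : ℕ → Ω → ℝ}
  {N : ℕ → ℕ → Ω → ℕ} {f₃ : ℝ → ℝ → ℝ → ℝ} {f₅ : ℝ → ℝ → ℝ → ℝ → ℝ → ℝ}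

/-- All triples have the same law, so measurement `0` of subject `0` can represent them; likewise
measurements `0` and `1` represent all pairs. -/
theorem SamplingModel.integral_single (h : SamplingModel P T Y Z N f₃ f₅) {F : ℝ × ℝ × ℝ → ℝ}
    (hF : Measurable F) (i j : ℕ) :
    ∫ ω, F (T i j ω, Z i ω, Y i j ω) ∂P = ∫ ω, F (T 0 0 ω, Z 0 ω, Y 0 0 ω) ∂P := by
  have hm : ∀ i j, Measurable fun ω => (T i j ω, Z i ω, Y i j ω) := fun i j =>
    (h.measurable_T i j).prodMk ((h.measurable_Z i).prodMk (h.measurable_Y i j))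
  rw [← integral_map (hm i j).aemeasurable hF.aestronglyMeasurable, h.law₃ i j, ← h.law₃ 0 0,
    integral_map (hm 0 0).aemeasurable hF.aestronglyMeasurable]

theorem SamplingModel.integral_pair (h : SamplingModel P T Y Z N f₃ f₅)
    {F : ℝ × ℝ × ℝ × ℝ × ℝ → ℝ} (hF : Measurable F) (i : ℕ) {j k : ℕ} (hjk : j ≠ k) :
    ∫ ω, F (T i j ω, T i k ω, Z i ω, Y i j ω, Y i k ω) ∂P =
      ∫ ω, F (T 0 0 ω, T 0 1 ω, Z 0 ω, Y 0 0 ω, Y 0 1 ω) ∂P := by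
  have hm : ∀ i j k, Measurable fun ω => (T i j ω, T i k ω, Z i ω, Y i j ω, Y i k ω) :=
    fun i j k => (h.measurable_T i j).prodMk ((h.measurable_T i k).prodMk
      ((h.measurable_Z i).prodMk ((h.measurable_Y i j).prodMk (h.measurable_Y i k))))
  rw [← integral_map (hm i j k).aemeasurable hF.aestronglyMeasurable, h.law₅ i j k hjk,
    ← h.law₅ 0 0 1 zero_ne_one, integral_map (hm 0 0 1).aemeasurable hF.aestronglyMeasurable]

theorem SamplingModel.memLp_single (h : SamplingModel P T Y Z N f₃ f₅) {F : ℝ × ℝ × ℝ → ℝ}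
    (hF : Measurable F) {p : ENNReal} (h0 : MemLp (fun ω => F (T 0 0 ω, Z 0 ω, Y 0 0 ω)) p P)
    (i j : ℕ) : MemLp (fun ω => F (T i j ω, Z i ω, Y i j ω)) p P := by
  have hm : ∀ i j, Measurable fun ω => (T i j ω, Z i ω, Y i j ω) := fun i j =>
    (h.measurable_T i j).prodMk ((h.measurable_Z i).prodMk (h.measurable_Y i j))
  have h1 : MemLp F p (P.map fun ω => (T 0 0 ω, Z 0 ω, Y 0 0 ω)) :=
    (memLp_map_measure_iff hF.aestronglyMeasurable (hm 0 0).aemeasurable).2 h0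
  rw [h.law₃ 0 0, ← h.law₃ i j] at h1
  exact (memLp_map_measure_iff hF.aestronglyMeasurable (hm i j).aemeasurable).1 h1

lemma SamplingModel.measurable_data (h : SamplingModel P T Y Z N f₃ f₅) (i : ℕ) :
    Measurable fun ω => (Z i ω, fun j => (T i j ω, Y i j ω)) :=
  (h.measurable_Z i).prodMk (measurable_pi_lambda _ fun j =>
    (h.measurable_T i j).prodMk (h.measurable_Y i j))

lemma SamplingModel.indepFun_count_data (h : SamplingModel P T Y Z N f₃ f₅) (n i : ℕ) :
    IndepFun (N n i) (fun ω => (Z i ω, fun j => (T i j ω, Y i j ω))) P :=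
  (h.indep_N_data n).comp (measurable_pi_apply i) (measurable_pi_apply i)

/-- The value of `g(T, Z, Y)` at measurement `j`, as a function of the data of a subject. -/
def atMeasurement (g : ℝ → ℝ → ℝ → ℝ) (j : ℕ) (x : ℝ × (ℕ → ℝ × ℝ)) : ℝ :=
  g (x.2 j).1 x.1 (x.2 j).2

lemma measurable_atMeasurement {g : ℝ → ℝ → ℝ → ℝ}
    (hg : Measurable fun p : ℝ × ℝ × ℝ => g p.1 p.2.1 p.2.2) (j : ℕ) :
    Measurable (atMeasurement g j) := by
  have h1 : Measurable fun x : ℝ × (ℕ → ℝ × ℝ) => x.2 j :=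
    (measurable_pi_apply j).comp measurable_snd
  exact hg.comp (h1.fst.prodMk (measurable_fst.prodMk h1.snd))

lemma SamplingModel.measurable_subjectSum (h : SamplingModel P T Y Z N f₃ f₅)
    {g : ℝ → ℝ → ℝ → ℝ} (hg : Measurable fun p : ℝ × ℝ × ℝ => g p.1 p.2.1 p.2.2) (n i : ℕ) :
    Measurable (subjectSum T Y Z N g n i) :=
  measurable_randomSum (ψ := atMeasurement g) (h.measurable_N n i) (h.measurable_data i)
    (measurable_atMeasurement hg)

lemma SamplingModel.measurable_totalSum (h : SamplingModel P T Y Z N f₃ f₅)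
    {g : ℝ → ℝ → ℝ → ℝ} (hg : Measurable fun p : ℝ × ℝ × ℝ => g p.1 p.2.1 p.2.2) (n : ℕ) :
    Measurable (totalSum T Y Z N g n) :=
  Finset.measurable_fun_sum _ fun i _ => h.measurable_subjectSum hg n i

/-- A subject sum is a function of the pair formed by the count and the data of that subject, and
these pairs are independent across subjects. -/
lemma SamplingModel.iIndepFun_subjectSum (h : SamplingModel P T Y Z N f₃ f₅)
    {g : ℝ → ℝ → ℝ → ℝ} (hg : Measurable fun p : ℝ × ℝ × ℝ => g p.1 p.2.1 p.2.2) (n : ℕ) :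
    iIndepFun (subjectSum T Y Z N g n) P := by
  have h1 := iIndepFun_prodMk_of_indepFun (h.measurable_N n) h.measurable_data (h.indep_N n)
    h.indep_subjects (h.indep_N_data n)
  have h2 : Measurable fun q : ℕ × (ℝ × (ℕ → ℝ × ℝ)) =>
      ∑ j ∈ Finset.range q.1, atMeasurement g j q.2 :=
    measurable_randomIndex (g := fun m x => ∑ j ∈ Finset.range m, atMeasurement g j x) fun _ =>
      Finset.measurable_fun_sum _ fun j _ => measurable_atMeasurement hg j
  exact h1.comp (fun _ q => ∑ j ∈ Finset.range q.1, atMeasurement g j q.2) fun _ => h2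

lemma CountMoments.memLp_two (hN : CountMoments P N) (h : SamplingModel P T Y Z N f₃ f₅)
    (n i : ℕ) : MemLp (fun ω => (N n i ω : ℝ)) 2 P := by
  have hm : ∀ i, Measurable fun ω => (N n i ω : ℝ) := fun i =>
    measurable_from_nat.comp (h.measurable_N n i)
  have h0 : MemLp (fun ω => (N n 0 ω : ℝ)) 2 P := by
    refine (memLp_two_iff_integrable_sq (hm 0).aestronglyMeasurable).2 ?_
    refine ((integrable_const (1 : ℝ)).add (hN.integrable n)).mono'
      ((hm 0).pow_const 2).aestronglyMeasurable (ae_of_all _ fun ω => ?_)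
    simp only [Pi.add_apply, Real.norm_eq_abs, abs_sq]
    -- The inequality is `N² ≤ 1 + N⁴`.
    nlinarith [sq_nonneg ((N n 0 ω : ℝ) ^ 2 - 1), sq_nonneg (N n 0 ω : ℝ)]
  exact (((h.ident_N n i).comp (measurable_from_nat (f := fun k : ℕ => (k : ℝ)))).memLp_iff).2 h0

lemma SamplingModel.integral_count (h : SamplingModel P T Y Z N f₃ f₅) (n i : ℕ) :
    ∫ ω, (N n i ω : ℝ) ∂P = momentN P N 1 n := by
  have := ((h.ident_N n i).comp (measurable_from_nat (f := fun k : ℕ => (k : ℝ)))).integral_eq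
  simpa [momentN] using this

lemma SamplingModel.integral_count_sq (h : SamplingModel P T Y Z N f₃ f₅) (n i : ℕ) :
    ∫ ω, (N n i ω : ℝ) ^ 2 ∂P = momentN P N 2 n := by
  have := ((h.ident_N n i).comp
    (measurable_from_nat (f := fun k : ℕ => (k : ℝ) ^ 2))).integral_eq
  simpa [momentN] using this

lemma SamplingModel.one_le_momentN (h : SamplingModel P T Y Z N f₃ f₅) (hN : CountMoments P N)
    (n : ℕ) : 1 ≤ momentN P N 1 n := by
  rw [← h.integral_count n 0]
  have : (1 : ℝ) = ∫ _, (1 : ℝ) ∂P := by simp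
  rw [this]
  refine integral_mono_ae (integrable_const _) ((hN.memLp_two h n 0).integrable (by norm_num)) ?_
  filter_upwards [h.pos_N n 0] with ω hω
  exact_mod_cast hω

/-- Makes the weight `E N² - E N` of the pair terms nonnegative. -/
lemma SamplingModel.momentN_one_le_two (h : SamplingModel P T Y Z N f₃ f₅)
    (hN : CountMoments P N) (n : ℕ) : momentN P N 1 n ≤ momentN P N 2 n := by
  rw [← h.integral_count n 0, ← h.integral_count_sq n 0]
  refine integral_mono ((hN.memLp_two h n 0).integrable (by norm_num))
    (hN.memLp_two h n 0).integrable_sq fun ω => ?_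
  simp only
  exact_mod_cast Nat.le_self_pow two_ne_zero _

/-- The expectation of `g(T, Z, Y)`. -/
noncomputable def singleMean (P : Measure Ω) (T Y : ℕ → ℕ → Ω → ℝ) (Z : ℕ → Ω → ℝ)
    (g : ℝ → ℝ → ℝ → ℝ) : ℝ := ∫ ω, g (T 0 0 ω) (Z 0 ω) (Y 0 0 ω) ∂P

/-- The expectation of `g(T₁, Z, Y₁) g(T₂, Z, Y₂)` for two measurements on one subject. -/
noncomputable def pairMean (P : Measure Ω) (T Y : ℕ → ℕ → Ω → ℝ) (Z : ℕ → Ω → ℝ)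
    (g : ℝ → ℝ → ℝ → ℝ) : ℝ :=
  ∫ ω, g (T 0 0 ω) (Z 0 ω) (Y 0 0 ω) * g (T 0 1 ω) (Z 0 ω) (Y 0 1 ω) ∂P

section moments

variable {g : ℝ → ℝ → ℝ → ℝ}

lemma SamplingModel.memLp_subjectSum (h : SamplingModel P T Y Z N f₃ f₅) (hN : CountMoments P N)
    (hg : Measurable fun p : ℝ × ℝ × ℝ => g p.1 p.2.1 p.2.2)
    (h2 : MemLp (fun ω => g (T 0 0 ω) (Z 0 ω) (Y 0 0 ω)) 2 P) (n i : ℕ) :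
    MemLp (subjectSum T Y Z N g n i) 2 P :=
  memLp_randomSum (ψ := atMeasurement g) (h.measurable_N n i) (h.measurable_data i)
    (h.indepFun_count_data n i) (hN.memLp_two h n i) (measurable_atMeasurement hg)
    (fun j => h.memLp_single hg h2 i j) fun j => h.integral_single (hg.pow_const 2) i j

lemma SamplingModel.integral_subjectSum (h : SamplingModel P T Y Z N f₃ f₅)
    (hN : CountMoments P N) (hg : Measurable fun p : ℝ × ℝ × ℝ => g p.1 p.2.1 p.2.2)
    (h2 : MemLp (fun ω => g (T 0 0 ω) (Z 0 ω) (Y 0 0 ω)) 2 P) (n i : ℕ) :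
    ∫ ω, subjectSum T Y Z N g n i ω ∂P = momentN P N 1 n * singleMean P T Y Z g := by
  rw [← h.integral_count n i]
  exact integral_randomSum (ψ := atMeasurement g) (h.measurable_N n i) (h.measurable_data i)
    (h.indepFun_count_data n i) (hN.memLp_two h n i) (measurable_atMeasurement hg)
    (fun j => h.memLp_single hg h2 i j) (fun j => h.integral_single (hg.pow_const 2) i j)
    fun j => h.integral_single hg i j

lemma measurable_pairProduct (hg : Measurable fun p : ℝ × ℝ × ℝ => g p.1 p.2.1 p.2.2) :
    Measurable fun q : ℝ × ℝ × ℝ × ℝ × ℝ =>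
      g q.1 q.2.2.1 q.2.2.2.1 * g q.2.1 q.2.2.1 q.2.2.2.2 :=
  (hg.comp (measurable_fst.prodMk (measurable_snd.snd.fst.prodMk measurable_snd.snd.snd.fst))).mul
    (hg.comp (measurable_snd.fst.prodMk
      (measurable_snd.snd.fst.prodMk measurable_snd.snd.snd.snd)))

lemma SamplingModel.integral_subjectSum_sq (h : SamplingModel P T Y Z N f₃ f₅)
    (hN : CountMoments P N) (hg : Measurable fun p : ℝ × ℝ × ℝ => g p.1 p.2.1 p.2.2)
    (h2 : MemLp (fun ω => g (T 0 0 ω) (Z 0 ω) (Y 0 0 ω)) 2 P) (n i : ℕ) :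
    ∫ ω, subjectSum T Y Z N g n i ω ^ 2 ∂P =
      momentN P N 1 n * singleMean P T Y Z (fun s w y => g s w y ^ 2) +
        (momentN P N 2 n - momentN P N 1 n) * pairMean P T Y Z g := by
  rw [← h.integral_count n i, ← h.integral_count_sq n i]
  exact integral_sq_randomSum (ψ := atMeasurement g) (h.measurable_N n i) (h.measurable_data i)
    (h.indepFun_count_data n i) (hN.memLp_two h n i) (measurable_atMeasurement hg)
    (fun j => h.memLp_single hg h2 i j) (fun j => h.integral_single (hg.pow_const 2) i j)
    fun j k hjk => h.integral_pair (measurable_pairProduct hg) i hjk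

/-- The engine of the Lindeberg condition. The pair mean of the indicator is the probability that
two measurements on one subject both contribute. -/
lemma SamplingModel.integral_subjectSum_sq_tail_le (h : SamplingModel P T Y Z N f₃ f₅)
    (hN : CountMoments P N) (hg : Measurable fun p : ℝ × ℝ × ℝ => g p.1 p.2.1 p.2.2)
    (h2 : MemLp (fun ω => g (T 0 0 ω) (Z 0 ω) (Y 0 0 ω)) 2 P) (n i : ℕ) {M c : ℝ} (hMc : M ≤ c) :
    ∫ ω, subjectSum T Y Z N g n i ω ^ 2 *
        (if c < |subjectSum T Y Z N g n i ω| then 1 else 0) ∂P ≤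
      momentN P N 1 n *
        singleMean P T Y Z (fun s w y => g s w y ^ 2 * (if M < |g s w y| then 1 else 0)) +
        (momentN P N 2 n - momentN P N 1 n) *
          (M ^ 2 * pairMean P T Y Z (fun s w y => if g s w y ≠ 0 then 1 else 0) +
            pairMean P T Y Z g) := by
  rw [← h.integral_count n i, ← h.integral_count_sq n i]
  have m1 : Measurable fun p : ℝ × ℝ × ℝ => g p.1 p.2.1 p.2.2 ^ 2 *
      (if M < |g p.1 p.2.1 p.2.2| then (1 : ℝ) else 0) :=
    (hg.pow_const 2).mul (Measurable.ite
      (measurableSet_lt measurable_const hg.abs) measurable_const measurable_const)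
  have m2 : Measurable fun p : ℝ × ℝ × ℝ => (if g p.1 p.2.1 p.2.2 ≠ 0 then (1 : ℝ) else 0) :=
    Measurable.ite (hg (measurableSet_singleton 0).compl) measurable_const measurable_const
  refine integral_sq_tail_randomSum_le (ψ := atMeasurement g) (h.measurable_N n i)
    (h.measurable_data i)
    (h.indepFun_count_data n i) (hN.memLp_two h n i) (measurable_atMeasurement hg)
    (fun j => h.memLp_single hg h2 i j) (fun j => h.integral_single (hg.pow_const 2) i j)
    (fun j k hjk => h.integral_pair (measurable_pairProduct hg) i hjk) hMc
    (fun j => (h.integral_single m1 i j).le) (fun j k hjk => ?_)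
  -- The indicator that both values are nonzero is the product of the two indicators, hence a pair
  -- mean.
  have := (h.integral_pair (measurable_pairProduct
    (g := fun s w y => if g s w y ≠ 0 then (1 : ℝ) else 0) m2) i hjk).le
  refine le_trans (le_of_eq ?_) this
  refine integral_congr_ae (ae_of_all _ fun ω => ?_)
  simp only [atMeasurement]
  by_cases a1 : g (T i j ω) (Z i ω) (Y i j ω) = 0
  · simp [a1]
  · by_cases a2 : g (T i k ω) (Z i ω) (Y i k ω) = 0 <;> simp [a1, a2]

lemma SamplingModel.memLp_totalSum (h : SamplingModel P T Y Z N f₃ f₅) (hN : CountMoments P N)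
    (hg : Measurable fun p : ℝ × ℝ × ℝ => g p.1 p.2.1 p.2.2)
    (h2 : MemLp (fun ω => g (T 0 0 ω) (Z 0 ω) (Y 0 0 ω)) 2 P) (n : ℕ) :
    MemLp (totalSum T Y Z N g n) 2 P :=
  memLp_finsetSum _ fun i _ => h.memLp_subjectSum hN hg h2 n i

lemma SamplingModel.integral_totalSum (h : SamplingModel P T Y Z N f₃ f₅)
    (hN : CountMoments P N) (hg : Measurable fun p : ℝ × ℝ × ℝ => g p.1 p.2.1 p.2.2)
    (h2 : MemLp (fun ω => g (T 0 0 ω) (Z 0 ω) (Y 0 0 ω)) 2 P) (n : ℕ) :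
    ∫ ω, totalSum T Y Z N g n ω ∂P = n * momentN P N 1 n * singleMean P T Y Z g := by
  unfold totalSum
  rw [integral_finsetSum _ fun i _ => (h.memLp_subjectSum hN hg h2 n i).integrable (by norm_num)]
  simp_rw [h.integral_subjectSum hN hg h2]
  simp
  ring

/-- Independence across subjects adds the variances; the squared means are then dropped. -/
lemma SamplingModel.variance_totalSum_le (h : SamplingModel P T Y Z N f₃ f₅)
    (hN : CountMoments P N) (hg : Measurable fun p : ℝ × ℝ × ℝ => g p.1 p.2.1 p.2.2)
    (h2 : MemLp (fun ω => g (T 0 0 ω) (Z 0 ω) (Y 0 0 ω)) 2 P) (n : ℕ) :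
    variance (totalSum T Y Z N g n) P ≤
      n * (momentN P N 1 n * singleMean P T Y Z (fun s w y => g s w y ^ 2) +
        (momentN P N 2 n - momentN P N 1 n) * pairMean P T Y Z g) := by
  have e : totalSum T Y Z N g n = ∑ i ∈ Finset.range n, subjectSum T Y Z N g n i := by
    ext ω; simp [totalSum]
  have hind := h.iIndepFun_subjectSum hg n
  rw [e, IndepFun.variance_sum (fun i _ => h.memLp_subjectSum hN hg h2 n i)
    fun i _ j _ hij => hind.indepFun hij]
  refine (Finset.sum_le_sum fun i _ => variance_le_expectation_sq
    (h.memLp_subjectSum hN hg h2 n i).aestronglyMeasurable).trans (le_of_eq ?_)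
  simp only [Pi.pow_apply]
  simp_rw [h.integral_subjectSum_sq hN hg h2]
  rw [Finset.sum_const, Finset.card_range, nsmul_eq_mul]

end moments

end sums


/-! ### Rescaling around a point -/

section rescale

variable {a b : ℝ}

lemma map_volume_sub_mul (t : ℝ) (ha : 0 < a) :
    Measure.map (fun s : ℝ => t - a * s) volume = ENNReal.ofReal a⁻¹ • volume := by
  have h1 : (fun s : ℝ => t - a * s) = (fun s => t - s) ∘ fun s => a * s := rfl
  rw [h1, ← Measure.map_map (by fun_prop) (by fun_prop), Real.map_volume_mul_left ha.ne',
    Measure.map_smul, (Measure.measurePreserving_sub_left volume t).map_eq,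
    abs_of_pos (inv_pos.2 ha)]

/-- The substitution is made so that the kernel argument `((t - T) / a, (z - Z) / b)` becomes the
new variable; the reflections preserve volume. -/
lemma map_volume_rescale (t z : ℝ) (ha : 0 < a) (hb : 0 < b) :
    Measure.map (fun s : ℝ × ℝ => (t - a * s.1, z - b * s.2)) volume =
      ENNReal.ofReal (a * b)⁻¹ • volume := by
  have h1 : (fun s : ℝ × ℝ => (t - a * s.1, z - b * s.2)) =
      Prod.map (fun s => t - a * s) fun s => z - b * s := rfl
  rw [h1, Measure.volume_eq_prod, ← Measure.map_prod_map _ _ (by fun_prop) (by fun_prop),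
    map_volume_sub_mul t ha, map_volume_sub_mul z hb, Measure.prod_smul_left,
    Measure.prod_smul_right, smul_smul, ← ENNReal.ofReal_mul (inv_nonneg.2 ha.le), mul_inv]

lemma map_volume_rescale_prod (t z : ℝ) (ha : 0 < a) (hb : 0 < b) :
    Measure.map (fun q : (ℝ × ℝ) × ℝ => ((t - a * q.1.1, z - b * q.1.2), q.2)) volume =
      ENNReal.ofReal (a * b)⁻¹ • volume := by
  have h1 : (fun q : (ℝ × ℝ) × ℝ => ((t - a * q.1.1, z - b * q.1.2), q.2)) =
      Prod.map (fun s : ℝ × ℝ => (t - a * s.1, z - b * s.2)) id := rfl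
  rw [h1, Measure.volume_eq_prod, ← Measure.map_prod_map _ _ (by fun_prop) measurable_id,
    map_volume_rescale t z ha hb, Measure.map_id, Measure.prod_smul_left]

lemma measurableEmbedding_rescale (t z : ℝ) (ha : 0 < a) (hb : 0 < b) :
    MeasurableEmbedding fun s : ℝ × ℝ => (t - a * s.1, z - b * s.2) :=
  (((Homeomorph.mulLeft₀ a ha.ne').trans (Homeomorph.subLeft t)).prodCongr
    ((Homeomorph.mulLeft₀ b hb.ne').trans (Homeomorph.subLeft z))).measurableEmbedding

lemma measurableEmbedding_rescale_prod (t z : ℝ) (ha : 0 < a) (hb : 0 < b) :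
    MeasurableEmbedding fun q : (ℝ × ℝ) × ℝ => ((t - a * q.1.1, z - b * q.1.2), q.2) :=
  ((((Homeomorph.mulLeft₀ a ha.ne').trans (Homeomorph.subLeft t)).prodCongr
    ((Homeomorph.mulLeft₀ b hb.ne').trans (Homeomorph.subLeft z))).prodCongr
      (Homeomorph.refl ℝ)).measurableEmbedding

/-- Valid without any integrability or measurability of `F`, since the substitution is a measurable
embedding. -/
lemma integral_rescale (t z : ℝ) (ha : 0 < a) (hb : 0 < b) (F : ℝ × ℝ → ℝ) :
    ∫ p, F p = a * b * ∫ s : ℝ × ℝ, F (t - a * s.1, z - b * s.2) := by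
  rw [← (measurableEmbedding_rescale t z ha hb).integral_map, map_volume_rescale t z ha hb,
    integral_smul_measure, ENNReal.toReal_ofReal (by positivity), smul_eq_mul]
  field_simp

lemma integrable_rescale (t z : ℝ) (ha : 0 < a) (hb : 0 < b) {F : ℝ × ℝ → ℝ} :
    Integrable (fun s : ℝ × ℝ => F (t - a * s.1, z - b * s.2)) ↔ Integrable F := by
  have := (measurableEmbedding_rescale t z ha hb).integrable_map_iff (μ := volume) (g := F)
  rw [map_volume_rescale t z ha hb, integrable_smul_measure
    (ENNReal.ofReal_pos.2 (by positivity)).ne' ENNReal.ofReal_ne_top] at this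
  exact this.symm

lemma integral_rescale_prod (t z : ℝ) (ha : 0 < a) (hb : 0 < b) (F : (ℝ × ℝ) × ℝ → ℝ) :
    ∫ p, F p = a * b * ∫ q : (ℝ × ℝ) × ℝ, F ((t - a * q.1.1, z - b * q.1.2), q.2) := by
  rw [← (measurableEmbedding_rescale_prod t z ha hb).integral_map,
    map_volume_rescale_prod t z ha hb,
    integral_smul_measure, ENNReal.toReal_ofReal (by positivity), smul_eq_mul]
  field_simp

lemma integrable_rescale_prod (t z : ℝ) (ha : 0 < a) (hb : 0 < b) {F : (ℝ × ℝ) × ℝ → ℝ} :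
    Integrable (fun q : (ℝ × ℝ) × ℝ => F ((t - a * q.1.1, z - b * q.1.2), q.2)) ↔
      Integrable F := by
  have := (measurableEmbedding_rescale_prod t z ha hb).integrable_map_iff (μ := volume) (g := F)
  rw [map_volume_rescale_prod t z ha hb, integrable_smul_measure
    (ENNReal.ofReal_pos.2 (by positivity)).ne' ENNReal.ofReal_ne_top] at this
  exact this.symm

end rescale

/-! ### Expectations in terms of the densities -/

section densities

set_option linter.unusedSectionVars false

variable {Ω : Type*} [MeasurableSpace Ω] {P : Measure Ω} [IsProbabilityMeasure P]
  {T Y : ℕ → ℕ → Ω → ℝ} {Z : ℕ → Ω → ℝ}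
  {N : ℕ → ℕ → Ω → ℕ} {f₃ : ℝ → ℝ → ℝ → ℝ} {f₅ : ℝ → ℝ → ℝ → ℝ → ℝ → ℝ} {g : ℝ → ℝ → ℝ → ℝ}

lemma SamplingModel.measurable_triple (h : SamplingModel P T Y Z N f₃ f₅) :
    Measurable fun ω => (T 0 0 ω, Z 0 ω, Y 0 0 ω) :=
  (h.measurable_T 0 0).prodMk ((h.measurable_Z 0).prodMk (h.measurable_Y 0 0))

/-- The bracketing `((t, z), y)` prepares Fubini with the response as inner variable. -/
lemma SamplingModel.integrable_iff (h : SamplingModel P T Y Z N f₃ f₅)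
    (hg : Measurable fun p : ℝ × ℝ × ℝ => g p.1 p.2.1 p.2.2) :
    Integrable (fun ω => g (T 0 0 ω) (Z 0 ω) (Y 0 0 ω)) P ↔
      Integrable fun q : (ℝ × ℝ) × ℝ => g q.1.1 q.1.2 q.2 * f₃ q.1.1 q.1.2 q.2 := by
  have h1 := integrable_map_measure (μ := P) (f := fun ω => (T 0 0 ω, Z 0 ω, Y 0 0 ω))
    (g := fun p : ℝ × ℝ × ℝ => g p.1 p.2.1 p.2.2) hg.aestronglyMeasurable
    h.measurable_triple.aemeasurable
  rw [h.law₃, integrable_withDensity_iff h.measurable_f₃.ennreal_ofReal (by simp)] at h1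
  simp_rw [ENNReal.toReal_ofReal (h.f₃_nonneg _ _ _)] at h1
  refine h1.symm.trans ?_
  exact (volume_preserving_prodAssoc (α₁ := ℝ) (β₁ := ℝ) (γ₁ := ℝ)).integrable_comp_emb
    MeasurableEquiv.prodAssoc.measurableEmbedding |>.symm

lemma SamplingModel.singleMean_eq (h : SamplingModel P T Y Z N f₃ f₅)
    (hg : Measurable fun p : ℝ × ℝ × ℝ => g p.1 p.2.1 p.2.2) :
    singleMean P T Y Z g = ∫ q : (ℝ × ℝ) × ℝ, g q.1.1 q.1.2 q.2 * f₃ q.1.1 q.1.2 q.2 := by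
  have h1 := integral_map (μ := P) (φ := fun ω => (T 0 0 ω, Z 0 ω, Y 0 0 ω))
    h.measurable_triple.aemeasurable
    (f := fun p : ℝ × ℝ × ℝ => g p.1 p.2.1 p.2.2) hg.aestronglyMeasurable
  rw [h.law₃, integral_withDensity_eq_integral_toReal_smul h.measurable_f₃.ennreal_ofReal
    (by simp)] at h1
  simp_rw [ENNReal.toReal_ofReal (h.f₃_nonneg _ _ _), smul_eq_mul] at h1
  rw [singleMean, ← h1, ← (volume_preserving_prodAssoc (α₁ := ℝ) (β₁ := ℝ)
    (γ₁ := ℝ)).integral_comp MeasurableEquiv.prodAssoc.measurableEmbedding]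
  refine integral_congr_ae (ae_of_all _ fun q => ?_)
  exact mul_comm _ _

/-- The reordering `((t₁, t₂, z), (y₁, y₂)) ↦ (t₁, t₂, z, y₁, y₂)`. -/
def assocPair : (ℝ × ℝ × ℝ) × (ℝ × ℝ) ≃ᵐ ℝ × ℝ × ℝ × ℝ × ℝ :=
  MeasurableEquiv.prodAssoc.trans
    ((MeasurableEquiv.refl ℝ).prodCongr MeasurableEquiv.prodAssoc)

lemma measurePreserving_assocPair : MeasurePreserving assocPair volume volume :=
  ((MeasurePreserving.id volume).prod volume_preserving_prodAssoc).comp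
    volume_preserving_prodAssoc

lemma SamplingModel.measurable_quintuple (h : SamplingModel P T Y Z N f₃ f₅) :
    Measurable fun ω => (T 0 0 ω, T 0 1 ω, Z 0 ω, Y 0 0 ω, Y 0 1 ω) :=
  (h.measurable_T 0 0).prodMk ((h.measurable_T 0 1).prodMk
    ((h.measurable_Z 0).prodMk ((h.measurable_Y 0 0).prodMk (h.measurable_Y 0 1))))

lemma SamplingModel.pairMean_eq (h : SamplingModel P T Y Z N f₃ f₅)
    (hg : Measurable fun p : ℝ × ℝ × ℝ => g p.1 p.2.1 p.2.2)
    (h2 : MemLp (fun ω => g (T 0 0 ω) (Z 0 ω) (Y 0 0 ω)) 2 P) :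
    pairMean P T Y Z g = ∫ q : ℝ × ℝ × ℝ, ∫ y : ℝ × ℝ,
      g q.1 q.2.2 y.1 * g q.2.1 q.2.2 y.2 * f₅ q.1 q.2.1 q.2.2 y.1 y.2 := by
  have hF := measurable_pairProduct hg
  -- The product of two square integrable values is integrable, which Fubini needs below.
  have hi : Integrable (fun ω => g (T 0 0 ω) (Z 0 ω) (Y 0 0 ω) * g (T 0 1 ω) (Z 0 ω) (Y 0 1 ω)) P :=
    integrable_mul_of_memLp_two h2 (h.memLp_single hg h2 0 1)
  have hi' := (integrable_map_measure (μ := P)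
    (f := fun ω => (T 0 0 ω, T 0 1 ω, Z 0 ω, Y 0 0 ω, Y 0 1 ω)) hF.aestronglyMeasurable
    h.measurable_quintuple.aemeasurable).2 hi
  have h1 := integral_map (μ := P) (φ := fun ω => (T 0 0 ω, T 0 1 ω, Z 0 ω, Y 0 0 ω, Y 0 1 ω))
    h.measurable_quintuple.aemeasurable hF.aestronglyMeasurable
  rw [h.law₅ 0 0 1 zero_ne_one, integrable_withDensity_iff h.measurable_f₅.ennreal_ofReal
    (by simp)] at hi'
  rw [h.law₅ 0 0 1 zero_ne_one, integral_withDensity_eq_integral_toReal_smul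
    h.measurable_f₅.ennreal_ofReal (by simp)] at h1
  simp_rw [ENNReal.toReal_ofReal (h.f₅_nonneg _ _ _ _ _)] at hi'
  simp_rw [ENNReal.toReal_ofReal (h.f₅_nonneg _ _ _ _ _), smul_eq_mul] at h1
  rw [pairMean, ← h1, ← measurePreserving_assocPair.integral_comp
    assocPair.measurableEmbedding, Measure.volume_eq_prod, integral_prod]
  · refine integral_congr_ae (ae_of_all _ fun q => integral_congr_ae (ae_of_all _ fun y => ?_))
    exact mul_comm _ _
  · have := (measurePreserving_assocPair.integrable_comp_emb
      assocPair.measurableEmbedding).2 hi'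
    refine this.congr (ae_of_all _ fun q => ?_)
    exact mul_comm _ _

end densities


/-! ### Moments of localized summands -/

section localized

set_option linter.unusedSectionVars false

variable {Ω : Type*} [MeasurableSpace Ω] {P : Measure Ω} [IsProbabilityMeasure P]
  {T Y : ℕ → ℕ → Ω → ℝ} {Z : ℕ → Ω → ℝ}
  {N : ℕ → ℕ → Ω → ℕ} {f₃ : ℝ → ℝ → ℝ → ℝ} {f₅ : ℝ → ℝ → ℝ → ℝ → ℝ → ℝ}
  {φ : ℝ → ℝ → ℝ} {A : ℝ → ℝ → ℝ → ℝ} {U : Set (ℝ × ℝ)} {C t δ : ℝ}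

lemma measurable_localized (hφ : Measurable fun p : ℝ × ℝ => φ p.1 p.2)
    (hA : Measurable fun p : ℝ × ℝ × ℝ => A p.1 p.2.1 p.2.2) :
    Measurable fun p : ℝ × ℝ × ℝ => φ p.1 p.2.1 * A p.1 p.2.1 p.2.2 :=
  (hφ.comp (measurable_fst.prodMk measurable_snd.fst)).mul hA

lemma measurable_assoc_triple {F : ℝ → ℝ → ℝ → ℝ}
    (hF : Measurable fun p : ℝ × ℝ × ℝ => F p.1 p.2.1 p.2.2) :
    Measurable fun q : (ℝ × ℝ) × ℝ => F q.1.1 q.1.2 q.2 :=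
  hF.comp (measurable_fst.fst.prodMk (measurable_fst.snd.prodMk measurable_snd))

/-- The factor `φ` localizes the design and `A` carries the response. Integrating the response first
leaves `φ ^ 2` times a quantity bounded on the support of `φ`. -/
lemma SamplingModel.integrable_localized_sq (h : SamplingModel P T Y Z N f₃ f₅)
    (hφ : Measurable fun p : ℝ × ℝ => φ p.1 p.2)
    (hA : Measurable fun p : ℝ × ℝ × ℝ => A p.1 p.2.1 p.2.2)
    (hU : ∀ s w, φ s w ≠ 0 → (s, w) ∈ U)
    (hA2 : ∀ p ∈ U, Integrable fun y => A p.1 p.2 y ^ 2 * f₃ p.1 p.2 y)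
    (hC : ∀ p ∈ U, ∫ y, A p.1 p.2 y ^ 2 * f₃ p.1 p.2 y ≤ C)
    (hφ2 : Integrable fun p : ℝ × ℝ => φ p.1 p.2 ^ 2) :
    Integrable fun q : (ℝ × ℝ) × ℝ =>
      (φ q.1.1 q.1.2 * A q.1.1 q.1.2 q.2) ^ 2 * f₃ q.1.1 q.1.2 q.2 := by
  have hm : Measurable fun q : (ℝ × ℝ) × ℝ =>
      (φ q.1.1 q.1.2 * A q.1.1 q.1.2 q.2) ^ 2 * f₃ q.1.1 q.1.2 q.2 :=
    (measurable_assoc_triple (F := fun s w y => (φ s w * A s w y) ^ 2 * f₃ s w y)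
      (((measurable_localized hφ hA).pow_const 2).mul h.measurable_f₃))
  have e : ∀ p : ℝ × ℝ, (fun y => (φ p.1 p.2 * A p.1 p.2 y) ^ 2 * f₃ p.1 p.2 y) =
      fun y => φ p.1 p.2 ^ 2 * (A p.1 p.2 y ^ 2 * f₃ p.1 p.2 y) := by
    intro p; ext y; ring
  rw [Measure.volume_eq_prod, integrable_prod_iff hm.aestronglyMeasurable]
  constructor
  · refine ae_of_all _ fun p => ?_
    simp only
    rw [e p]
    by_cases h0 : φ p.1 p.2 = 0
    · simp [h0]
    · exact (hA2 p (hU _ _ h0)).const_mul _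
  · refine (hφ2.const_mul C).mono' hm.aestronglyMeasurable.norm.integral_prod_right'
      (ae_of_all _ fun p => ?_)
    have hn : ∀ y, 0 ≤ (φ p.1 p.2 * A p.1 p.2 y) ^ 2 * f₃ p.1 p.2 y := fun y =>
      mul_nonneg (sq_nonneg _) (h.f₃_nonneg _ _ _)
    simp only
    simp_rw [Real.norm_eq_abs, abs_of_nonneg (hn _)]
    rw [abs_of_nonneg (integral_nonneg hn), e p, integral_const_mul]
    by_cases h0 : φ p.1 p.2 = 0
    · simp [h0]
    · rw [mul_comm C]
      exact mul_le_mul_of_nonneg_left (hC p (hU _ _ h0)) (sq_nonneg _)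

lemma SamplingModel.memLp_localized (h : SamplingModel P T Y Z N f₃ f₅)
    (hφ : Measurable fun p : ℝ × ℝ => φ p.1 p.2)
    (hA : Measurable fun p : ℝ × ℝ × ℝ => A p.1 p.2.1 p.2.2)
    (hi : Integrable fun q : (ℝ × ℝ) × ℝ =>
      (φ q.1.1 q.1.2 * A q.1.1 q.1.2 q.2) ^ 2 * f₃ q.1.1 q.1.2 q.2) :
    MemLp (fun ω => φ (T 0 0 ω) (Z 0 ω) * A (T 0 0 ω) (Z 0 ω) (Y 0 0 ω)) 2 P := by
  have hm := measurable_localized hφ hA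
  refine (memLp_two_iff_integrable_sq (hm.comp h.measurable_triple).aestronglyMeasurable).2 ?_
  exact (h.integrable_iff (g := fun s w y => (φ s w * A s w y) ^ 2) (hm.pow_const 2)).2 hi

lemma SamplingModel.singleMean_sq_localized (h : SamplingModel P T Y Z N f₃ f₅)
    (hφ : Measurable fun p : ℝ × ℝ => φ p.1 p.2)
    (hA : Measurable fun p : ℝ × ℝ × ℝ => A p.1 p.2.1 p.2.2)
    (hi : Integrable fun q : (ℝ × ℝ) × ℝ =>
      (φ q.1.1 q.1.2 * A q.1.1 q.1.2 q.2) ^ 2 * f₃ q.1.1 q.1.2 q.2) :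
    singleMean P T Y Z (fun s w y => (φ s w * A s w y) ^ 2) =
      ∫ p : ℝ × ℝ, φ p.1 p.2 ^ 2 * ∫ y, A p.1 p.2 y ^ 2 * f₃ p.1 p.2 y := by
  rw [h.singleMean_eq ((measurable_localized hφ hA).pow_const 2), Measure.volume_eq_prod,
    integral_prod _ hi]
  refine integral_congr_ae (ae_of_all _ fun p => ?_)
  simp only
  rw [← integral_const_mul]
  refine integral_congr_ae (ae_of_all _ fun y => ?_)
  simp only
  ring

lemma SamplingModel.singleMean_localized (h : SamplingModel P T Y Z N f₃ f₅)
    (hφ : Measurable fun p : ℝ × ℝ => φ p.1 p.2)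
    (hA : Measurable fun p : ℝ × ℝ × ℝ => A p.1 p.2.1 p.2.2)
    (hi : Integrable fun q : (ℝ × ℝ) × ℝ =>
      (φ q.1.1 q.1.2 * A q.1.1 q.1.2 q.2) ^ 2 * f₃ q.1.1 q.1.2 q.2) :
    singleMean P T Y Z (fun s w y => φ s w * A s w y) =
      ∫ p : ℝ × ℝ, φ p.1 p.2 * ∫ y, A p.1 p.2 y * f₃ p.1 p.2 y := by
  have hm := measurable_localized hφ hA
  have h1 := (h.integrable_iff (g := fun s w y => φ s w * A s w y) hm).1
    ((h.memLp_localized hφ hA hi).integrable (by norm_num))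
  rw [h.singleMean_eq hm, Measure.volume_eq_prod, integral_prod _ h1]
  refine integral_congr_ae (ae_of_all _ fun p => ?_)
  simp only
  rw [← integral_const_mul]
  refine integral_congr_ae (ae_of_all _ fun y => ?_)
  simp only
  ring

/-- Exchange of the first two coordinates of `ℝ³`. -/
def swapFirst : ℝ × ℝ × ℝ ≃ᵐ ℝ × ℝ × ℝ :=
  (MeasurableEquiv.prodAssoc.symm.trans
    (MeasurableEquiv.prodComm.prodCongr (MeasurableEquiv.refl ℝ))).trans MeasurableEquiv.prodAssoc

lemma measurePreserving_swapFirst : MeasurePreserving swapFirst volume volume :=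
  volume_preserving_prodAssoc.comp ((Measure.measurePreserving_swap.prod
    (MeasurePreserving.id volume)).comp volume_preserving_prodAssoc.symm)

/-- The inequality `|xy| ≤ (x² + y²) / 2` leaves `φ ^ 2` in one of the two times, while the other
time is free only in an interval of length `2 * δ`. This extra factor `δ`, of the order of the
bandwidth, is what makes the dependence within subjects negligible. -/
lemma SamplingModel.abs_pairMean_le (h : SamplingModel P T Y Z N f₃ f₅)
    (hφ : Measurable fun p : ℝ × ℝ => φ p.1 p.2)
    (hA : Measurable fun p : ℝ × ℝ × ℝ => A p.1 p.2.1 p.2.2)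
    (h2 : MemLp (fun ω => φ (T 0 0 ω) (Z 0 ω) * A (T 0 0 ω) (Z 0 ω) (Y 0 0 ω)) 2 P)
    (hφ2 : Integrable fun p : ℝ × ℝ => φ p.1 p.2 ^ 2) (hδ : 0 ≤ δ)
    (hbox : ∀ s w, φ s w ≠ 0 → |s - t| ≤ δ)
    (hC : ∀ s₁ s₂ w, φ s₁ w ≠ 0 → φ s₂ w ≠ 0 →
      |∫ y : ℝ × ℝ, A s₁ w y.1 * A s₂ w y.2 * f₅ s₁ s₂ w y.1 y.2| ≤ C) :
    |pairMean P T Y Z (fun s w y => φ s w * A s w y)| ≤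
      C * (2 * δ * ∫ p : ℝ × ℝ, φ p.1 p.2 ^ 2) := by
  -- The indicator remembers the localization of the time whose factor `φ` is given up.
  set I : ℝ → ℝ := (Set.Icc (t - δ) (t + δ)).indicator 1 with hI
  have hI0 : ∀ s, 0 ≤ I s := fun s => Set.indicator_nonneg (fun _ _ => zero_le_one) s
  have hI1 : ∀ s w, φ s w ≠ 0 → I s = 1 := by
    intro s w hs
    have := abs_le.1 (hbox s w hs)
    have hs' : s ∈ Set.Icc (t - δ) (t + δ) := ⟨by linarith, by linarith⟩
    rw [hI, Set.indicator_of_mem hs']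
    rfl
  have hIi : Integrable I := by
    rw [hI]
    exact (integrable_indicator_iff measurableSet_Icc).2
      (integrableOn_const (by simp))
  have hIv : ∫ s, I s = 2 * δ := by
    rw [hI, integral_indicator_one measurableSet_Icc]
    simp only [Measure.real, Real.volume_Icc]
    rw [ENNReal.toReal_ofReal (by linarith)]
    ring
  set B : ℝ × ℝ × ℝ → ℝ := fun q => I q.1 * φ q.2.1 q.2.2 ^ 2 with hB
  have hBi : Integrable B := hIi.mul_prod hφ2
  have hBv : ∫ q, B q = 2 * δ * ∫ p : ℝ × ℝ, φ p.1 p.2 ^ 2 := by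
    rw [← hIv]
    exact integral_prod_mul (μ := (volume : Measure ℝ)) (ν := (volume : Measure (ℝ × ℝ))) I
      fun p : ℝ × ℝ => φ p.1 p.2 ^ 2
  have hBi' : Integrable fun q : ℝ × ℝ × ℝ => B (q.2.1, q.1, q.2.2) :=
    (measurePreserving_swapFirst.integrable_comp_emb swapFirst.measurableEmbedding).2 hBi
  have hBv' : ∫ q : ℝ × ℝ × ℝ, B (q.2.1, q.1, q.2.2) = ∫ q, B q :=
    measurePreserving_swapFirst.integral_comp swapFirst.measurableEmbedding B
  rw [h.pairMean_eq (measurable_localized hφ hA) h2, ← Real.norm_eq_abs]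
  refine (norm_integral_le_of_norm_le (((hBi.add hBi').const_mul (C / 2)))
    (ae_of_all _ fun q => ?_)).trans (le_of_eq ?_)
  · simp only [Pi.add_apply]
    have e : ∫ y : ℝ × ℝ, φ q.1 q.2.2 * A q.1 q.2.2 y.1 * (φ q.2.1 q.2.2 * A q.2.1 q.2.2 y.2) *
          f₅ q.1 q.2.1 q.2.2 y.1 y.2 = φ q.1 q.2.2 * φ q.2.1 q.2.2 *
        ∫ y : ℝ × ℝ, A q.1 q.2.2 y.1 * A q.2.1 q.2.2 y.2 * f₅ q.1 q.2.1 q.2.2 y.1 y.2 := by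
      rw [← integral_const_mul]
      refine integral_congr_ae (ae_of_all _ fun y => ?_)
      simp only
      ring
    rw [e, norm_mul, Real.norm_eq_abs, Real.norm_eq_abs]
    by_cases h0 : φ q.1 q.2.2 = 0 ∨ φ q.2.1 q.2.2 = 0
    · have h00 : φ q.1 q.2.2 * φ q.2.1 q.2.2 = 0 := by simpa using h0
      rw [h00, abs_zero, zero_mul]
      -- A negative `C` contradicts its own hypothesis unless `φ` vanishes identically, and then
      -- both sides are zero.
      by_cases hCneg : 0 ≤ C
      · have b1 : 0 ≤ B q := mul_nonneg (hI0 _) (sq_nonneg _)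
        have b2 : 0 ≤ B (q.2.1, q.1, q.2.2) := mul_nonneg (hI0 _) (sq_nonneg _)
        positivity
      · have hz : ∀ s w, φ s w = 0 := by
          intro s w
          by_contra hsw
          exact hCneg ((abs_nonneg _).trans (hC s s w hsw hsw))
        simp [hB, hz]
    · push Not at h0
      have hc := hC _ _ _ h0.1 h0.2
      have hC0 : 0 ≤ C := (abs_nonneg _).trans hc
      simp only [hB]
      rw [hI1 _ _ h0.1, hI1 _ _ h0.2, one_mul, one_mul, abs_mul,
        ← sq_abs (φ q.1 q.2.2), ← sq_abs (φ q.2.1 q.2.2)]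
      set x := |φ q.1 q.2.2|
      set y := |φ q.2.1 q.2.2|
      have hxy : x * y ≤ (y ^ 2 + x ^ 2) / 2 := by nlinarith [sq_nonneg (x - y)]
      calc _ ≤ (y ^ 2 + x ^ 2) / 2 * C := by gcongr
        _ = _ := by ring
  · simp only [Pi.add_apply]
    rw [integral_const_mul, integral_add hBi hBi', hBv', hBv]
    ring

end localized


/-! ### Square integrable windows of bounded support -/

/-- A square integrable function that vanishes outside `[-R, R]²`. -/
structure Window (L : ℝ → ℝ → ℝ) (R : ℝ) : Prop where
  radius_nonneg : 0 ≤ R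
  measurable : Measurable fun p : ℝ × ℝ => L p.1 p.2
  memLp_two : MemLp (fun p : ℝ × ℝ => L p.1 p.2) 2 volume
  support : ∀ s w, L s w ≠ 0 → |s| ≤ R ∧ |w| ≤ R

/-- One radius serves all monomial multiples of the kernel, because monomials are bounded on its
support. -/
lemma IsKernelOfOrderTwo.exists_window {K : ℝ → ℝ → ℝ} (hK : IsKernelOfOrderTwo K) :
    ∃ R : ℝ, 0 < R ∧ ∀ k₁ k₂ : ℕ, Window (fun s w => s ^ k₁ * w ^ k₂ * K s w) R := by
  obtain ⟨R, hR⟩ := hK.compactSupport.isCompact.isBounded.subset_closedBall (0 : ℝ × ℝ)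
  have hsupp : ∀ s w, K s w ≠ 0 → |s| ≤ max R 1 ∧ |w| ≤ max R 1 := by
    intro s w h
    have : (s, w) ∈ Metric.closedBall (0 : ℝ × ℝ) R := hR (subset_tsupport _ h)
    rw [mem_closedBall_zero_iff, Prod.norm_def, max_le_iff] at this
    exact ⟨this.1.trans (le_max_left _ _), this.2.trans (le_max_left _ _)⟩
  refine ⟨max R 1, by positivity, fun k₁ k₂ => ⟨by positivity, ?_, ?_, ?_⟩⟩
  · exact ((measurable_fst.pow_const k₁).mul (measurable_snd.pow_const k₂)).mul hK.measurable
  · refine MemLp.of_le_mul (c := max R 1 ^ (k₁ + k₂)) hK.memLp_two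
      (((measurable_fst.pow_const k₁).mul
        (measurable_snd.pow_const k₂)).mul hK.measurable).aestronglyMeasurable
      (ae_of_all _ fun p => ?_)
    rw [norm_mul, norm_mul, norm_pow, norm_pow]
    by_cases h0 : K p.1 p.2 = 0
    · simp [h0]
    · obtain ⟨h1, h2⟩ := hsupp _ _ h0
      rw [pow_add]
      simp only [Real.norm_eq_abs]
      gcongr
  · intro s w h
    exact hsupp s w (right_ne_zero_of_mul h)

namespace Window

variable {L : ℝ → ℝ → ℝ} {R t z a b : ℝ}

lemma integrable_sq (h : Window L R) : Integrable fun p : ℝ × ℝ => L p.1 p.2 ^ 2 :=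
  h.memLp_two.integrable_sq

lemma integrable (h : Window L R) : Integrable fun p : ℝ × ℝ => L p.1 p.2 := by
  set S : Set (ℝ × ℝ) := Set.Icc (-R) R ×ˢ Set.Icc (-R) R with hS
  have hSm : MeasurableSet S := measurableSet_Icc.prod measurableSet_Icc
  have hSv : volume S ≠ ⊤ := (isCompact_Icc.prod isCompact_Icc).measure_lt_top.ne
  have h1 : Integrable (S.indicator fun _ => (1 : ℝ)) :=
    (integrable_indicator_iff hSm).2 (integrableOn_const hSv)
  -- On the square that carries the support, `|L| ≤ 1 + L ^ 2`.
  refine (h1.add h.integrable_sq).mono' h.measurable.aestronglyMeasurable (ae_of_all _ fun p => ?_)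
  simp only [Pi.add_apply, Real.norm_eq_abs]
  by_cases h0 : L p.1 p.2 = 0
  · rw [h0, abs_zero]
    have : 0 ≤ S.indicator (fun _ => (1 : ℝ)) p := Set.indicator_nonneg (fun _ _ => zero_le_one) _
    positivity
  · obtain ⟨h2, h3⟩ := h.support _ _ h0
    have hp : p ∈ S := ⟨abs_le.1 h2, abs_le.1 h3⟩
    rw [Set.indicator_of_mem hp, ← sq_abs]
    nlinarith [sq_nonneg (|L p.1 p.2| - 1)]

/-- The constant window. -/
lemma box (hR : 0 ≤ R) : Window (fun s w => if |s| ≤ R ∧ |w| ≤ R then 1 else 0) R := by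
  have e : {p : ℝ × ℝ | |p.1| ≤ R ∧ |p.2| ≤ R} = Set.Icc (-R) R ×ˢ Set.Icc (-R) R := by
    ext p
    simp only [Set.mem_ofPred_eq, Set.mem_prod, Set.mem_Icc, abs_le]
  have hm : MeasurableSet {p : ℝ × ℝ | |p.1| ≤ R ∧ |p.2| ≤ R} := by
    rw [e]
    exact measurableSet_Icc.prod measurableSet_Icc
  refine ⟨hR, Measurable.ite hm measurable_const measurable_const, ?_, ?_⟩
  · have hfin : volume {p : ℝ × ℝ | |p.1| ≤ R ∧ |p.2| ≤ R} ≠ ⊤ := by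
      rw [e]
      exact (isCompact_Icc.prod isCompact_Icc).measure_lt_top.ne
    refine (memLp_indicator_const (μ := volume) 2 hm (1 : ℝ) (Or.inr hfin)).ae_eq
      (ae_of_all _ fun p => ?_)
    simp only [Set.indicator_apply, Set.mem_ofPred_eq]
  · intro s w h
    by_contra h'
    simp [h'] at h

end Window

/-- The window `L` centered at `(t, z)` and scaled by the bandwidths `(a, b)`. -/
noncomputable def scaled (L : ℝ → ℝ → ℝ) (t z a b s w : ℝ) : ℝ := L ((t - s) / a) ((z - w) / b)

/-! ### Change of variables for scaled windows -/

section scaled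

variable {L : ℝ → ℝ → ℝ} {R t z a b : ℝ}

lemma scaled_rescale (ha : 0 < a) (hb : 0 < b) (s w : ℝ) :
    scaled L t z a b (t - a * s) (z - b * w) = L s w := by
  unfold scaled
  congr 1 <;> field_simp <;> ring

lemma Window.measurable_scaled (h : Window L R) :
    Measurable fun p : ℝ × ℝ => scaled L t z a b p.1 p.2 :=
  h.measurable.comp (f := fun p : ℝ × ℝ => ((t - p.1) / a, (z - p.2) / b)) (by fun_prop)

lemma Window.scaled_support (h : Window L R) (ha : 0 < a) (hb : 0 < b) {s w : ℝ}
    (hs : scaled L t z a b s w ≠ 0) : |s - t| ≤ R * a ∧ |w - z| ≤ R * b := by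
  obtain ⟨h1, h2⟩ := h.support _ _ hs
  rw [abs_div, abs_of_pos ha, div_le_iff₀ ha, abs_sub_comm] at h1
  rw [abs_div, abs_of_pos hb, div_le_iff₀ hb, abs_sub_comm] at h2
  exact ⟨h1, h2⟩

lemma integral_scaled_mul (ha : 0 < a) (hb : 0 < b) (H : ℝ → ℝ → ℝ) :
    ∫ p : ℝ × ℝ, scaled L t z a b p.1 p.2 * H p.1 p.2 =
      a * b * ∫ s : ℝ × ℝ, L s.1 s.2 * H (t - a * s.1) (z - b * s.2) := by
  rw [integral_rescale t z ha hb]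
  simp_rw [scaled_rescale ha hb]

lemma integral_scaled_sq_mul (ha : 0 < a) (hb : 0 < b) (H : ℝ → ℝ → ℝ) :
    ∫ p : ℝ × ℝ, scaled L t z a b p.1 p.2 ^ 2 * H p.1 p.2 =
      a * b * ∫ s : ℝ × ℝ, L s.1 s.2 ^ 2 * H (t - a * s.1) (z - b * s.2) := by
  rw [integral_rescale t z ha hb]
  simp_rw [scaled_rescale ha hb]

lemma integral_scaled_sq (ha : 0 < a) (hb : 0 < b) :
    ∫ p : ℝ × ℝ, scaled L t z a b p.1 p.2 ^ 2 = a * b * ∫ s : ℝ × ℝ, L s.1 s.2 ^ 2 := by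
  simpa using integral_scaled_sq_mul (L := L) (t := t) (z := z) ha hb fun _ _ => 1

lemma Window.integrable_scaled_sq (h : Window L R) (ha : 0 < a) (hb : 0 < b) :
    Integrable fun p : ℝ × ℝ => scaled L t z a b p.1 p.2 ^ 2 := by
  rw [← integrable_rescale t z ha hb]
  simp_rw [scaled_rescale ha hb]
  exact h.integrable_sq

end scaled

/-! ### Limits of rescaled integrals -/

section limits

variable {L : ℝ × ℝ → ℝ} {R t z : ℝ} {a b : ℕ → ℝ}

lemma tendsto_rescale (ha : Tendsto a atTop (𝓝 0)) (hb : Tendsto b atTop (𝓝 0)) (s : ℝ × ℝ) :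
    Tendsto (fun n => (t - a n * s.1, z - b n * s.2)) atTop (𝓝 (t, z)) := by
  have h1 := ((ha.mul_const s.1).const_sub t)
  have h2 := ((hb.mul_const s.2).const_sub z)
  rw [zero_mul, sub_zero] at h1 h2
  exact h1.prodMk_nhds h2

lemma eventually_rescale_mem (ha : Tendsto a atTop (𝓝 0)) (hb : Tendsto b atTop (𝓝 0)) (R : ℝ)
    {U : Set (ℝ × ℝ)} (hU : U ∈ 𝓝 (t, z)) :
    ∀ᶠ n in atTop, ∀ s w : ℝ, |s - t| ≤ R * |a n| → |w - z| ≤ R * |b n| → (s, w) ∈ U := by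
  obtain ⟨δ, hδ, hball⟩ := Metric.mem_nhds_iff.1 hU
  have h1 : Tendsto (fun n => R * |a n|) atTop (𝓝 0) := by
    simpa using ha.abs.const_mul R
  have h2 : Tendsto (fun n => R * |b n|) atTop (𝓝 0) := by
    simpa using hb.abs.const_mul R
  filter_upwards [h1.eventually_lt_const hδ, h2.eventually_lt_const hδ] with n k1 k2 s w hs hw
  refine hball ?_
  rw [Metric.mem_ball, Prod.dist_eq, max_lt_iff, Real.dist_eq, Real.dist_eq]
  exact ⟨hs.trans_lt k1, hw.trans_lt k2⟩

lemma eventually_rescale_mem' (ha : Tendsto a atTop (𝓝 0)) (hb : Tendsto b atTop (𝓝 0)) (R : ℝ)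
    {U : Set (ℝ × ℝ)} (hU : U ∈ 𝓝 (t, z)) :
    ∀ᶠ n in atTop, ∀ s w : ℝ, |s| ≤ R → |w| ≤ R → (t - a n * s, z - b n * w) ∈ U := by
  filter_upwards [eventually_rescale_mem ha hb R hU] with n hn s w hs hw
  refine hn _ _ ?_ ?_
  · rw [sub_sub_cancel_left, abs_neg, abs_mul, mul_comm]
    gcongr
  · rw [sub_sub_cancel_left, abs_neg, abs_mul, mul_comm]
    gcongr

/-- Dominated convergence with majorant `C * |L|`; boundedness and convergence of the other factor
are needed only where `L` does not vanish, that is, in shrinking neighbourhoods of the point after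
rescaling. -/
lemma tendsto_integral_window_mul (hL : Integrable L) {G : ℕ → ℝ × ℝ → ℝ} {G₀ : ℝ × ℝ → ℝ}
    (hG : ∀ n, Measurable (G n)) {C : ℝ}
    (hC : ∀ᶠ n in atTop, ∀ s, L s ≠ 0 → |G n s| ≤ C)
    (hlim : ∀ s, L s ≠ 0 → Tendsto (fun n => G n s) atTop (𝓝 (G₀ s))) :
    Tendsto (fun n => ∫ s, L s * G n s) atTop (𝓝 (∫ s, L s * G₀ s)) := by
  refine tendsto_integral_filter_of_dominated_convergence (fun s => C * |L s|)
    (Eventually.of_forall fun n => hL.aestronglyMeasurable.mul (hG n).aestronglyMeasurable) ?_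
    (hL.abs.const_mul C) (ae_of_all _ fun s => ?_)
  · filter_upwards [hC] with n hn
    refine ae_of_all _ fun s => ?_
    rw [norm_mul, Real.norm_eq_abs, Real.norm_eq_abs]
    by_cases h0 : L s = 0
    · simp [h0]
    · rw [mul_comm C]
      exact mul_le_mul_of_nonneg_left (hn s h0) (abs_nonneg _)
  · by_cases h0 : L s = 0
    · simp [h0]
    · exact (hlim s h0).const_mul _

lemma tendsto_integral_window_mul_of_continuousAt (hL : Integrable L)
    (hsupp : ∀ s, L s ≠ 0 → |s.1| ≤ R ∧ |s.2| ≤ R) {G : ℝ → ℝ → ℝ}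
    (ha : Tendsto a atTop (𝓝 0)) (hb : Tendsto b atTop (𝓝 0))
    (hG : Measurable fun p : ℝ × ℝ => G p.1 p.2)
    (hc : ContinuousAt (fun p : ℝ × ℝ => G p.1 p.2) (t, z)) :
    Tendsto (fun n => ∫ s, L s * G (t - a n * s.1) (z - b n * s.2)) atTop
      (𝓝 ((∫ s, L s) * G t z)) := by
  rw [← integral_mul_const]
  have hU : {p : ℝ × ℝ | |G p.1 p.2| ≤ |G t z| + 1} ∈ 𝓝 (t, z) := by
    have := hc.abs.eventually_lt_const (lt_add_one |G t z|)
    filter_upwards [this] with p hp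
    exact hp.le
  refine tendsto_integral_window_mul hL (G := fun n s => G (t - a n * s.1) (z - b n * s.2))
    (C := |G t z| + 1)
    (fun n => hG.comp (f := fun s : ℝ × ℝ => (t - a n * s.1, z - b n * s.2)) (by fun_prop)) ?_ ?_
  · filter_upwards [eventually_rescale_mem' ha hb R hU] with n hn s hs
    obtain ⟨h1, h2⟩ := hsupp s hs
    exact hn _ _ h1 h2
  · intro s _
    exact hc.tendsto.comp (tendsto_rescale ha hb s)

end limits

/-- **Scheffé's lemma** for nonnegative functions. -/
theorem tendsto_integral_abs_sub_of_tendsto_integral {α : Type*} [MeasurableSpace α]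
    {ν : Measure α} {F : ℕ → α → ℝ} {F₀ : α → ℝ} (hF : ∀ᶠ n in atTop, Integrable (F n) ν)
    (hF₀ : Integrable F₀ ν) (hnn : ∀ n x, 0 ≤ F n x) (hnn₀ : ∀ x, 0 ≤ F₀ x)
    (hlim : ∀ x, Tendsto (fun n => F n x) atTop (𝓝 (F₀ x)))
    (hint : Tendsto (fun n => ∫ x, F n x ∂ν) atTop (𝓝 (∫ x, F₀ x ∂ν))) :
    Tendsto (fun n => ∫ x, |F n x - F₀ x| ∂ν) atTop (𝓝 0) := by
  -- By nonnegativity of `F n` the positive part of `F₀ - F n` is dominated by `F₀`; the absolute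
  -- value is recovered from it and the convergent integrals.
  have h1 : Tendsto (fun n => ∫ x, max (F₀ x - F n x) 0 ∂ν) atTop (𝓝 (∫ _, (0 : ℝ) ∂ν)) := by
    refine tendsto_integral_filter_of_dominated_convergence F₀ ?_ ?_ hF₀ (ae_of_all _ fun x => ?_)
    · filter_upwards [hF] with n hn
      exact (hF₀.sub hn).pos_part.aestronglyMeasurable
    · refine Eventually.of_forall fun n => ae_of_all _ fun x => ?_
      rw [Real.norm_eq_abs, abs_of_nonneg (le_max_right _ _)]
      exact max_le (by linarith [hnn n x]) (hnn₀ x)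
    · have := ((hlim x).const_sub (F₀ x)).max (tendsto_const_nhds (x := (0 : ℝ)))
      simpa using this
  rw [integral_zero] at h1
  have h2 := (hint.sub_const (∫ x, F₀ x ∂ν)).add (h1.const_mul 2)
  rw [sub_self, mul_zero, add_zero] at h2
  refine h2.congr' ?_
  filter_upwards [hF] with n hn
  have hp : Integrable (fun x => max (F₀ x - F n x) 0) ν := (hF₀.sub hn).pos_part
  have e : ∀ x, |F n x - F₀ x| = F n x - F₀ x + 2 * max (F₀ x - F n x) 0 := by
    intro x
    rcases le_total (F n x) (F₀ x) with h | h
    · rw [abs_of_nonpos (by linarith), max_eq_left (by linarith)]; ring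
    · rw [abs_of_nonneg (by linarith), max_eq_right (by linarith)]; ring
  simp_rw [e]
  have hs : Integrable (fun x => F n x - F₀ x) ν := hn.sub hF₀
  rw [integral_add hs (hp.const_mul 2), integral_sub hn hF₀, integral_const_mul]


/-! ### Local bounds around the point of estimation -/

/-! ### Residuals and uniform bounds near the point -/

section localFacts

variable {Ω : Type*} [MeasurableSpace Ω] {P : Measure Ω}
  {T Y : ℕ → ℕ → Ω → ℝ} {Z : ℕ → Ω → ℝ}
  {N : ℕ → ℕ → Ω → ℕ} {f₃ : ℝ → ℝ → ℝ → ℝ} {f₅ : ℝ → ℝ → ℝ → ℝ → ℝ → ℝ} {t z : ℝ}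

lemma SamplingModel.measurable_designDensity (h : SamplingModel P T Y Z N f₃ f₅) :
    Measurable fun p : ℝ × ℝ => designDensity f₃ p.1 p.2 :=
  (StronglyMeasurable.integral_prod_right (f := fun (p : ℝ × ℝ) y => f₃ p.1 p.2 y)
    (measurable_assoc_triple h.measurable_f₃).stronglyMeasurable).measurable

lemma SamplingModel.measurable_condMean (h : SamplingModel P T Y Z N f₃ f₅) :
    Measurable fun p : ℝ × ℝ => condMean f₃ p.1 p.2 :=
  (StronglyMeasurable.integral_prod_right (f := fun (p : ℝ × ℝ) y => y * f₃ p.1 p.2 y)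
    (measurable_snd.mul
      (measurable_assoc_triple h.measurable_f₃)).stronglyMeasurable).measurable.div
    h.measurable_designDensity

/-- The deviation of a response from the mean surface. -/
noncomputable def residual (f₃ : ℝ → ℝ → ℝ → ℝ) (s w y : ℝ) : ℝ := y - condMean f₃ s w

lemma SamplingModel.measurable_residual (h : SamplingModel P T Y Z N f₃ f₅) :
    Measurable fun p : ℝ × ℝ × ℝ => residual f₃ p.1 p.2.1 p.2.2 :=
  measurable_snd.snd.sub
    (h.measurable_condMean.comp (measurable_fst.prodMk measurable_snd.fst))

/-- The second moment of the residuals times the design density. -/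
noncomputable def residualMoment (f₃ : ℝ → ℝ → ℝ → ℝ) (s w : ℝ) : ℝ :=
  ∫ y, residual f₃ s w y ^ 2 * f₃ s w y

lemma SamplingModel.measurable_residualMoment (h : SamplingModel P T Y Z N f₃ f₅) :
    Measurable fun p : ℝ × ℝ => residualMoment f₃ p.1 p.2 :=
  (StronglyMeasurable.integral_prod_right
    (f := fun (p : ℝ × ℝ) y => residual f₃ p.1 p.2 y ^ 2 * f₃ p.1 p.2 y)
    (measurable_assoc_triple (F := fun s w y => residual f₃ s w y ^ 2 * f₃ s w y)
      ((h.measurable_residual.pow_const 2).mul h.measurable_f₃)).stronglyMeasurable).measurable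

section point

variable {s w : ℝ}

/-- The Bochner integral of a nonintegrable function is zero by convention, so a positive value
forces integrability. -/
lemma integrable_of_designDensity_pos (h : 0 < designDensity f₃ s w) : Integrable (f₃ s w) := by
  by_contra hn
  rw [designDensity, integral_undef hn] at h
  exact lt_irrefl _ h

lemma integrable_mul_of_sq {f : ℝ → ℝ} (h0 : Integrable f)
    (h2 : Integrable fun y => y ^ 2 * f y) : Integrable fun y => y * f y := by
  refine (h0.norm.add h2.norm).mono'
    (measurable_id.aestronglyMeasurable.mul h0.aestronglyMeasurable) (ae_of_all _ fun y => ?_)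
  simp only [Pi.add_apply, norm_mul, norm_pow, Real.norm_eq_abs]
  have h1 : |y| ≤ 1 + |y| ^ 2 := by nlinarith [sq_nonneg (|y| - 1), abs_nonneg y]
  calc |y| * |f y| ≤ (1 + |y| ^ 2) * |f y| := by gcongr
    _ = _ := by ring

lemma integral_residual_mul (h : 0 < designDensity f₃ s w)
    (h2 : Integrable fun y => y ^ 2 * f₃ s w y) : ∫ y, residual f₃ s w y * f₃ s w y = 0 := by
  have h0 := integrable_of_designDensity_pos h
  have h1 := integrable_mul_of_sq h0 h2
  have e : ∀ y, residual f₃ s w y * f₃ s w y = y * f₃ s w y - condMean f₃ s w * f₃ s w y := by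
    intro y
    rw [residual]
    ring
  simp_rw [e]
  rw [integral_sub h1 (h0.const_mul _), integral_const_mul, condMean]
  change _ - _ / _ * designDensity f₃ s w = 0
  field_simp
  ring

lemma integrable_residual_sq_mul (h : 0 < designDensity f₃ s w)
    (h2 : Integrable fun y => y ^ 2 * f₃ s w y) :
    Integrable fun y => residual f₃ s w y ^ 2 * f₃ s w y := by
  have h0 := integrable_of_designDensity_pos h
  have h1 := integrable_mul_of_sq h0 h2
  have := (h2.sub (h1.const_mul (2 * condMean f₃ s w))).add (h0.const_mul (condMean f₃ s w ^ 2))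
  refine this.congr (ae_of_all _ fun y => ?_)
  simp only [Pi.add_apply, Pi.sub_apply, residual]
  ring

lemma residualMoment_eq (h : 0 < designDensity f₃ s w) :
    residualMoment f₃ s w = condVar f₃ s w * designDensity f₃ s w := by
  rw [condVar, div_mul_cancel₀ _ h.ne']
  rfl

end point

/-- Bounds on a neighbourhood `U` of `(t, z)`. -/
structure LocalFacts (f₃ : ℝ → ℝ → ℝ → ℝ) (f₅ : ℝ → ℝ → ℝ → ℝ → ℝ → ℝ) (t z C : ℝ)
    (U : Set (ℝ × ℝ)) : Prop where
  mem_nhds : U ∈ 𝓝 (t, z)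
  design_integrable : ∀ p ∈ U, Integrable (f₃ p.1 p.2)
  design_le : ∀ p ∈ U, designDensity f₃ p.1 p.2 ≤ C
  residual_integrable : ∀ p ∈ U, Integrable fun y => residual f₃ p.1 p.2 y ^ 2 * f₃ p.1 p.2 y
  residual_le : ∀ p ∈ U, residualMoment f₃ p.1 p.2 ≤ C
  residual_mean : ∀ p ∈ U, ∫ y, residual f₃ p.1 p.2 y * f₃ p.1 p.2 y = 0
  mean_le : ∀ p ∈ U, |condMean f₃ p.1 p.2| ≤ C
  remainder_le : ∀ p ∈ U, |linRemainder (condMean f₃) t z p.1 p.2| ≤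
    C * ((p.1 - t) ^ 2 + (p.2 - z) ^ 2)
  pair_le : ∀ s₁ s₂ w, (s₁, w) ∈ U → (s₂, w) ∈ U → |pairDesignDensity f₅ s₁ s₂ w| ≤ C ∧
    |pairCovDensity f₃ f₅ s₁ s₂ w| ≤ C

lemma LocalFacts.nonneg {C : ℝ} {U : Set (ℝ × ℝ)} (h : LocalFacts f₃ f₅ t z C U) : 0 ≤ C :=
  (abs_nonneg _).trans (h.mean_le (t, z) (mem_of_mem_nhds h.mem_nhds))

/-- Near the point the design density is positive, so this moment is the product of conditional
variance and design density there, and both are continuous. -/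
lemma Regularity.continuousAt_residualMoment (h : Regularity f₃ f₅ t z) :
    ContinuousAt (fun p : ℝ × ℝ => residualMoment f₃ p.1 p.2) (t, z) := by
  have h1 := h.var_cont.mul h.f₂_smooth.continuousAt
  refine h1.congr ?_
  filter_upwards [h.f₂_smooth.continuousAt.eventually_const_lt h.f₂_pos] with p hp
  exact (residualMoment_eq hp).symm

theorem Regularity.exists_localFacts (h : Regularity f₃ f₅ t z) :
    ∃ C U, LocalFacts f₃ f₅ t z C U := by
  obtain ⟨C₁, hC₁, hr⟩ := h.mean_smooth.exists_linRemainder_le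
  obtain ⟨C₂, hp⟩ := h.pair_bdd
  have c1 := h.f₂_smooth.continuousAt
  have c2 := h.continuousAt_residualMoment
  have c3 := h.mean_smooth.continuousAt.abs
  obtain ⟨δ, hδ, hpb⟩ := Metric.eventually_nhds_iff.1 hp
  -- Values at the point plus one bound continuous functions nearby; the remaining entries bound the
  -- Taylor remainder and the pair quantities.
  set C := max (max C₁ C₂) (max (max (designDensity f₃ t z + 1) (residualMoment f₃ t z + 1))
    (|condMean f₃ t z| + 1)) with hC
  have l1 : C₁ ≤ C := (le_max_left _ _).trans (le_max_left _ _)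
  have l2 : C₂ ≤ C := (le_max_right _ _).trans (le_max_left _ _)
  have l3 : designDensity f₃ t z + 1 ≤ C :=
    ((le_max_left _ _).trans (le_max_left _ _)).trans (le_max_right _ _)
  have l4 : residualMoment f₃ t z + 1 ≤ C :=
    ((le_max_right _ _).trans (le_max_left _ _)).trans (le_max_right _ _)
  have l5 : |condMean f₃ t z| + 1 ≤ C := (le_max_right _ _).trans (le_max_right _ _)
  have e1 := c1.eventually_const_lt h.f₂_pos
  have e2 := c1.eventually_lt_const (lt_add_one _)
  have e3 := c2.eventually_lt_const (lt_add_one _)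
  have e4 := c3.eventually_lt_const (lt_add_one _)
  have e5 : ∀ᶠ p in 𝓝 (t, z), dist p (t, z) < δ := Metric.ball_mem_nhds _ hδ
  refine ⟨C, {p | (0 < designDensity f₃ p.1 p.2 ∧ designDensity f₃ p.1 p.2 ≤ C) ∧
    residualMoment f₃ p.1 p.2 ≤ C ∧ |condMean f₃ p.1 p.2| ≤ C ∧ dist p (t, z) < δ ∧
    (Integrable fun y : ℝ => y ^ 2 * f₃ p.1 p.2 y) ∧
    |linRemainder (condMean f₃) t z p.1 p.2| ≤ C * ((p.1 - t) ^ 2 + (p.2 - z) ^ 2)}, ?_, ?_, ?_,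
    ?_, ?_, ?_, ?_, ?_, ?_⟩
  · filter_upwards [e1, e2, e3, e4, e5, h.second_moment, hr] with p k1 k2 k3 k4 k5 k6 k7
    refine ⟨⟨k1, k2.le.trans l3⟩, k3.le.trans l4, k4.le.trans l5, k5, k6, k7.trans ?_⟩
    gcongr
  · exact fun p hp => integrable_of_designDensity_pos hp.1.1
  · exact fun p hp => hp.1.2
  · exact fun p hp => integrable_residual_sq_mul hp.1.1 hp.2.2.2.2.1
  · exact fun p hp => hp.2.1
  · exact fun p hp => integral_residual_mul hp.1.1 hp.2.2.2.2.1
  · exact fun p hp => hp.2.2.1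
  · exact fun p hp => hp.2.2.2.2.2
  · intro s₁ s₂ w h1 h2
    have d1 := h1.2.2.2.1
    have d2 := h2.2.2.2.1
    rw [Prod.dist_eq, max_lt_iff] at d1 d2
    -- In the maximum metric, closeness of `(s₁, w)` and `(s₂, w)` to `(t, z)` is closeness of the
    -- triple to `(t, t, z)`.
    have := @hpb (s₁, s₂, w) (by
      rw [Prod.dist_eq, Prod.dist_eq, max_lt_iff, max_lt_iff]
      exact ⟨d1.1, d2.1, d1.2⟩)
    exact ⟨this.1.trans l2, this.2.trans l2⟩

end localFacts


section summands

set_option linter.unusedSectionVars false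

variable {Ω : Type*} [MeasurableSpace Ω] {P : Measure Ω} [IsProbabilityMeasure P]
  {T Y : ℕ → ℕ → Ω → ℝ} {Z : ℕ → Ω → ℝ}
  {N : ℕ → ℕ → Ω → ℕ} {f₃ : ℝ → ℝ → ℝ → ℝ} {f₅ : ℝ → ℝ → ℝ → ℝ → ℝ → ℝ} {t z C δ : ℝ}
  {U : Set (ℝ × ℝ)} {φ : ℝ → ℝ → ℝ}

/-! ### Summands that depend on the design only -/

lemma SamplingModel.integrable_design_sq (h : SamplingModel P T Y Z N f₃ f₅)
    (hl : LocalFacts f₃ f₅ t z C U) (hφ : Measurable fun p : ℝ × ℝ => φ p.1 p.2)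
    (hU : ∀ s w, φ s w ≠ 0 → (s, w) ∈ U) (hφ2 : Integrable fun p : ℝ × ℝ => φ p.1 p.2 ^ 2) :
    Integrable fun q : (ℝ × ℝ) × ℝ => (φ q.1.1 q.1.2 * (1 : ℝ)) ^ 2 * f₃ q.1.1 q.1.2 q.2 :=
  h.integrable_localized_sq (A := fun _ _ _ => 1) hφ measurable_const hU
    (fun p hp => by simpa using hl.design_integrable p hp)
    (fun p hp => by simpa [designDensity] using hl.design_le p hp) hφ2

lemma SamplingModel.memLp_design (h : SamplingModel P T Y Z N f₃ f₅)
    (hl : LocalFacts f₃ f₅ t z C U) (hφ : Measurable fun p : ℝ × ℝ => φ p.1 p.2)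
    (hU : ∀ s w, φ s w ≠ 0 → (s, w) ∈ U) (hφ2 : Integrable fun p : ℝ × ℝ => φ p.1 p.2 ^ 2) :
    MemLp (fun ω => φ (T 0 0 ω) (Z 0 ω)) 2 P := by
  simpa using h.memLp_localized (A := fun _ _ _ => 1) hφ measurable_const
    (h.integrable_design_sq hl hφ hU hφ2)

lemma SamplingModel.singleMean_design (h : SamplingModel P T Y Z N f₃ f₅)
    (hl : LocalFacts f₃ f₅ t z C U) (hφ : Measurable fun p : ℝ × ℝ => φ p.1 p.2)
    (hU : ∀ s w, φ s w ≠ 0 → (s, w) ∈ U) (hφ2 : Integrable fun p : ℝ × ℝ => φ p.1 p.2 ^ 2) :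
    singleMean P T Y Z (fun s w _ => φ s w) =
      ∫ p : ℝ × ℝ, φ p.1 p.2 * designDensity f₃ p.1 p.2 := by
  simpa [designDensity] using h.singleMean_localized (A := fun _ _ _ => 1) hφ measurable_const
    (h.integrable_design_sq hl hφ hU hφ2)

lemma SamplingModel.singleMean_design_sq_le (h : SamplingModel P T Y Z N f₃ f₅)
    (hl : LocalFacts f₃ f₅ t z C U) (hφ : Measurable fun p : ℝ × ℝ => φ p.1 p.2)
    (hU : ∀ s w, φ s w ≠ 0 → (s, w) ∈ U) (hφ2 : Integrable fun p : ℝ × ℝ => φ p.1 p.2 ^ 2) :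
    singleMean P T Y Z (fun s w _ => φ s w ^ 2) ≤ C * ∫ p : ℝ × ℝ, φ p.1 p.2 ^ 2 := by
  have h1 := h.singleMean_sq_localized (A := fun _ _ _ => 1) hφ measurable_const
    (h.integrable_design_sq hl hφ hU hφ2)
  simp only [mul_one, one_pow, one_mul] at h1
  rw [h1, ← integral_const_mul]
  refine integral_mono_of_nonneg (ae_of_all _ fun p => ?_) (hφ2.const_mul C)
    (ae_of_all _ fun p => ?_)
  · exact mul_nonneg (sq_nonneg _) (integral_nonneg fun y => h.f₃_nonneg _ _ _)
  · simp only
    by_cases h0 : φ p.1 p.2 = 0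
    · simp [h0]
    · rw [mul_comm C]
      exact mul_le_mul_of_nonneg_left (hl.design_le p (hU _ _ h0)) (sq_nonneg _)

lemma SamplingModel.abs_pairMean_design_le (h : SamplingModel P T Y Z N f₃ f₅)
    (hl : LocalFacts f₃ f₅ t z C U) (hφ : Measurable fun p : ℝ × ℝ => φ p.1 p.2)
    (hU : ∀ s w, φ s w ≠ 0 → (s, w) ∈ U) (hφ2 : Integrable fun p : ℝ × ℝ => φ p.1 p.2 ^ 2)
    (hδ : 0 ≤ δ) (hbox : ∀ s w, φ s w ≠ 0 → |s - t| ≤ δ) :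
    |pairMean P T Y Z (fun s w _ => φ s w)| ≤ C * (2 * δ * ∫ p : ℝ × ℝ, φ p.1 p.2 ^ 2) := by
  have h1 := h.abs_pairMean_le (A := fun _ _ _ => 1) hφ measurable_const
    (by simpa using h.memLp_design hl hφ hU hφ2) hφ2 hδ hbox (C := C) (fun s₁ s₂ w h1 h2 => by
      simpa [pairDesignDensity] using (hl.pair_le s₁ s₂ w (hU _ _ h1) (hU _ _ h2)).1)
  simpa using h1

/-- The diagonal contributes the `1` and the pairs contribute `E N² / E N` times the window width;
the latter vanishes in the limit when `δ` is of the order of the bandwidth. -/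
lemma SamplingModel.variance_design_le (h : SamplingModel P T Y Z N f₃ f₅)
    (hN : CountMoments P N)
    (hl : LocalFacts f₃ f₅ t z C U) (hφ : Measurable fun p : ℝ × ℝ => φ p.1 p.2)
    (hU : ∀ s w, φ s w ≠ 0 → (s, w) ∈ U) (hφ2 : Integrable fun p : ℝ × ℝ => φ p.1 p.2 ^ 2)
    (hδ : 0 ≤ δ) (hbox : ∀ s w, φ s w ≠ 0 → |s - t| ≤ δ) (n : ℕ) :
    variance (totalSum T Y Z N (fun s w _ => φ s w) n) P ≤
      n * momentN P N 1 n * (∫ p : ℝ × ℝ, φ p.1 p.2 ^ 2) *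
        (C * (1 + momentN P N 2 n / momentN P N 1 n * (2 * δ))) := by
  have hm : Measurable fun p : ℝ × ℝ × ℝ => φ p.1 p.2.1 :=
    hφ.comp (measurable_fst.prodMk measurable_snd.fst)
  have h1 := h.variance_totalSum_le hN (g := fun s w _ => φ s w) hm
    (h.memLp_design hl hφ hU hφ2) n
  have h2 := h.singleMean_design_sq_le hl hφ hU hφ2
  have h3 := (le_abs_self _).trans (h.abs_pairMean_design_le hl hφ hU hφ2 hδ hbox)
  have h4 := h.one_le_momentN hN n
  have h5 := h.momentN_one_le_two hN n
  have hC := hl.nonneg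
  have hI : 0 ≤ ∫ p : ℝ × ℝ, φ p.1 p.2 ^ 2 := integral_nonneg fun _ => sq_nonneg _
  refine h1.trans ?_
  set I := ∫ p : ℝ × ℝ, φ p.1 p.2 ^ 2
  set m₁ := momentN P N 1 n
  set m₂ := momentN P N 2 n
  have h6 : (m₂ - m₁) * pairMean P T Y Z (fun s w _ => φ s w) ≤ m₂ * (C * (2 * δ * I)) :=
    calc _ ≤ (m₂ - m₁) * (C * (2 * δ * I)) := mul_le_mul_of_nonneg_left h3 (by linarith)
      _ ≤ _ := mul_le_mul_of_nonneg_right (by linarith) (by positivity)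
  have h7 : m₁ * singleMean P T Y Z (fun s w _ => φ s w ^ 2) ≤ m₁ * (C * I) :=
    mul_le_mul_of_nonneg_left h2 (by linarith)
  calc _ ≤ (n : ℝ) * (m₁ * (C * I) + m₂ * (C * (2 * δ * I))) :=
        mul_le_mul_of_nonneg_left (add_le_add h7 h6) (Nat.cast_nonneg n)
    _ = _ := by field_simp

/-! ### Residual summands -/

lemma SamplingModel.integrable_noise_sq (h : SamplingModel P T Y Z N f₃ f₅)
    (hl : LocalFacts f₃ f₅ t z C U) (hφ : Measurable fun p : ℝ × ℝ => φ p.1 p.2)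
    (hU : ∀ s w, φ s w ≠ 0 → (s, w) ∈ U) (hφ2 : Integrable fun p : ℝ × ℝ => φ p.1 p.2 ^ 2) :
    Integrable fun q : (ℝ × ℝ) × ℝ =>
      (φ q.1.1 q.1.2 * residual f₃ q.1.1 q.1.2 q.2) ^ 2 * f₃ q.1.1 q.1.2 q.2 :=
  h.integrable_localized_sq hφ h.measurable_residual hU hl.residual_integrable hl.residual_le hφ2

lemma SamplingModel.memLp_noise (h : SamplingModel P T Y Z N f₃ f₅)
    (hl : LocalFacts f₃ f₅ t z C U) (hφ : Measurable fun p : ℝ × ℝ => φ p.1 p.2)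
    (hU : ∀ s w, φ s w ≠ 0 → (s, w) ∈ U) (hφ2 : Integrable fun p : ℝ × ℝ => φ p.1 p.2 ^ 2) :
    MemLp (fun ω => φ (T 0 0 ω) (Z 0 ω) * residual f₃ (T 0 0 ω) (Z 0 ω) (Y 0 0 ω)) 2 P :=
  h.memLp_localized hφ h.measurable_residual (h.integrable_noise_sq hl hφ hU hφ2)

/-- Residuals are centered conditionally on the design. -/
lemma SamplingModel.singleMean_noise (h : SamplingModel P T Y Z N f₃ f₅)
    (hl : LocalFacts f₃ f₅ t z C U) (hφ : Measurable fun p : ℝ × ℝ => φ p.1 p.2)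
    (hU : ∀ s w, φ s w ≠ 0 → (s, w) ∈ U) (hφ2 : Integrable fun p : ℝ × ℝ => φ p.1 p.2 ^ 2) :
    singleMean P T Y Z (fun s w y => φ s w * residual f₃ s w y) = 0 := by
  rw [h.singleMean_localized hφ h.measurable_residual (h.integrable_noise_sq hl hφ hU hφ2)]
  refine integral_eq_zero_of_ae (ae_of_all _ fun p => ?_)
  by_cases h0 : φ p.1 p.2 = 0
  · simp [h0]
  · simp [hl.residual_mean p (hU _ _ h0)]

lemma SamplingModel.singleMean_noise_sq (h : SamplingModel P T Y Z N f₃ f₅)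
    (hl : LocalFacts f₃ f₅ t z C U) (hφ : Measurable fun p : ℝ × ℝ => φ p.1 p.2)
    (hU : ∀ s w, φ s w ≠ 0 → (s, w) ∈ U) (hφ2 : Integrable fun p : ℝ × ℝ => φ p.1 p.2 ^ 2) :
    singleMean P T Y Z (fun s w y => (φ s w * residual f₃ s w y) ^ 2) =
      ∫ p : ℝ × ℝ, φ p.1 p.2 ^ 2 * residualMoment f₃ p.1 p.2 :=
  h.singleMean_sq_localized hφ h.measurable_residual (h.integrable_noise_sq hl hφ hU hφ2)

lemma SamplingModel.abs_pairMean_noise_le (h : SamplingModel P T Y Z N f₃ f₅)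
    (hl : LocalFacts f₃ f₅ t z C U) (hφ : Measurable fun p : ℝ × ℝ => φ p.1 p.2)
    (hU : ∀ s w, φ s w ≠ 0 → (s, w) ∈ U) (hφ2 : Integrable fun p : ℝ × ℝ => φ p.1 p.2 ^ 2)
    (hδ : 0 ≤ δ) (hbox : ∀ s w, φ s w ≠ 0 → |s - t| ≤ δ) :
    |pairMean P T Y Z (fun s w y => φ s w * residual f₃ s w y)| ≤
      C * (2 * δ * ∫ p : ℝ × ℝ, φ p.1 p.2 ^ 2) :=
  h.abs_pairMean_le hφ h.measurable_residual (h.memLp_noise hl hφ hU hφ2) hφ2 hδ hbox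
    fun s₁ s₂ w h1 h2 => (hl.pair_le s₁ s₂ w (hU _ _ h1) (hU _ _ h2)).2

end summands

/-! ### Consequences of the bandwidth conditions -/

section bandwidths

set_option linter.unusedSectionVars false

variable {Ω : Type*} [MeasurableSpace Ω] {P : Measure Ω} [IsProbabilityMeasure P]
  {T Y : ℕ → ℕ → Ω → ℝ} {Z : ℕ → Ω → ℝ} {f₃ : ℝ → ℝ → ℝ → ℝ} {f₅ : ℝ → ℝ → ℝ → ℝ → ℝ → ℝ}
  {N : ℕ → ℕ → Ω → ℕ} {ht hz : ℕ → ℝ} {ρ τ : ℝ}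

/-- The expected effective sample size `n E(N) h_t h_z`. -/
noncomputable def effSize (P : Measure Ω) (N : ℕ → ℕ → Ω → ℕ) (ht hz : ℕ → ℝ) (n : ℕ) : ℝ :=
  n * momentN P N 1 n * (ht n * hz n)

namespace BandwidthConditions

lemma hz_eq (hb : BandwidthConditions P N ht hz ρ τ) (n : ℕ) :
    hz n = hz n / ht n * ht n := (div_mul_cancel₀ _ (hb.ht_pos n).ne').symm

lemma hz_tendsto (hb : BandwidthConditions P N ht hz ρ τ) : Tendsto hz atTop (𝓝 0) := by
  have := hb.ratio.mul hb.ht_tendsto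
  rw [mul_zero] at this
  exact this.congr fun n => (hb.hz_eq n).symm

lemma effSize_tendsto (hb : BandwidthConditions P N ht hz ρ τ) (hρ : 0 < ρ) :
    Tendsto (effSize P N ht hz) atTop atTop := by
  refine (hb.effective_size.atTop_mul_pos hρ hb.ratio).congr fun n => ?_
  have := (hb.ht_pos n).ne'
  rw [effSize]
  field_simp

lemma sqrt_effSize_mul_tendsto (hb : BandwidthConditions P N ht hz ρ τ) (hτ : 0 < τ) :
    Tendsto (fun n => √(effSize P N ht hz n) * ht n ^ 2) atTop (𝓝 (τ * √ρ)) := by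
  have h1 := (hb.rate.mul hb.ratio).sqrt
  rw [Real.sqrt_mul (sq_nonneg τ), Real.sqrt_sq hτ.le] at h1
  refine h1.congr fun n => ?_
  have h2 := hb.ht_pos n
  -- The rate condition times the bandwidth ratio is the square of `√q h_t²`; its limit is `τ² ρ`.
  have e : n * momentN P N 1 n * ht n ^ 6 * (hz n / ht n) =
      effSize P N ht hz n * (ht n ^ 2) ^ 2 := by
    rw [effSize]
    field_simp
  rw [e, Real.sqrt_mul' _ (sq_nonneg _), Real.sqrt_sq (sq_nonneg _)]

/-- Write `(E N² / E N) h_t` as `E N² / (E N)²`, which is bounded, times `E N · h_t`, which tends to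
zero. -/
lemma count_ratio_mul_tendsto (hb : BandwidthConditions P N ht hz ρ τ) (hN : CountMoments P N)
    (h : SamplingModel P T Y Z N f₃ f₅) :
    Tendsto (fun n => momentN P N 2 n / momentN P N 1 n * ht n) atTop (𝓝 0) := by
  have hpos : ∀ n, 0 < momentN P N 1 n := fun n => one_pos.trans_le (h.one_le_momentN hN n)
  obtain ⟨B, hB⟩ := hN.second
  rw [eventually_map] at hB
  have h1 := hb.sparse.const_mul (max B 0)
  rw [mul_zero] at h1
  refine squeeze_zero' (Eventually.of_forall fun n => ?_) ?_ h1
  · have := (hpos n).le.trans (h.momentN_one_le_two hN n)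
    have := (hpos n).le
    have := (hb.ht_pos n).le
    positivity
  · filter_upwards [hB] with n hn
    have e : momentN P N 2 n / momentN P N 1 n * ht n =
        momentN P N 2 n / momentN P N 1 n ^ 2 * (momentN P N 1 n * ht n) := by
      have := (hpos n).ne'
      field_simp
    rw [e]
    exact mul_le_mul_of_nonneg_right (hn.trans (le_max_left _ _))
      (mul_nonneg (hpos n).le (hb.ht_pos n).le)

end BandwidthConditions

end bandwidths


/-! ### Laws of large numbers for the design -/

/-- Chebyshev's inequality at radius `ε / 2`; the other half absorbs the deviation of the mean from
its limit. -/
theorem tendstoInMeasure_const_of_variance {Ω : Type*} [MeasurableSpace Ω] {P : Measure Ω}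
    [IsProbabilityMeasure P] {X : ℕ → Ω → ℝ} {c : ℝ} (hX : ∀ᶠ n in atTop, MemLp (X n) 2 P)
    (hmean : Tendsto (fun n => ∫ ω, X n ω ∂P) atTop (𝓝 c))
    (hvar : Tendsto (fun n => variance (X n) P) atTop (𝓝 0)) :
    TendstoInMeasure P X atTop fun _ => c := by
  rw [tendstoInMeasure_iff_norm]
  intro ε hε
  have h1 : Tendsto (fun n => ENNReal.ofReal (variance (X n) P / (ε / 2) ^ 2)) atTop (𝓝 0) := by
    have := ENNReal.tendsto_ofReal (hvar.div_const ((ε / 2) ^ 2))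
    simpa using this
  refine tendsto_of_tendsto_of_tendsto_of_le_of_le' tendsto_const_nhds h1
    (Eventually.of_forall fun _ => zero_le) ?_
  have h2 := (Metric.tendsto_nhds.1 hmean) (ε / 2) (half_pos hε)
  filter_upwards [hX, h2] with n hn h2n
  refine le_trans (measure_mono fun ω hω => ?_) (meas_ge_le_variance_div_sq hn (half_pos hε))
  simp only [Set.mem_ofPred_eq, Real.norm_eq_abs, Real.dist_eq] at hω h2n ⊢
  have := abs_sub_le (X n ω) (∫ ω, X n ω ∂P) c
  linarith

section design

set_option linter.unusedSectionVars false

variable {Ω : Type*} [MeasurableSpace Ω] {P : Measure Ω} [IsProbabilityMeasure P]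
  {T Y : ℕ → ℕ → Ω → ℝ} {Z : ℕ → Ω → ℝ}
  {N : ℕ → ℕ → Ω → ℕ} {f₃ : ℝ → ℝ → ℝ → ℝ} {f₅ : ℝ → ℝ → ℝ → ℝ → ℝ → ℝ} {t z C R ρ τ : ℝ}
  {U : Set (ℝ × ℝ)} {L : ℝ → ℝ → ℝ} {ht hz : ℕ → ℝ}

lemma effSize_pos (h : SamplingModel P T Y Z N f₃ f₅) (hN : CountMoments P N)
    (hb : BandwidthConditions P N ht hz ρ τ) {n : ℕ} (hn : 0 < n) :
    0 < effSize P N ht hz n := by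
  have h1 := h.one_le_momentN hN n
  have h2 := hb.ht_pos n
  have h3 := hb.hz_pos n
  have h4 : (0 : ℝ) < n := by exact_mod_cast hn
  unfold effSize
  positivity

/-- A law of large numbers for sums over the design: `φ n` is a window scaled by the bandwidths
and multiplied by a factor `κ n` that is bounded by `B n`. -/
theorem SamplingModel.tendstoInMeasure_design (h : SamplingModel P T Y Z N f₃ f₅)
    (hN : CountMoments P N) (hl : LocalFacts f₃ f₅ t z C U)
    (hb : BandwidthConditions P N ht hz ρ τ) (hL : Window L R) {κ : ℕ → ℝ → ℝ → ℝ}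
    {B : ℕ → ℝ} {c : ℕ → ℝ} {m : ℝ} (hκ : ∀ n, Measurable fun p : ℝ × ℝ => κ n p.1 p.2)
    (hκB : ∀ᶠ n in atTop, ∀ s w, |s - t| ≤ R * ht n → |w - z| ≤ R * hz n → |κ n s w| ≤ B n)
    (hmean : Tendsto (fun n => c n * effSize P N ht hz n * ∫ s : ℝ × ℝ, L s.1 s.2 *
      (κ n (t - ht n * s.1) (z - hz n * s.2) *
        designDensity f₃ (t - ht n * s.1) (z - hz n * s.2))) atTop (𝓝 m))
    (hvar : Tendsto (fun n => c n ^ 2 * effSize P N ht hz n * B n ^ 2) atTop (𝓝 0)) :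
    TendstoInMeasure P (fun n ω => c n *
      totalSum T Y Z N (fun s w _ => scaled L t z (ht n) (hz n) s w * κ n s w) n ω) atTop
      fun _ => m := by
  set φ : ℕ → ℝ → ℝ → ℝ := fun n s w => scaled L t z (ht n) (hz n) s w * κ n s w with hφ
  have hφm : ∀ n, Measurable fun p : ℝ × ℝ => φ n p.1 p.2 := fun n =>
    hL.measurable_scaled.mul (hκ n)
  have hφm' : ∀ n, Measurable fun p : ℝ × ℝ × ℝ => φ n p.1 p.2.1 := fun n =>
    (hφm n).comp (measurable_fst.prodMk measurable_snd.fst)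
  have hsupp : ∀ n s w, φ n s w ≠ 0 → |s - t| ≤ R * ht n ∧ |w - z| ≤ R * hz n :=
    fun n s w hs => hL.scaled_support (hb.ht_pos n) (hb.hz_pos n) (left_ne_zero_of_mul hs)
  have hUev : ∀ᶠ n in atTop, ∀ s w, φ n s w ≠ 0 → (s, w) ∈ U := by
    filter_upwards [eventually_rescale_mem hb.ht_tendsto hb.hz_tendsto R hl.mem_nhds] with n hn s w hs
    have := hsupp n s w hs
    rw [abs_of_pos (hb.ht_pos n), abs_of_pos (hb.hz_pos n)] at hn
    exact hn s w this.1 this.2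
  have hsq : ∀ᶠ n in atTop, ∀ p : ℝ × ℝ, φ n p.1 p.2 ^ 2 ≤
      B n ^ 2 * scaled L t z (ht n) (hz n) p.1 p.2 ^ 2 := by
    filter_upwards [hκB] with n hn p
    by_cases h0 : φ n p.1 p.2 = 0
    · rw [h0]
      simp only [ne_eq, OfNat.ofNat_ne_zero, not_false_eq_true, zero_pow]
      positivity
    · have h1 := hsupp n _ _ h0
      have h2 := hn _ _ h1.1 h1.2
      rw [hφ, mul_pow, mul_comm]
      refine mul_le_mul_of_nonneg_right ?_ (sq_nonneg _)
      exact sq_le_sq' (by linarith [neg_abs_le (κ n p.1 p.2)])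
        (by linarith [le_abs_self (κ n p.1 p.2)])
  have hint : ∀ᶠ n in atTop, Integrable fun p : ℝ × ℝ => φ n p.1 p.2 ^ 2 := by
    filter_upwards [hsq] with n hn
    refine ((hL.integrable_scaled_sq (t := t) (z := z) (hb.ht_pos n) (hb.hz_pos n)).const_mul
      (B n ^ 2)).mono' ((hφm n).pow_const 2).aestronglyMeasurable (ae_of_all _ fun p => ?_)
    rw [Real.norm_eq_abs, abs_sq]
    exact hn p
  have hintle : ∀ᶠ n in atTop, ∫ p : ℝ × ℝ, φ n p.1 p.2 ^ 2 ≤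
      B n ^ 2 * (ht n * hz n * ∫ s : ℝ × ℝ, L s.1 s.2 ^ 2) := by
    filter_upwards [hsq, hint] with n hn hi
    rw [← integral_scaled_sq (t := t) (z := z) (hb.ht_pos n) (hb.hz_pos n), ← integral_const_mul]
    exact integral_mono hi ((hL.integrable_scaled_sq (hb.ht_pos n) (hb.hz_pos n)).const_mul _) hn
  refine tendstoInMeasure_const_of_variance ?_ ?_ ?_
  · filter_upwards [hUev, hint] with n h1 h2
    exact (h.memLp_totalSum hN (hφm' n) (h.memLp_design hl (hφm n) h1 h2) n).const_mul (c n)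
  · refine hmean.congr' ?_
    filter_upwards [hUev, hint] with n h1 h2
    rw [integral_const_mul, h.integral_totalSum hN (hφm' n) (h.memLp_design hl (hφm n) h1 h2),
      h.singleMean_design hl (hφm n) h1 h2]
    simp_rw [hφ, mul_assoc (scaled _ _ _ _ _ _ _)]
    rw [integral_scaled_mul (hb.ht_pos n) (hb.hz_pos n)
      fun s w => κ n s w * designDensity f₃ s w, effSize]
    ring
  -- The variance is at most `c² q B²` times a factor that stays bounded, because the pair
  -- contribution in it tends to zero.
  · have hlim : Tendsto (fun n => c n ^ 2 * effSize P N ht hz n * B n ^ 2 *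
        ((∫ s : ℝ × ℝ, L s.1 s.2 ^ 2) *
          (C * (1 + momentN P N 2 n / momentN P N 1 n * ht n * (2 * R))))) atTop (𝓝 0) := by
      have := hvar.mul ((((hb.count_ratio_mul_tendsto hN h).mul_const (2 * R)).const_add
        1).const_mul C |>.const_mul (∫ s : ℝ × ℝ, L s.1 s.2 ^ 2))
      simpa using this
    refine squeeze_zero' (Eventually.of_forall fun n => variance_nonneg _ _) ?_ hlim
    filter_upwards [hUev, hint, hintle] with n h1 h2 h3
    have ha := hb.ht_pos n
    have hv := h.variance_design_le hN hl (hφm n) h1 h2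
      (mul_nonneg hL.radius_nonneg ha.le) (fun s w hs => (hsupp n s w hs).1) n
    rw [variance_const_mul]
    have h4 := h.one_le_momentN hN n
    have h5 := h.momentN_one_le_two hN n
    have hC := hl.nonneg
    have hR := hL.radius_nonneg
    have hfac : 0 ≤ C * (1 + momentN P N 2 n / momentN P N 1 n * (2 * (R * ht n))) := by
      have : 0 ≤ momentN P N 2 n / momentN P N 1 n := div_nonneg (by linarith) (by linarith)
      positivity
    calc _ ≤ c n ^ 2 * (n * momentN P N 1 n *
          (B n ^ 2 * (ht n * hz n * ∫ s : ℝ × ℝ, L s.1 s.2 ^ 2)) *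
          (C * (1 + momentN P N 2 n / momentN P N 1 n * (2 * (R * ht n))))) := by
          refine mul_le_mul_of_nonneg_left (hv.trans ?_) (sq_nonneg _)
          refine mul_le_mul_of_nonneg_right ?_ hfac
          exact mul_le_mul_of_nonneg_left h3 (mul_nonneg (Nat.cast_nonneg n) (by linarith))
      _ = _ := by rw [effSize]; ring

/-- With normalization `1 / q` and constant factor `1`, the variance is of order `1 / q`, and the
mean converges by continuity of the design density. -/
theorem SamplingModel.tendstoInMeasure_weights (h : SamplingModel P T Y Z N f₃ f₅)
    (hN : CountMoments P N) (hl : LocalFacts f₃ f₅ t z C U) (hreg : Regularity f₃ f₅ t z)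
    (hρ : 0 < ρ) (hb : BandwidthConditions P N ht hz ρ τ) (hL : Window L R) :
    TendstoInMeasure P (fun n ω => (effSize P N ht hz n)⁻¹ *
      totalSum T Y Z N (fun s w _ => scaled L t z (ht n) (hz n) s w) n ω) atTop
      fun _ => (∫ s : ℝ × ℝ, L s.1 s.2) * designDensity f₃ t z := by
  have hq := hb.effSize_tendsto hρ
  have hmean := tendsto_integral_window_mul_of_continuousAt hL.integrable
    (fun s hs => hL.support _ _ hs) hb.ht_tendsto hb.hz_tendsto h.measurable_designDensity
    hreg.f₂_smooth.continuousAt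
  have := h.tendstoInMeasure_design hN hl hb hL (κ := fun _ _ _ => 1) (B := fun _ => 1)
    (c := fun n => (effSize P N ht hz n)⁻¹)
    (m := (∫ s : ℝ × ℝ, L s.1 s.2) * designDensity f₃ t z)
    (fun _ => measurable_const) (Eventually.of_forall fun _ _ _ _ _ => by simp) ?_ ?_
  · simpa using this
  · refine hmean.congr' ?_
    filter_upwards [hq.eventually_gt_atTop 0] with n hn
    rw [inv_mul_cancel₀ hn.ne']
    simp
  · refine hq.inv_tendsto_atTop.congr' ?_
    filter_upwards [hq.eventually_gt_atTop 0] with n hn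
    simp only [Pi.inv_apply]
    field_simp

end design


/-! ### Convergence of the Taylor remainder terms -/

section bias

set_option linter.unusedSectionVars false

variable {Ω : Type*} [MeasurableSpace Ω] {P : Measure Ω} [IsProbabilityMeasure P]
  {T Y : ℕ → ℕ → Ω → ℝ} {Z : ℕ → Ω → ℝ}
  {N : ℕ → ℕ → Ω → ℕ} {f₃ : ℝ → ℝ → ℝ → ℝ} {f₅ : ℝ → ℝ → ℝ → ℝ → ℝ → ℝ} {t z C R ρ τ : ℝ}
  {U : Set (ℝ × ℝ)} {L : ℝ → ℝ → ℝ} {ht hz : ℕ → ℝ}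

lemma SamplingModel.measurable_linRemainder (h : SamplingModel P T Y Z N f₃ f₅) (t z : ℝ) :
    Measurable fun p : ℝ × ℝ => linRemainder (condMean f₃) t z p.1 p.2 := by
  unfold linRemainder
  exact ((h.measurable_condMean.sub_const _).sub
    ((measurable_fst.sub_const t).mul_const _)).sub ((measurable_snd.sub_const z).mul_const _)

lemma BandwidthConditions.sqrt_effSize_mul_mul_tendsto
    (hb : BandwidthConditions P N ht hz ρ τ) (hτ : 0 < τ) :
    Tendsto (fun n => √(effSize P N ht hz n) * (ht n * hz n)) atTop (𝓝 (τ * √ρ * ρ)) := by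
  refine ((hb.sqrt_effSize_mul_tendsto hτ).mul hb.ratio).congr fun n => ?_
  have := (hb.ht_pos n).ne'
  field_simp

lemma BandwidthConditions.sqrt_effSize_mul_sq_tendsto
    (hb : BandwidthConditions P N ht hz ρ τ) (hτ : 0 < τ) :
    Tendsto (fun n => √(effSize P N ht hz n) * hz n ^ 2) atTop (𝓝 (τ * √ρ * ρ ^ 2)) := by
  refine ((hb.sqrt_effSize_mul_tendsto hτ).mul (hb.ratio.pow 2)).congr fun n => ?_
  have := (hb.ht_pos n).ne'
  field_simp

/-- The limit of the rescaled Taylor remainder of `μ` at `(t, z)`. -/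
noncomputable def limitQuad (f : ℝ → ℝ → ℝ) (t z ρ τ : ℝ) (s : ℝ × ℝ) : ℝ :=
  τ * √ρ * taylorQuad f t z s.1 (ρ * s.2)

/-- The Taylor error is of smaller order than `h_t² + h_z²`, and `√q` times the latter is bounded.
The quadratic part has an exact limit, as its three monomials scale with powers of the bandwidth
ratio. -/
lemma BandwidthConditions.tendsto_sqrt_effSize_mul_remainder
    (hb : BandwidthConditions P N ht hz ρ τ) (hτ : 0 < τ) {f : ℝ → ℝ → ℝ}
    (hf : HasContSecondPartials f t z) (s : ℝ × ℝ) :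
    Tendsto (fun n => √(effSize P N ht hz n) *
      linRemainder f t z (t - ht n * s.1) (z - hz n * s.2)) atTop (𝓝 (limitQuad f t z ρ τ s)) := by
  have k1 := hb.sqrt_effSize_mul_tendsto hτ
  have k2 := hb.sqrt_effSize_mul_mul_tendsto hτ
  have k3 := hb.sqrt_effSize_mul_sq_tendsto hτ
  have h1 : (fun p : ℝ × ℝ => linRemainder f t z p.1 p.2 - taylorQuad f t z (p.1 - t) (p.2 - z))
      =o[𝓝 (t, z)] fun p : ℝ × ℝ => (p.1 - t) ^ 2 + (p.2 - z) ^ 2 := by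
    refine Asymptotics.isLittleO_iff.2 fun ε hε => ?_
    filter_upwards [hf.taylor hε] with p hp
    rwa [Real.norm_eq_abs, Real.norm_eq_abs,
      abs_of_nonneg (by positivity : 0 ≤ (p.1 - t) ^ 2 + (p.2 - z) ^ 2)]
  have h2 := h1.comp_tendsto (tendsto_rescale (t := t) (z := z) hb.ht_tendsto hb.hz_tendsto s)
  have h3 := (Asymptotics.isBigO_refl (fun n => √(effSize P N ht hz n)) atTop).mul_isLittleO h2
  have h4 : Tendsto (fun n => √(effSize P N ht hz n) *
      (((t - ht n * s.1) - t) ^ 2 + ((z - hz n * s.2) - z) ^ 2)) atTop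
      (𝓝 (τ * √ρ * s.1 ^ 2 + τ * √ρ * ρ ^ 2 * s.2 ^ 2)) := by
    refine ((k1.mul_const (s.1 ^ 2)).add (k3.mul_const (s.2 ^ 2))).congr fun n => ?_
    ring
  have h5 := (h3.trans_isBigO (h4.isBigO_one ℝ)).tendsto_zero_of_tendsto tendsto_const_nhds
  have h6 : Tendsto (fun n => √(effSize P N ht hz n) *
      taylorQuad f t z ((t - ht n * s.1) - t) ((z - hz n * s.2) - z)) atTop
      (𝓝 (limitQuad f t z ρ τ s)) := by
    have := ((k1.mul_const (s.1 ^ 2 / 2 * pderiv 2 0 f t z)).add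
      (k2.mul_const (s.1 * s.2 * pderiv 1 1 f t z))).add
        (k3.mul_const (s.2 ^ 2 / 2 * pderiv 0 2 f t z))
    have e : limitQuad f t z ρ τ s = τ * √ρ * (s.1 ^ 2 / 2 * pderiv 2 0 f t z) +
        τ * √ρ * ρ * (s.1 * s.2 * pderiv 1 1 f t z) +
        τ * √ρ * ρ ^ 2 * (s.2 ^ 2 / 2 * pderiv 0 2 f t z) := by
      rw [limitQuad, taylorQuad]
      ring
    rw [e]
    refine this.congr fun n => ?_
    rw [taylorQuad]
    ring
  have h7 := h5.add h6
  rw [zero_add] at h7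
  refine h7.congr fun n => ?_
  simp only [Function.comp]
  ring

/-- The remainder is of order `h_t² + h_z²` on the window, which balances the weaker normalization
`1 / √q`: the mean has a finite limit, while the variance is of order `(h_t² + h_z²)²`. -/
theorem SamplingModel.tendstoInMeasure_bias (h : SamplingModel P T Y Z N f₃ f₅)
    (hN : CountMoments P N) (hl : LocalFacts f₃ f₅ t z C U) (hreg : Regularity f₃ f₅ t z)
    (hρ : 0 < ρ) (hτ : 0 < τ) (hb : BandwidthConditions P N ht hz ρ τ) (hL : Window L R) :
    TendstoInMeasure P (fun n ω => (√(effSize P N ht hz n))⁻¹ *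
      totalSum T Y Z N (fun s w _ => scaled L t z (ht n) (hz n) s w *
        linRemainder (condMean f₃) t z s w) n ω) atTop
      fun _ => ∫ s : ℝ × ℝ, L s.1 s.2 *
        (limitQuad (condMean f₃) t z ρ τ s * designDensity f₃ t z) := by
  have hq := hb.effSize_tendsto hρ
  have hC := hl.nonneg
  have hR := hL.radius_nonneg
  have hUev : ∀ᶠ n in atTop, ∀ s w, |s - t| ≤ R * ht n → |w - z| ≤ R * hz n → (s, w) ∈ U := by
    filter_upwards [eventually_rescale_mem hb.ht_tendsto hb.hz_tendsto R hl.mem_nhds] with n hn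
    rwa [abs_of_pos (hb.ht_pos n), abs_of_pos (hb.hz_pos n)] at hn
  have hrem : ∀ᶠ n in atTop, ∀ s w, |s - t| ≤ R * ht n → |w - z| ≤ R * hz n →
      |linRemainder (condMean f₃) t z s w| ≤ C * R ^ 2 * (ht n ^ 2 + hz n ^ 2) := by
    filter_upwards [hUev] with n hn s w hs hw
    refine (hl.remainder_le _ (hn s w hs hw)).trans ?_
    have h1 : (s - t) ^ 2 ≤ (R * ht n) ^ 2 := sq_le_sq' (by linarith [abs_le.1 hs]) (abs_le.1 hs).2
    have h2 : (w - z) ^ 2 ≤ (R * hz n) ^ 2 := sq_le_sq' (by linarith [abs_le.1 hw]) (abs_le.1 hw).2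
    calc _ ≤ C * ((R * ht n) ^ 2 + (R * hz n) ^ 2) :=
          mul_le_mul_of_nonneg_left (add_le_add h1 h2) hC
      _ = _ := by ring
  have hpt : ∀ n (s : ℝ × ℝ), L s.1 s.2 ≠ 0 →
      |(t - ht n * s.1) - t| ≤ R * ht n ∧ |(z - hz n * s.2) - z| ≤ R * hz n := by
    intro n s hs
    have := (hL.support _ _ hs)
    have h1 := hb.ht_pos n
    have h2 := hb.hz_pos n
    constructor
    · rw [sub_sub_cancel_left, abs_neg, abs_mul, abs_of_pos h1, mul_comm]
      exact mul_le_mul_of_nonneg_right this.1 h1.le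
    · rw [sub_sub_cancel_left, abs_neg, abs_mul, abs_of_pos h2, mul_comm]
      exact mul_le_mul_of_nonneg_right this.2 h2.le
  -- With `c = 1 / √q`, the variance condition `c² q B² → 0` reduces to `B → 0`.
  refine h.tendstoInMeasure_design hN hl hb hL (κ := fun _ => linRemainder (condMean f₃) t z)
    (B := fun n => C * R ^ 2 * (ht n ^ 2 + hz n ^ 2))
    (c := fun n => (√(effSize P N ht hz n))⁻¹) (fun _ => h.measurable_linRemainder t z) hrem ?_ ?_
  · have k1 := hb.sqrt_effSize_mul_tendsto hτ
    have k3 := hb.sqrt_effSize_mul_sq_tendsto hτ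
    have k4 := (k1.add k3).const_mul (C * R ^ 2)
    have hresc : ∀ n, Measurable fun s : ℝ × ℝ => (t - ht n * s.1, z - hz n * s.2) :=
      fun n => by fun_prop
    have := tendsto_integral_window_mul hL.integrable
      (G := fun n s => √(effSize P N ht hz n) *
        (linRemainder (condMean f₃) t z (t - ht n * s.1) (z - hz n * s.2) *
          designDensity f₃ (t - ht n * s.1) (z - hz n * s.2)))
      (G₀ := fun s => limitQuad (condMean f₃) t z ρ τ s * designDensity f₃ t z)
      (C := (C * R ^ 2 * (τ * √ρ + τ * √ρ * ρ ^ 2) + 1) * C)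
      (fun n => (((h.measurable_linRemainder t z).comp (hresc n)).mul
        (h.measurable_designDensity.comp (hresc n))).const_mul _) ?_ ?_
    · refine this.congr' ?_
      filter_upwards [hq.eventually_gt_atTop 0] with n hn
      have e : (√(effSize P N ht hz n))⁻¹ * effSize P N ht hz n = √(effSize P N ht hz n) := by
        have h0 := (Real.sqrt_pos.2 hn).ne'
        rw [inv_mul_eq_iff_eq_mul₀ h0, Real.mul_self_sqrt hn.le]
      rw [e, ← integral_const_mul]
      refine integral_congr_ae (ae_of_all _ fun s => ?_)
      simp only
      ring
    · filter_upwards [hrem, hUev, k4.eventually_lt_const (lt_add_one _)] with n h1 h2 h3 s hs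
      obtain ⟨p1, p2⟩ := hpt n s hs
      rw [← mul_assoc, abs_mul]
      have hd : |designDensity f₃ (t - ht n * s.1) (z - hz n * s.2)| ≤ C := by
        have h0 : 0 ≤ designDensity f₃ (t - ht n * s.1) (z - hz n * s.2) :=
          integral_nonneg fun y => h.f₃_nonneg _ _ _
        rw [abs_of_nonneg h0]
        exact hl.design_le _ (h2 _ _ p1 p2)
      refine mul_le_mul ?_ hd (abs_nonneg _) ((by positivity : (0 : ℝ) ≤ _).trans h3.le)
      rw [abs_mul, abs_of_nonneg (Real.sqrt_nonneg _)]
      refine (mul_le_mul_of_nonneg_left (h1 _ _ p1 p2) (Real.sqrt_nonneg _)).trans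
        (le_trans (le_of_eq ?_) h3.le)
      ring
    · intro s _
      refine ((hb.tendsto_sqrt_effSize_mul_remainder hτ hreg.mean_smooth s).mul
        (hreg.f₂_smooth.continuousAt.tendsto.comp
          (tendsto_rescale hb.ht_tendsto hb.hz_tendsto s))).congr fun n => ?_
      simp only [Function.comp]
      ring
  · have hB : Tendsto (fun n => (C * R ^ 2 * (ht n ^ 2 + hz n ^ 2)) ^ 2) atTop (𝓝 0) := by
      have := (((hb.ht_tendsto.pow 2).add (hb.hz_tendsto.pow 2)).const_mul (C * R ^ 2)).pow 2
      simpa using this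
    refine hB.congr' ?_
    filter_upwards [hq.eventually_gt_atTop 0] with n hn
    rw [inv_pow, Real.sq_sqrt hn.le, inv_mul_cancel₀ hn.ne', one_mul]

end bias


/-! ### Uniform integrability of the kernel weighted residuals -/

section noise

set_option linter.unusedSectionVars false

variable {Ω : Type*} [MeasurableSpace Ω] {P : Measure Ω} [IsProbabilityMeasure P]
  {T Y : ℕ → ℕ → Ω → ℝ} {Z : ℕ → Ω → ℝ}
  {N : ℕ → ℕ → Ω → ℕ} {f₃ : ℝ → ℝ → ℝ → ℝ} {f₅ : ℝ → ℝ → ℝ → ℝ → ℝ → ℝ} {t z C R ρ τ : ℝ}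
  {U : Set (ℝ × ℝ)} {L : ℝ → ℝ → ℝ} {ht hz : ℕ → ℝ}

/-- The residual of a measurement, weighted by a window of bandwidths `(a, b)` at `(t, z)`. -/
noncomputable def noise (f₃ : ℝ → ℝ → ℝ → ℝ) (L : ℝ → ℝ → ℝ) (t z a b s w y : ℝ) : ℝ :=
  scaled L t z a b s w * residual f₃ s w y

lemma Regularity.tendsto_density (hreg : Regularity f₃ f₅ t z) {p : ℕ → ℝ × ℝ}
    (hp : Tendsto p atTop (𝓝 (t, z))) (y : ℝ) :
    Tendsto (fun n => f₃ (p n).1 (p n).2 y) atTop (𝓝 (f₃ t z y)) := by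
  rw [Metric.tendsto_nhds]
  intro ε hε
  filter_upwards [hp.eventually (hreg.f₃_cont ε hε)] with n hn
  exact hn y

lemma Regularity.tendsto_residual (hreg : Regularity f₃ f₅ t z) {p : ℕ → ℝ × ℝ}
    (hp : Tendsto p atTop (𝓝 (t, z))) (y : ℝ) :
    Tendsto (fun n => residual f₃ (p n).1 (p n).2 y) atTop (𝓝 (residual f₃ t z y)) :=
  (hreg.mean_smooth.continuousAt.tendsto.comp hp).const_sub y

lemma Window.eventually_scaled_mem (hL : Window L R) (hb : BandwidthConditions P N ht hz ρ τ)
    (hU : U ∈ 𝓝 (t, z)) :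
    ∀ᶠ n in atTop, ∀ s w, scaled L t z (ht n) (hz n) s w ≠ 0 → (s, w) ∈ U := by
  filter_upwards [eventually_rescale_mem hb.ht_tendsto hb.hz_tendsto R hU] with n hn s w hs
  rw [abs_of_pos (hb.ht_pos n), abs_of_pos (hb.hz_pos n)] at hn
  have := hL.scaled_support (hb.ht_pos n) (hb.hz_pos n) hs
  exact hn s w this.1 this.2

lemma SamplingModel.measurable_noise (h : SamplingModel P T Y Z N f₃ f₅) (hL : Window L R)
    (t z a b : ℝ) : Measurable fun p : ℝ × ℝ × ℝ => noise f₃ L t z a b p.1 p.2.1 p.2.2 :=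
  measurable_localized hL.measurable_scaled h.measurable_residual

lemma SamplingModel.tendsto_integral_residualMoment (h : SamplingModel P T Y Z N f₃ f₅)
    (hreg : Regularity f₃ f₅ t z) (hb : BandwidthConditions P N ht hz ρ τ) (hL : Window L R) :
    Tendsto (fun n => ∫ s : ℝ × ℝ, L s.1 s.2 ^ 2 *
      residualMoment f₃ (t - ht n * s.1) (z - hz n * s.2)) atTop
      (𝓝 ((∫ s : ℝ × ℝ, L s.1 s.2 ^ 2) * residualMoment f₃ t z)) :=
  tendsto_integral_window_mul_of_continuousAt hL.integrable_sq
    (fun s hs => hL.support _ _ fun h0 => hs (by simp [h0])) hb.ht_tendsto hb.hz_tendsto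
    h.measurable_residualMoment hreg.continuousAt_residualMoment

/-- Uniform integrability of the squared noise. -/
theorem SamplingModel.exists_noise_tail_le (h : SamplingModel P T Y Z N f₃ f₅)
    (hl : LocalFacts f₃ f₅ t z C U) (hreg : Regularity f₃ f₅ t z)
    (hb : BandwidthConditions P N ht hz ρ τ) (hL : Window L R) {η : ℝ} (hη : 0 < η) :
    ∃ M : ℝ, ∀ᶠ n in atTop, singleMean P T Y Z (fun s w y =>
      noise f₃ L t z (ht n) (hz n) s w y ^ 2 *
        (if M < |noise f₃ L t z (ht n) (hz n) s w y| then 1 else 0)) ≤ ht n * hz n * η := by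
  set r : ℕ → ℝ × ℝ → ℝ × ℝ := fun n s => (t - ht n * s.1, z - hz n * s.2) with hr
  -- `F n` is the squared noise times the density in rescaled coordinates; `F₀` is its pointwise
  -- limit.
  set F : ℕ → (ℝ × ℝ) × ℝ → ℝ := fun n q =>
    (L q.1.1 q.1.2 * residual f₃ (r n q.1).1 (r n q.1).2 q.2) ^ 2 *
      f₃ (r n q.1).1 (r n q.1).2 q.2 with hF
  set F₀ : (ℝ × ℝ) × ℝ → ℝ := fun q =>
    L q.1.1 q.1.2 ^ 2 * (residual f₃ t z q.2 ^ 2 * f₃ t z q.2) with hF₀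
  have hUev := hL.eventually_scaled_mem hb hl.mem_nhds
  have hresc : ∀ n s w y, noise f₃ L t z (ht n) (hz n) (t - ht n * s) (z - hz n * w) y =
      L s w * residual f₃ (t - ht n * s) (z - hz n * w) y := fun n s w y => by
    rw [noise, scaled_rescale (hb.ht_pos n) (hb.hz_pos n)]
  have hFi : ∀ᶠ n in atTop, Integrable (F n) := by
    filter_upwards [hUev] with n hn
    have h1 := h.integrable_noise_sq hl hL.measurable_scaled hn
      (hL.integrable_scaled_sq (hb.ht_pos n) (hb.hz_pos n))
    have h2 := (integrable_rescale_prod t z (hb.ht_pos n) (hb.hz_pos n)).2 h1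
    refine h2.congr (ae_of_all _ fun q => ?_)
    simp only [hF, hr, scaled_rescale (hb.ht_pos n) (hb.hz_pos n)]
  have hFint : ∀ᶠ n in atTop, ∫ q, F n q = ∫ s : ℝ × ℝ, L s.1 s.2 ^ 2 *
      residualMoment f₃ (t - ht n * s.1) (z - hz n * s.2) := by
    filter_upwards [hFi] with n hn
    rw [Measure.volume_eq_prod, integral_prod _ hn]
    refine integral_congr_ae (ae_of_all _ fun s => ?_)
    simp only [hF, residualMoment, ← integral_const_mul, hr]
    refine integral_congr_ae (ae_of_all _ fun y => ?_)
    simp only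
    ring
  have hF₀i : Integrable F₀ := hL.integrable_sq.mul_prod
    (hl.residual_integrable (t, z) (mem_of_mem_nhds hl.mem_nhds))
  have hF₀int : ∫ q, F₀ q = (∫ s : ℝ × ℝ, L s.1 s.2 ^ 2) * residualMoment f₃ t z := by
    rw [Measure.volume_eq_prod]
    exact integral_prod_mul (fun s : ℝ × ℝ => L s.1 s.2 ^ 2)
      fun y => residual f₃ t z y ^ 2 * f₃ t z y
  have hF₀nn : ∀ q, 0 ≤ F₀ q := fun q => by
    have := h.f₃_nonneg t z q.2
    positivity
  have hFnn : ∀ n q, 0 ≤ F n q := fun n q => mul_nonneg (sq_nonneg _) (h.f₃_nonneg _ _ _)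
  -- Scheffé applies: the densities converge pointwise, and the total masses converge by continuity
  -- of the residual moment. No moment of order above two is used.
  have hS := tendsto_integral_abs_sub_of_tendsto_integral hFi hF₀i hFnn hF₀nn (fun q => by
    have hp := tendsto_rescale (t := t) (z := z) hb.ht_tendsto hb.hz_tendsto q.1
    refine ((((hreg.tendsto_residual hp q.2).const_mul (L q.1.1 q.1.2)).pow 2).mul
      (hreg.tendsto_density hp q.2)).trans_eq ?_
    rw [hF₀]
    ring_nf) (by
    rw [hF₀int]
    exact (h.tendsto_integral_residualMoment hreg hb hL).congr' (by
      filter_upwards [hFint] with n hn using hn.symm))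
  have hLm : Measurable fun q : (ℝ × ℝ) × ℝ => |L q.1.1 q.1.2| * (|q.2| + C) :=
    (hL.measurable.comp measurable_fst).abs.mul (measurable_snd.abs.add_const C)
  -- The threshold is compared with a majorant of the rescaled noise that does not depend on `n`, so
  -- `M` can be chosen from the single integrable function `F₀`.
  have htail : Tendsto (fun M : ℝ => ∫ q : (ℝ × ℝ) × ℝ,
      F₀ q * (if M < |L q.1.1 q.1.2| * (|q.2| + C) then 1 else 0)) atTop (𝓝 0) := by
    rw [show 𝓝 (0 : ℝ) = 𝓝 (∫ _ : (ℝ × ℝ) × ℝ, (0 : ℝ)) by simp]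
    refine tendsto_integral_filter_of_dominated_convergence F₀ (Eventually.of_forall fun M => ?_)
      (Eventually.of_forall fun M => ae_of_all _ fun q => ?_) hF₀i (ae_of_all _ fun q => ?_)
    · exact hF₀i.aestronglyMeasurable.mul (Measurable.ite (measurableSet_lt measurable_const hLm)
        measurable_const measurable_const).aestronglyMeasurable
    · rw [norm_mul, Real.norm_eq_abs, abs_of_nonneg (hF₀nn q)]
      split_ifs <;> simp [hF₀nn q]
    · refine tendsto_const_nhds.congr' ?_
      filter_upwards [eventually_ge_atTop (|L q.1.1 q.1.2| * (|q.2| + C))] with M hM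
      rw [if_neg hM.not_gt, mul_zero]
  obtain ⟨M, hM⟩ := (htail.eventually_lt_const (half_pos hη)).exists
  refine ⟨M, ?_⟩
  filter_upwards [hUev, hFi, hS.eventually_lt_const (half_pos hη)] with n hn hi hs
  have ha := hb.ht_pos n
  have hb' := hb.hz_pos n
  have hm := h.measurable_noise hL t z (ht n) (hz n)
  have hm2 : Measurable fun p : ℝ × ℝ × ℝ => noise f₃ L t z (ht n) (hz n) p.1 p.2.1 p.2.2 ^ 2 *
      (if M < |noise f₃ L t z (ht n) (hz n) p.1 p.2.1 p.2.2| then (1 : ℝ) else 0) :=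
    (hm.pow_const 2).mul (Measurable.ite (measurableSet_lt measurable_const hm.abs)
      measurable_const measurable_const)
  rw [h.singleMean_eq (g := fun s w y => noise f₃ L t z (ht n) (hz n) s w y ^ 2 *
      (if M < |noise f₃ L t z (ht n) (hz n) s w y| then 1 else 0)) hm2,
    integral_rescale_prod t z ha hb']
  refine mul_le_mul_of_nonneg_left ?_ (mul_pos ha hb').le
  have hi1 : Integrable fun q => |F n q - F₀ q| := (hi.sub hF₀i).abs
  have hi2 : Integrable fun q : (ℝ × ℝ) × ℝ =>
      F₀ q * (if M < |L q.1.1 q.1.2| * (|q.2| + C) then 1 else 0) := by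
    refine hF₀i.mono' (hF₀i.aestronglyMeasurable.mul (Measurable.ite
      (measurableSet_lt measurable_const hLm)
      measurable_const measurable_const).aestronglyMeasurable) (ae_of_all _ fun q => ?_)
    rw [norm_mul, Real.norm_eq_abs, abs_of_nonneg (hF₀nn q)]
    split_ifs <;> simp [hF₀nn q]
  -- The truncated `F n` is at most `|F n - F₀|` plus the truncated `F₀`, and each has integral
  -- below `η / 2`.
  refine le_trans (integral_mono_of_nonneg (ae_of_all _ fun q => ?_) (hi1.add hi2)
    (ae_of_all _ fun q => ?_)) ((integral_add hi1 hi2).trans_le (by linarith))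
  · refine mul_nonneg (mul_nonneg (sq_nonneg _) ?_) (h.f₃_nonneg _ _ _)
    split_ifs <;> simp
  · simp only [hresc, Pi.add_apply]
    have e : (L q.1.1 q.1.2 * residual f₃ (t - ht n * q.1.1) (z - hz n * q.1.2) q.2) ^ 2 *
        f₃ (t - ht n * q.1.1) (z - hz n * q.1.2) q.2 = F n q := rfl
    rw [mul_right_comm, e]
    by_cases hLq : L q.1.1 q.1.2 = 0
    -- Off the support of `L` both functions vanish, and the bound on `μ` is not available there.
    · simp only [hF, hF₀, hLq]
      simp
    have hmem : (t - ht n * q.1.1, z - hz n * q.1.2) ∈ U :=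
      hn _ _ (by rwa [scaled_rescale ha hb'])
    have hle : |L q.1.1 q.1.2 * residual f₃ (t - ht n * q.1.1) (z - hz n * q.1.2) q.2| ≤
        |L q.1.1 q.1.2| * (|q.2| + C) := by
      rw [abs_mul]
      refine mul_le_mul_of_nonneg_left ?_ (abs_nonneg _)
      exact (abs_sub _ _).trans (add_le_add le_rfl (hl.mean_le _ hmem))
    have h1 := abs_nonneg (F n q - F₀ q)
    have h2 := le_abs_self (F n q - F₀ q)
    have h3 := hF₀nn q
    split_ifs with k1 k2
    · linarith
    · exact absurd (k1.trans_le hle) k2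
    · linarith
    · linarith

end noise


/-! ### Central limit theorem for the kernel weighted residuals -/

section noiseLimit

set_option linter.unusedSectionVars false

variable {Ω : Type*} [MeasurableSpace Ω] {P : Measure Ω} [IsProbabilityMeasure P]
  {T Y : ℕ → ℕ → Ω → ℝ} {Z : ℕ → Ω → ℝ}
  {N : ℕ → ℕ → Ω → ℕ} {f₃ : ℝ → ℝ → ℝ → ℝ} {f₅ : ℝ → ℝ → ℝ → ℝ → ℝ → ℝ} {t z C R ρ τ : ℝ}
  {U : Set (ℝ × ℝ)} {L : ℝ → ℝ → ℝ} {ht hz : ℕ → ℝ}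

/-- The normalized contribution of a subject to the noise. -/
noncomputable def subjectNoise (P : Measure Ω) (T Y : ℕ → ℕ → Ω → ℝ) (Z : ℕ → Ω → ℝ)
    (N : ℕ → ℕ → Ω → ℕ) (f₃ : ℝ → ℝ → ℝ → ℝ) (L : ℝ → ℝ → ℝ) (t z : ℝ) (ht hz : ℕ → ℝ)
    (n i : ℕ) (ω : Ω) : ℝ :=
  (√(effSize P N ht hz n))⁻¹ * subjectSum T Y Z N (noise f₃ L t z (ht n) (hz n)) n i ω

lemma SamplingModel.eventually_memLp_noise (h : SamplingModel P T Y Z N f₃ f₅)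
    (hl : LocalFacts f₃ f₅ t z C U) (hb : BandwidthConditions P N ht hz ρ τ) (hL : Window L R) :
    ∀ᶠ n in atTop, MemLp (fun ω => noise f₃ L t z (ht n) (hz n) (T 0 0 ω) (Z 0 ω) (Y 0 0 ω)) 2 P := by
  filter_upwards [hL.eventually_scaled_mem hb hl.mem_nhds] with n hn
  exact h.memLp_noise hl hL.measurable_scaled hn
    (hL.integrable_scaled_sq (hb.ht_pos n) (hb.hz_pos n))

lemma SamplingModel.eventually_memLp_subjectNoise (h : SamplingModel P T Y Z N f₃ f₅)
    (hN : CountMoments P N)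
    (hl : LocalFacts f₃ f₅ t z C U) (hb : BandwidthConditions P N ht hz ρ τ) (hL : Window L R) :
    ∀ᶠ n in atTop, ∀ i, MemLp (subjectNoise P T Y Z N f₃ L t z ht hz n i) 2 P := by
  filter_upwards [h.eventually_memLp_noise hl hb hL] with n hn i
  exact (h.memLp_subjectSum hN (h.measurable_noise hL t z _ _) hn n i).const_mul _

lemma SamplingModel.eventually_integral_subjectNoise (h : SamplingModel P T Y Z N f₃ f₅)
    (hN : CountMoments P N)
    (hl : LocalFacts f₃ f₅ t z C U) (hb : BandwidthConditions P N ht hz ρ τ) (hL : Window L R) :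
    ∀ᶠ n in atTop, ∀ i, ∫ ω, subjectNoise P T Y Z N f₃ L t z ht hz n i ω ∂P = 0 := by
  filter_upwards [h.eventually_memLp_noise hl hb hL,
    hL.eventually_scaled_mem hb hl.mem_nhds] with n hn hU i
  have h1 : singleMean P T Y Z (noise f₃ L t z (ht n) (hz n)) = 0 :=
    h.singleMean_noise hl hL.measurable_scaled hU
      (hL.integrable_scaled_sq (hb.ht_pos n) (hb.hz_pos n))
  unfold subjectNoise
  rw [integral_const_mul, h.integral_subjectSum hN (h.measurable_noise hL t z _ _) hn n i, h1]
  simp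

lemma SamplingModel.iIndepFun_subjectNoise (h : SamplingModel P T Y Z N f₃ f₅) (hL : Window L R)
    (n : ℕ) : iIndepFun (subjectNoise P T Y Z N f₃ L t z ht hz n) P :=
  (h.iIndepFun_subjectSum (h.measurable_noise hL t z (ht n) (hz n)) n).comp
    (fun _ x => (√(effSize P N ht hz n))⁻¹ * x) fun _ => measurable_const_mul _

lemma SamplingModel.measurable_subjectNoise (h : SamplingModel P T Y Z N f₃ f₅) (hL : Window L R)
    (n i : ℕ) : Measurable (subjectNoise P T Y Z N f₃ L t z ht hz n i) :=
  (h.measurable_subjectSum (h.measurable_noise hL t z (ht n) (hz n)) n i).const_mul _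

/-- The normalization by `q` cancels `n`, one factor `E N` and the area `h_t h_z` of the window,
leaving one bandwidth `h_t` from the pair bound. -/
lemma abs_pair_contribution_le (h : SamplingModel P T Y Z N f₃ f₅) (hN : CountMoments P N)
    (hb : BandwidthConditions P N ht hz ρ τ) {n : ℕ} (hn : 0 < n) {Q I : ℝ}
    (hQ : |Q| ≤ C * (2 * (R * ht n) * (ht n * hz n * I))) :
    |(effSize P N ht hz n)⁻¹ * (n * ((momentN P N 2 n - momentN P N 1 n) * Q))| ≤
      momentN P N 2 n / momentN P N 1 n * ht n * (C * (2 * R * I)) := by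
  have ha := hb.ht_pos n
  have hb' := hb.hz_pos n
  have h4 := h.one_le_momentN hN n
  have h5 := h.momentN_one_le_two hN n
  have hn' : (0 : ℝ) < n := by exact_mod_cast hn
  have hq := effSize_pos h hN hb hn
  rw [abs_mul, abs_mul, abs_mul, abs_of_pos (inv_pos.2 hq), abs_of_pos hn',
    abs_of_nonneg (sub_nonneg.2 h5)]
  have h6 : momentN P N 2 n - momentN P N 1 n ≤ momentN P N 2 n := by linarith
  have h7 := (abs_nonneg Q).trans hQ
  calc _ ≤ (effSize P N ht hz n)⁻¹ * (n * (momentN P N 2 n *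
        (C * (2 * (R * ht n) * (ht n * hz n * I))))) := by
        gcongr
        exact (sub_nonneg.2 h5).trans h6
    _ = _ := by
        rw [effSize]
        have : momentN P N 1 n ≠ 0 := by linarith
        field_simp

/-- The correlation of measurements on one subject is asymptotically negligible. -/
lemma SamplingModel.eventually_pair_noise_le (h : SamplingModel P T Y Z N f₃ f₅)
    (hN : CountMoments P N)
    (hl : LocalFacts f₃ f₅ t z C U) (hb : BandwidthConditions P N ht hz ρ τ) (hL : Window L R) :
    ∀ᶠ n in atTop, |(effSize P N ht hz n)⁻¹ * (n * ((momentN P N 2 n - momentN P N 1 n) *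
      pairMean P T Y Z (noise f₃ L t z (ht n) (hz n))))| ≤
      momentN P N 2 n / momentN P N 1 n * ht n * (C * (2 * R * ∫ s : ℝ × ℝ, L s.1 s.2 ^ 2)) := by
  filter_upwards [hL.eventually_scaled_mem hb hl.mem_nhds, eventually_gt_atTop 0] with n hU hn
  have ha := hb.ht_pos n
  have hb' := hb.hz_pos n
  have h1 : |pairMean P T Y Z (noise f₃ L t z (ht n) (hz n))| ≤ _ :=
    h.abs_pairMean_noise_le hl hL.measurable_scaled hU (hL.integrable_scaled_sq ha hb')
      (mul_nonneg hL.radius_nonneg ha.le) fun s w hs => (hL.scaled_support ha hb' hs).1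
  rw [integral_scaled_sq ha hb'] at h1
  exact abs_pair_contribution_le h hN hb hn h1

/-- The event of nonzero noise involves the response, so it is enlarged to the event that the design
point lies in the box. This depends on the design only and is covered by the bound on the pair
density. -/
lemma SamplingModel.abs_pairMean_indicator_le (h : SamplingModel P T Y Z N f₃ f₅)
    (hL : Window L R) (a b : ℝ) :
    |pairMean P T Y Z (fun s w y => if noise f₃ L t z a b s w y ≠ 0 then 1 else 0)| ≤
      |pairMean P T Y Z (fun s w _ =>
        scaled (fun s w => if |s| ≤ R ∧ |w| ≤ R then 1 else 0) t z a b s w)| := by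
  have hB := Window.box hL.radius_nonneg
  set B : ℝ → ℝ → ℝ := fun s w => if |s| ≤ R ∧ |w| ≤ R then 1 else 0 with hBdef
  have h0 : ∀ s w, 0 ≤ scaled B t z a b s w := fun s w => by
    simp only [scaled, hBdef]
    split_ifs <;> simp
  have h1 : ∀ s w, scaled B t z a b s w ≤ 1 := fun s w => by
    simp only [scaled, hBdef]
    split_ifs <;> simp
  have h2 : ∀ s w y, (if noise f₃ L t z a b s w y ≠ 0 then (1 : ℝ) else 0) ≤
      scaled B t z a b s w := fun s w y => by
    split_ifs with hs
    · have := hL.support _ _ (left_ne_zero_of_mul hs)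
      simp only [scaled, hBdef, if_pos this, le_refl]
    · exact h0 s w
  have h3 : ∀ s w y, 0 ≤ (if noise f₃ L t z a b s w y ≠ 0 then (1 : ℝ) else 0) := fun s w y => by
    split_ifs <;> simp
  have hm : ∀ j, Measurable fun ω => scaled B t z a b (T 0 j ω) (Z 0 ω) := fun j =>
    hB.measurable_scaled.comp ((h.measurable_T 0 j).prodMk (h.measurable_Z 0))
  unfold pairMean
  rw [abs_of_nonneg (integral_nonneg fun ω => mul_nonneg (h3 _ _ _) (h3 _ _ _)),
    abs_of_nonneg (integral_nonneg fun ω => mul_nonneg (h0 _ _) (h0 _ _))]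
  refine integral_mono_of_nonneg (ae_of_all _ fun ω => mul_nonneg (h3 _ _ _) (h3 _ _ _)) ?_
    (ae_of_all _ fun ω => mul_le_mul (h2 _ _ _) (h2 _ _ _) (h3 _ _ _) (h0 _ _))
  refine Integrable.of_bound ((hm 0).mul (hm 1)).aestronglyMeasurable 1 (ae_of_all _ fun ω => ?_)
  rw [Real.norm_eq_abs, abs_of_nonneg (mul_nonneg (h0 _ _) (h0 _ _))]
  exact mul_le_one₀ (h1 _ _) (h0 _ _) (h1 _ _)

lemma SamplingModel.eventually_pair_indicator_le (h : SamplingModel P T Y Z N f₃ f₅)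
    (hN : CountMoments P N)
    (hl : LocalFacts f₃ f₅ t z C U) (hb : BandwidthConditions P N ht hz ρ τ) (hL : Window L R) :
    ∃ B : ℝ, ∀ᶠ n in atTop, |(effSize P N ht hz n)⁻¹ * (n * ((momentN P N 2 n - momentN P N 1 n) *
      pairMean P T Y Z (fun s w y => if noise f₃ L t z (ht n) (hz n) s w y ≠ 0 then 1 else 0)))| ≤
      momentN P N 2 n / momentN P N 1 n * ht n * B := by
  have hB := Window.box hL.radius_nonneg
  refine ⟨C * (2 * R * ∫ s : ℝ × ℝ, (if |s.1| ≤ R ∧ |s.2| ≤ R then (1 : ℝ) else 0) ^ 2), ?_⟩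
  filter_upwards [hB.eventually_scaled_mem hb hl.mem_nhds, eventually_gt_atTop 0] with n hU hn
  have ha := hb.ht_pos n
  have hb' := hb.hz_pos n
  have h1 := h.abs_pairMean_design_le hl hB.measurable_scaled hU (hB.integrable_scaled_sq ha hb')
    (mul_nonneg hB.radius_nonneg ha.le) fun s w hs => (hB.scaled_support ha hb' hs).1
  rw [integral_scaled_sq ha hb'] at h1
  exact abs_pair_contribution_le h hN hb hn ((h.abs_pairMean_indicator_le hL (ht n) (hz n)).trans h1)

lemma SamplingModel.tendsto_noise_variance (h : SamplingModel P T Y Z N f₃ f₅)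
    (hN : CountMoments P N) (hl : LocalFacts f₃ f₅ t z C U) (hreg : Regularity f₃ f₅ t z)
    (hb : BandwidthConditions P N ht hz ρ τ) (hL : Window L R) :
    Tendsto (fun n => ∑ i ∈ Finset.range n,
      ∫ ω, subjectNoise P T Y Z N f₃ L t z ht hz n i ω ^ 2 ∂P) atTop
      (𝓝 ((∫ s : ℝ × ℝ, L s.1 s.2 ^ 2) * residualMoment f₃ t z)) := by
  have h1 := h.tendsto_integral_residualMoment hreg hb hL
  have h2 : Tendsto (fun n : ℕ => (effSize P N ht hz n)⁻¹ *
      (n * ((momentN P N 2 n - momentN P N 1 n) *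
        pairMean P T Y Z (noise f₃ L t z (ht n) (hz n))))) atTop (𝓝 0) := by
    refine squeeze_zero_norm' (h.eventually_pair_noise_le hN hl hb hL) ?_
    simpa using (hb.count_ratio_mul_tendsto hN h).mul_const
      (C * (2 * R * ∫ s : ℝ × ℝ, L s.1 s.2 ^ 2))
  have h3 := h1.add h2
  rw [add_zero] at h3
  refine h3.congr' ?_
  filter_upwards [h.eventually_memLp_noise hl hb hL, hL.eventually_scaled_mem hb hl.mem_nhds,
    eventually_gt_atTop 0] with n hn hU hn0
  have ha := hb.ht_pos n
  have hb' := hb.hz_pos n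
  have hq := effSize_pos h hN hb hn0
  have hs : singleMean P T Y Z (fun s w y => noise f₃ L t z (ht n) (hz n) s w y ^ 2) = _ :=
    h.singleMean_noise_sq hl hL.measurable_scaled hU (hL.integrable_scaled_sq ha hb')
  rw [integral_scaled_sq_mul ha hb'] at hs
  unfold subjectNoise
  simp_rw [mul_pow, integral_const_mul,
    h.integral_subjectSum_sq hN (h.measurable_noise hL t z _ _) hn, hs, inv_pow, Real.sq_sqrt hq.le]
  rw [Finset.sum_const, Finset.card_range, nsmul_eq_mul]
  have h4 := h.one_le_momentN hN n
  have hn' : (0 : ℝ) < n := by exact_mod_cast hn0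
  have : momentN P N 1 n ≠ 0 := by linarith
  rw [effSize]
  field_simp

lemma SamplingModel.tendsto_noise_lindeberg (h : SamplingModel P T Y Z N f₃ f₅)
    (hN : CountMoments P N) (hl : LocalFacts f₃ f₅ t z C U) (hreg : Regularity f₃ f₅ t z)
    (hρ : 0 < ρ) (hb : BandwidthConditions P N ht hz ρ τ) (hL : Window L R) {ε : ℝ} (hε : 0 < ε) :
    Tendsto (fun n => ∑ i ∈ Finset.range n, ∫ ω, subjectNoise P T Y Z N f₃ L t z ht hz n i ω ^ 2 *
      (if ε < |subjectNoise P T Y Z N f₃ L t z ht hz n i ω| then 1 else 0) ∂P) atTop (𝓝 0) := by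
  have hnn : ∀ n, 0 ≤ ∑ i ∈ Finset.range n, ∫ ω, subjectNoise P T Y Z N f₃ L t z ht hz n i ω ^ 2 *
      (if ε < |subjectNoise P T Y Z N f₃ L t z ht hz n i ω| then 1 else 0) ∂P := fun n =>
    Finset.sum_nonneg fun i _ => integral_nonneg fun ω => by
      simp only [Pi.zero_apply]
      split_ifs <;> positivity
  rw [Metric.tendsto_nhds]
  intro η hη
  -- `M` is fixed before `n` grows: the single terms then use up `η / 2`, while the pair terms carry
  -- the fixed factor `M ^ 2` and still vanish.
  obtain ⟨M, hM⟩ := h.exists_noise_tail_le hl hreg hb hL (half_pos hη)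
  obtain ⟨B, hB⟩ := h.eventually_pair_indicator_le hN hl hb hL
  have hq := hb.effSize_tendsto hρ
  have hlim : Tendsto (fun n => η / 2 + (M ^ 2 * (momentN P N 2 n / momentN P N 1 n * ht n * B) +
      momentN P N 2 n / momentN P N 1 n * ht n *
        (C * (2 * R * ∫ s : ℝ × ℝ, L s.1 s.2 ^ 2)))) atTop (𝓝 (η / 2)) := by
    have k := hb.count_ratio_mul_tendsto hN h
    simpa using (((k.mul_const B).const_mul (M ^ 2)).add (k.mul_const
      (C * (2 * R * ∫ s : ℝ × ℝ, L s.1 s.2 ^ 2)))).const_add (η / 2)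
  -- The truncation level for the unnormalized subject sum is `ε √q`, which eventually exceeds the
  -- fixed `M`.
  have hMq : ∀ᶠ n in atTop, M ≤ ε * √(effSize P N ht hz n) :=
    ((Real.tendsto_sqrt_atTop.comp hq).const_mul_atTop hε).eventually_ge_atTop M
  filter_upwards [hM, hB, h.eventually_pair_noise_le hN hl hb hL, hMq,
    hlim.eventually_lt_const (half_lt_self hη), h.eventually_memLp_noise hl hb hL,
    eventually_gt_atTop 0] with n k1 k2 k3 k4 k5 k6 k7
  rw [Real.dist_eq, sub_zero, abs_of_nonneg (hnn n)]
  refine lt_of_le_of_lt ?_ k5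
  have hqn := effSize_pos h hN hb k7
  have hsq := Real.sqrt_pos.2 hqn
  set S := subjectSum T Y Z N (noise f₃ L t z (ht n) (hz n)) n with hS
  have e : ∀ i ω, subjectNoise P T Y Z N f₃ L t z ht hz n i ω ^ 2 *
      (if ε < |subjectNoise P T Y Z N f₃ L t z ht hz n i ω| then 1 else 0) =
      (effSize P N ht hz n)⁻¹ * (S i ω ^ 2 *
        (if ε * √(effSize P N ht hz n) < |S i ω| then 1 else 0)) := by
    intro i ω
    have e1 : ε < |subjectNoise P T Y Z N f₃ L t z ht hz n i ω| ↔
        ε * √(effSize P N ht hz n) < |S i ω| := by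
      rw [subjectNoise, abs_mul, abs_of_pos (inv_pos.2 hsq), ← div_eq_inv_mul, lt_div_iff₀ hsq]
    simp only [e1]
    rw [subjectNoise, mul_pow, inv_pow, Real.sq_sqrt hqn.le, mul_assoc]
  simp_rw [e, integral_const_mul]
  rw [← Finset.mul_sum]
  have h1 : ∀ i ∈ Finset.range n, _ := fun i _ =>
    h.integral_subjectSum_sq_tail_le hN (h.measurable_noise hL t z (ht n) (hz n)) k6 n i k4
  have h2 := Finset.sum_le_sum h1
  rw [Finset.sum_const, Finset.card_range, nsmul_eq_mul] at h2
  have h4 := h.one_le_momentN hN n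
  have hn' : (0 : ℝ) < n := by exact_mod_cast k7
  have k2' := mul_le_mul_of_nonneg_left ((le_abs_self _).trans k2) (sq_nonneg M)
  have k3' := (le_abs_self _).trans k3
  have k1' : (effSize P N ht hz n)⁻¹ * (n * (momentN P N 1 n *
      singleMean P T Y Z (fun s w y => noise f₃ L t z (ht n) (hz n) s w y ^ 2 *
        (if M < |noise f₃ L t z (ht n) (hz n) s w y| then 1 else 0)))) ≤ η / 2 := by
    calc _ ≤ (effSize P N ht hz n)⁻¹ * (n * (momentN P N 1 n * (ht n * hz n * (η / 2)))) := by
          gcongr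
      _ = (effSize P N ht hz n)⁻¹ * effSize P N ht hz n * (η / 2) := by rw [effSize]; ring
      _ = _ := by rw [inv_mul_cancel₀ hqn.ne', one_mul]
  refine (mul_le_mul_of_nonneg_left h2 (inv_pos.2 hqn).le).trans
    (le_trans (le_of_eq ?_) (add_le_add k1' (add_le_add k2' k3')))
  ring

/-- The central limit theorem for the kernel weighted residuals. -/
theorem SamplingModel.tendstoInDistribution_noise (h : SamplingModel P T Y Z N f₃ f₅)
    (hN : CountMoments P N) (hl : LocalFacts f₃ f₅ t z C U) (hreg : Regularity f₃ f₅ t z)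
    (hρ : 0 < ρ) (hb : BandwidthConditions P N ht hz ρ τ) (hL : Window L R) :
    TendstoInDistribution (fun n ω => (√(effSize P N ht hz n))⁻¹ *
        totalSum T Y Z N (noise f₃ L t z (ht n) (hz n)) n ω) atTop (id : ℝ → ℝ) (fun _ => P)
      (gaussianReal 0 (((∫ s : ℝ × ℝ, L s.1 s.2 ^ 2) * residualMoment f₃ t z).toNNReal)) := by
  have hv : 0 ≤ (∫ s : ℝ × ℝ, L s.1 s.2 ^ 2) * residualMoment f₃ t z :=
    mul_nonneg (integral_nonneg fun _ => sq_nonneg _)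
      (integral_nonneg fun y => mul_nonneg (sq_nonneg _) (h.f₃_nonneg _ _ _))
  have := tendstoInDistribution_sum_of_lindeberg
    (fun n i => (h.measurable_subjectNoise hL n i).aemeasurable)
    (h.iIndepFun_subjectNoise (t := t) (z := z) (ht := ht) (hz := hz) hL)
    ((h.eventually_memLp_subjectNoise hN hl hb hL).mono fun n hn i _ => hn i)
    ((h.eventually_integral_subjectNoise hN hl hb hL).mono fun n hn i _ => hn i)
    (v := ((∫ s : ℝ × ℝ, L s.1 s.2 ^ 2) * residualMoment f₃ t z).toNNReal)
    (by rw [Real.coe_toNNReal _ hv]; exact h.tendsto_noise_variance hN hl hreg hb hL)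
    fun ε hε => h.tendsto_noise_lindeberg hN hl hreg hρ hb hL hε
  refine this.congr (fun n => ae_of_all _ fun ω => ?_) (ae_of_all _ fun _ => rfl)
  simp only [subjectNoise, totalSum, Finset.mul_sum]

end noiseLimit


section inMeasure

variable {Ω : Type*} [MeasurableSpace Ω] {P : Measure Ω}

/-! ### Calculus of convergence in measure to constants -/

/-- If `A` is a neighbourhood of the limit, then the probability that `X n` is not in `A` tends
to zero. -/
lemma tendsto_measure_notMem {E : Type*} [PseudoMetricSpace E]
    {X : ℕ → Ω → E} {c : E} (hX : TendstoInMeasure P X atTop fun _ => c) {A : Set E}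
    (hA : A ∈ 𝓝 c) : Tendsto (fun n => P {ω | X n ω ∉ A}) atTop (𝓝 0) := by
  obtain ⟨δ, hδ, hball⟩ := Metric.mem_nhds_iff.1 hA
  refine tendsto_of_tendsto_of_tendsto_of_le_of_le tendsto_const_nhds
    (tendstoInMeasure_iff_dist.1 hX δ hδ) (fun _ => zero_le) fun n => measure_mono fun ω hω => ?_
  by_contra h
  exact hω (hball (Metric.mem_ball.2 (not_le.1 h)))

/-- **Continuous mapping theorem** for convergence in measure to a constant. -/
lemma tendstoInMeasure_comp_of_continuousAt {E F : Type*} [PseudoMetricSpace E] [PseudoMetricSpace F]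
    {X : ℕ → Ω → E} {c : E} (hX : TendstoInMeasure P X atTop fun _ => c) {g : E → F}
    (hg : ContinuousAt g c) : TendstoInMeasure P (fun n ω => g (X n ω)) atTop fun _ => g c := by
  rw [tendstoInMeasure_iff_dist]
  intro ε hε
  have hA : {x | dist (g x) (g c) < ε} ∈ 𝓝 c := (Metric.tendsto_nhds.1 hg) ε hε
  refine (tendsto_measure_notMem hX hA).congr fun n => ?_
  simp only [Set.mem_ofPred_eq, not_lt]

lemma tendstoInMeasure_prodMk {E F : Type*} [PseudoMetricSpace E] [PseudoMetricSpace F]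
    {X : ℕ → Ω → E} {X' : ℕ → Ω → F} {c : E} {c' : F}
    (hX : TendstoInMeasure P X atTop fun _ => c) (hX' : TendstoInMeasure P X' atTop fun _ => c') :
    TendstoInMeasure P (fun n ω => (X n ω, X' n ω)) atTop fun _ => (c, c') := by
  rw [tendstoInMeasure_iff_dist] at hX hX' ⊢
  intro ε hε
  have := (hX ε hε).add (hX' ε hε)
  rw [add_zero] at this
  refine tendsto_of_tendsto_of_tendsto_of_le_of_le tendsto_const_nhds this (fun _ => zero_le)
    fun n => (measure_mono fun ω hω => ?_).trans (measure_union_le _ _)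
  simpa [Prod.dist_eq] using hω

/-- Allows an arbitrary value of the estimator on an event of vanishing probability, where a
minimizer need not exist. -/
lemma tendstoInMeasure_zero_of_measure_ne {X X' : ℕ → Ω → ℝ} {A : ℕ → Set Ω}
    (hA : Tendsto (fun n => P (A n)) atTop (𝓝 0))
    (h : ∀ᶠ n in atTop, ∀ᵐ ω ∂P, ω ∉ A n → X n ω = X' n ω) :
    TendstoInMeasure P (X - X') atTop 0 := by
  rw [tendstoInMeasure_iff_norm]
  intro ε hε
  refine tendsto_of_tendsto_of_tendsto_of_le_of_le' tendsto_const_nhds hA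
    (Eventually.of_forall fun _ => zero_le) ?_
  filter_upwards [h] with n hn
  refine measure_mono_ae ?_
  filter_upwards [hn] with ω hω hmem
  by_contra h'
  have h1 : ε ≤ ‖X n ω - X' n ω - 0‖ := hmem
  rw [hω h', sub_self, sub_zero, norm_zero] at h1
  linarith

lemma tendstoInMeasure_mul {X X' : ℕ → Ω → ℝ} {c c' : ℝ}
    (hX : TendstoInMeasure P X atTop fun _ => c) (hX' : TendstoInMeasure P X' atTop fun _ => c') :
    TendstoInMeasure P (fun n ω => X n ω * X' n ω) atTop fun _ => c * c' :=
  tendstoInMeasure_comp_of_continuousAt (X := fun n ω => (X n ω, X' n ω)) (c := (c, c'))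
    (tendstoInMeasure_prodMk hX hX') (g := fun p => p.1 * p.2)
    (continuous_mul.continuousAt)

lemma tendstoInMeasure_add {X X' : ℕ → Ω → ℝ} {c c' : ℝ}
    (hX : TendstoInMeasure P X atTop fun _ => c) (hX' : TendstoInMeasure P X' atTop fun _ => c') :
    TendstoInMeasure P (fun n ω => X n ω + X' n ω) atTop fun _ => c + c' :=
  tendstoInMeasure_comp_of_continuousAt (X := fun n ω => (X n ω, X' n ω)) (c := (c, c'))
    (tendstoInMeasure_prodMk hX hX') (g := fun p => p.1 + p.2)
    (continuous_add.continuousAt)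

variable [IsProbabilityMeasure P] {Ω' : Type*} [MeasurableSpace Ω'] {P' : Measure Ω'}
  [IsProbabilityMeasure P']

lemma tendstoInMeasure_of_tendstoInDistribution_const {X : ℕ → Ω → ℝ} {c : ℝ}
    (hX : TendstoInDistribution X atTop (fun _ : Ω' => c) (fun _ => P) P') :
    TendstoInMeasure P X atTop fun _ => c := by
  rw [tendstoInMeasure_iff_norm]
  intro ε hε
  set F : Set ℝ := {x | ε ≤ ‖x - c‖} with hF
  have hFc : IsClosed F := isClosed_le continuous_const (by fun_prop)
  have hFm : MeasurableSet F := hFc.measurableSet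
  -- The portmanteau theorem needs a null frontier: the closed set `F` contains its frontier but not
  -- `c`.
  have h0 : P'.map (fun _ : Ω' => c) (frontier F) = 0 := by
    rw [Measure.map_const, measure_univ, one_smul]
    rw [Measure.dirac_apply' _ isClosed_frontier.measurableSet, Set.indicator_of_notMem]
    intro hc
    have := hFc.frontier_subset hc
    simp only [hF, Set.mem_ofPred_eq, sub_self, norm_zero] at this
    linarith
  have h1 := ProbabilityMeasure.tendsto_measure_of_null_frontier_of_tendsto' hX.tendsto
    (E := F) h0
  have h2 : P'.map (fun _ : Ω' => c) F = 0 := by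
    rw [Measure.map_const, measure_univ, one_smul, Measure.dirac_apply' _ hFm,
      Set.indicator_of_notMem]
    simp only [hF, Set.mem_ofPred_eq, sub_self, norm_zero, not_le]
    exact hε
  simp only [ProbabilityMeasure.coe_mk, h2] at h1
  refine h1.congr fun n => ?_
  rw [Measure.map_apply_of_aemeasurable (hX.forall_aemeasurable n) hFm]
  rfl

/-- The product of a sequence that tends to zero in measure and one that converges in distribution
tends to zero in measure. -/
lemma tendstoInMeasure_mul_of_tendstoInDistribution {A X : ℕ → Ω → ℝ} {G : Ω' → ℝ}
    (hA : TendstoInMeasure P A atTop fun _ => 0) (hAm : ∀ n, AEMeasurable (A n) P)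
    (hX : TendstoInDistribution X atTop G (fun _ => P) P') :
    TendstoInMeasure P (fun n ω => A n ω * X n ω) atTop fun _ => 0 := by
  have h1 := hX.continuous_comp_prodMk_of_tendstoInMeasure_const
    (g := fun p : ℝ × ℝ => p.2 * p.1) (by fun_prop) hA hAm
  simp only [zero_mul] at h1
  exact tendstoInMeasure_of_tendstoInDistribution_const (P' := P') h1

end inMeasure

/-! ### Law of large numbers for the average count -/

section counts

variable {Ω : Type*} [MeasurableSpace Ω] {P : Measure Ω} [IsProbabilityMeasure P]
  {T Y : ℕ → ℕ → Ω → ℝ} {Z : ℕ → Ω → ℝ}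
  {N : ℕ → ℕ → Ω → ℕ} {f₃ : ℝ → ℝ → ℝ → ℝ} {f₅ : ℝ → ℝ → ℝ → ℝ → ℝ → ℝ}

/-- The law of large numbers for the numbers of measurements. -/
theorem SamplingModel.tendstoInMeasure_averageN (h : SamplingModel P T Y Z N f₃ f₅)
    (hN : CountMoments P N) :
    TendstoInMeasure P (fun n ω => averageN N n ω / momentN P N 1 n) atTop fun _ => 1 := by
  have hg : Measurable fun p : ℝ × ℝ × ℝ => (fun _ _ _ => (1 : ℝ)) p.1 p.2.1 p.2.2 :=
    measurable_const
  have h2 : MemLp (fun ω => (fun _ _ _ => (1 : ℝ)) (T 0 0 ω) (Z 0 ω) (Y 0 0 ω)) 2 P :=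
    memLp_const 1
  -- The counts are the total sum of the constant summand `1`, so the general mean and variance
  -- formulas apply; the variance of the ratio is at most `E N² / (E N)²` divided by `n`.
  have e : ∀ n, (fun ω => averageN N n ω / momentN P N 1 n) = fun ω =>
      (n * momentN P N 1 n)⁻¹ * totalSum T Y Z N (fun _ _ _ => 1) n ω := fun n => by
    ext ω
    simp only [averageN, totalSum, subjectSum, Finset.sum_const, Finset.card_range, nsmul_eq_mul,
      mul_one]
    rw [mul_inv]
    ring
  have hm : ∀ n, 0 < momentN P N 1 n := fun n => one_pos.trans_le (h.one_le_momentN hN n)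
  refine tendstoInMeasure_const_of_variance (Eventually.of_forall fun n => ?_) ?_ ?_
  · rw [e]
    exact (h.memLp_totalSum hN (g := fun _ _ _ => 1) hg h2 n).const_mul _
  · refine tendsto_const_nhds.congr' ?_
    filter_upwards [eventually_gt_atTop 0] with n hn
    have hn' : (0 : ℝ) < n := by exact_mod_cast hn
    have := (hm n).ne'
    rw [e, integral_const_mul, h.integral_totalSum hN (g := fun _ _ _ => 1) hg h2]
    simp only [singleMean, integral_const, probReal_univ, smul_eq_mul, mul_one]
    field_simp
  · obtain ⟨B, hB⟩ := hN.second
    rw [eventually_map] at hB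
    have hlim : Tendsto (fun n : ℕ => B * (n : ℝ)⁻¹) atTop (𝓝 0) := by
      simpa using tendsto_inv_atTop_nhds_zero_nat.const_mul B
    refine squeeze_zero' (Eventually.of_forall fun n => variance_nonneg _ _) ?_ hlim
    filter_upwards [hB, eventually_gt_atTop 0] with n hn h0
    have hn' : (0 : ℝ) < n := by exact_mod_cast h0
    have h3 := h.variance_totalSum_le hN (g := fun _ _ _ => 1) hg h2 n
    simp only [singleMean, pairMean, one_pow, mul_one, integral_const, probReal_univ,
      smul_eq_mul] at h3
    have := hm n
    rw [e, variance_const_mul]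
    calc _ ≤ ((n * momentN P N 1 n)⁻¹) ^ 2 * (n * momentN P N 2 n) := by
          refine mul_le_mul_of_nonneg_left (h3.trans (le_of_eq ?_)) (sq_nonneg _)
          ring
      _ = momentN P N 2 n / momentN P N 1 n ^ 2 * (n : ℝ)⁻¹ := by field_simp
      _ ≤ _ := by gcongr

end counts


/-! ### Weighted least squares in three variables

The entries of the symmetric matrix `!![m₀₀, m₁₀, m₀₁; m₁₀, m₂₀, m₁₁; m₀₁, m₁₁, m₀₂]` are stored as
`(m₀₀, m₁₀, m₀₁, m₂₀, m₁₁, m₀₂)`. -/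

section leastSquares

/-- The entries `m₀₀, m₁₀, m₀₁, m₂₀, m₁₁, m₀₂` of a symmetric matrix. -/
abbrev Gram : Type := ℝ × ℝ × ℝ × ℝ × ℝ × ℝ

/-- The quadratic form of a symmetric matrix. -/
def quadForm : Gram → ℝ → ℝ → ℝ → ℝ
  | (m₀₀, m₁₀, m₀₁, m₂₀, m₁₁, m₀₂), x, y, w =>
    m₀₀ * x ^ 2 + 2 * m₁₀ * (x * y) + 2 * m₀₁ * (x * w) + m₂₀ * y ^ 2 + 2 * m₁₁ * (y * w) +
      m₀₂ * w ^ 2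

/-- The first row of the adjugate matrix. -/
def cofactors : Gram → ℝ × ℝ × ℝ
  | (_, m₁₀, m₀₁, m₂₀, m₁₁, m₀₂) =>
    (m₂₀ * m₀₂ - m₁₁ ^ 2, m₀₁ * m₁₁ - m₁₀ * m₀₂, m₁₀ * m₁₁ - m₀₁ * m₂₀)

def gramMinor (m : Gram) : ℝ := m.1 * m.2.2.2.1 - m.2.1 ^ 2

def gramDet (m : Gram) : ℝ :=
  m.1 * (cofactors m).1 + m.2.1 * (cofactors m).2.1 + m.2.2.1 * (cofactors m).2.2

/-- Positivity of the leading principal minors. -/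
def GramPos (m : Gram) : Prop := 0 < m.1 ∧ 0 < gramMinor m ∧ 0 < gramDet m

lemma eq_zero_of_quadForm_nonpos {m : Gram} (hm : GramPos m) {x y w : ℝ}
    (h : quadForm m x y w ≤ 0) : x = 0 ∧ y = 0 ∧ w = 0 := by
  obtain ⟨m₀₀, m₁₀, m₀₁, m₂₀, m₁₁, m₀₂⟩ := m
  obtain ⟨h1, h2, h3⟩ := hm
  simp only [gramMinor, gramDet, cofactors, quadForm] at h1 h2 h3 h
  set d := m₀₀ * m₂₀ - m₁₀ ^ 2 with hd
  set D := m₀₀ * (m₂₀ * m₀₂ - m₁₁ ^ 2) + m₁₀ * (m₀₁ * m₁₁ - m₁₀ * m₀₂) +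
    m₀₁ * (m₁₀ * m₁₁ - m₀₁ * m₂₀) with hD
  -- Reduction to a sum of squares, multiplied by `m₀₀ * d` to keep the coefficients polynomial; all
  -- three squares have positive coefficients.
  have key : m₀₀ * d * (m₀₀ * x ^ 2 + 2 * m₁₀ * (x * y) + 2 * m₀₁ * (x * w) + m₂₀ * y ^ 2 +
      2 * m₁₁ * (y * w) + m₀₂ * w ^ 2) =
      d * (m₀₀ * x + m₁₀ * y + m₀₁ * w) ^ 2 + (d * y + (m₀₀ * m₁₁ - m₁₀ * m₀₁) * w) ^ 2 +
        m₀₀ * D * w ^ 2 := by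
    rw [hd, hD]
    ring
  have hle := mul_nonpos_of_nonneg_of_nonpos (mul_pos h1 h2).le h
  rw [key] at hle
  have p1 : 0 ≤ d * (m₀₀ * x + m₁₀ * y + m₀₁ * w) ^ 2 := by positivity
  have p2 : 0 ≤ (d * y + (m₀₀ * m₁₁ - m₁₀ * m₀₁) * w) ^ 2 := by positivity
  have p3 : 0 ≤ m₀₀ * D * w ^ 2 := by positivity
  have hw : w = 0 := by
    have : m₀₀ * D * w ^ 2 = 0 := by linarith
    simpa [h1.ne', h3.ne'] using this
  subst hw
  have hy : y = 0 := by
    have : (d * y) ^ 2 = 0 := by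
      have : (d * y + (m₀₀ * m₁₁ - m₁₀ * m₀₁) * 0) ^ 2 = 0 := by linarith
      simpa using this
    simpa [h2.ne'] using this
  subst hy
  have hx : d * (m₀₀ * x + m₁₀ * 0 + m₀₁ * 0) ^ 2 = 0 := by linarith
  simp only [mul_zero, add_zero] at hx
  exact ⟨by simpa [h1.ne', h2.ne'] using hx, rfl, rfl⟩

/-- A positive definite quadratic criterion has a minimizer, whose first component is given by
Cramer's rule. -/
theorem quadratic_minimizer {m : Gram} (hm : GramPos m) {Φ : ℝ × ℝ × ℝ → ℝ}
    {k u₀ u₁ u₂ γ₀ γ₁ γ₂ β₀ β₁ β₂ : ℝ} (h₀ : γ₀ ≠ 0) (h₁ : γ₁ ≠ 0) (h₂ : γ₂ ≠ 0)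
    (hΦ : ∀ b, Φ b = k - 2 * (u₀ * (γ₀ * (b.1 - β₀)) + u₁ * (γ₁ * (b.2.1 - β₁)) +
      u₂ * (γ₂ * (b.2.2 - β₂))) +
      quadForm m (γ₀ * (b.1 - β₀)) (γ₁ * (b.2.1 - β₁)) (γ₂ * (b.2.2 - β₂))) :
    (∃ b, IsMinOn Φ Set.univ b) ∧ ∀ b, IsMinOn Φ Set.univ b →
      γ₀ * (b.1 - β₀) = (cofactors m).1 / gramDet m * u₀ +
        (cofactors m).2.1 / gramDet m * u₁ + (cofactors m).2.2 / gramDet m * u₂ := by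
  have hD := hm.2.2.ne'
  set x := (cofactors m).1 / gramDet m * u₀ + (cofactors m).2.1 / gramDet m * u₁ +
    (cofactors m).2.2 / gramDet m * u₂ with hx
  -- The solution of the normal equations by the adjugate matrix. Only its first coordinate is
  -- needed by name.
  obtain ⟨y, w, e₀, e₁, e₂⟩ : ∃ y w, m.1 * x + m.2.1 * y + m.2.2.1 * w = u₀ ∧
      m.2.1 * x + m.2.2.2.1 * y + m.2.2.2.2.1 * w = u₁ ∧
      m.2.2.1 * x + m.2.2.2.2.1 * y + m.2.2.2.2.2 * w = u₂ := by
    obtain ⟨m₀₀, m₁₀, m₀₁, m₂₀, m₁₁, m₀₂⟩ := m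
    simp only [gramDet, cofactors] at hD hx ⊢
    set D := m₀₀ * (m₂₀ * m₀₂ - m₁₁ ^ 2) + m₁₀ * (m₀₁ * m₁₁ - m₁₀ * m₀₂) +
      m₀₁ * (m₁₀ * m₁₁ - m₀₁ * m₂₀) with hDdef
    refine ⟨((m₀₁ * m₁₁ - m₁₀ * m₀₂) * u₀ + (m₀₀ * m₀₂ - m₀₁ ^ 2) * u₁ +
      (m₁₀ * m₀₁ - m₀₀ * m₁₁) * u₂) / D, ((m₁₀ * m₁₁ - m₀₁ * m₂₀) * u₀ +
      (m₁₀ * m₀₁ - m₀₀ * m₁₁) * u₁ + (m₀₀ * m₂₀ - m₁₀ ^ 2) * u₂) / D, ?_, ?_, ?_⟩ <;>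
    · rw [hx]
      field_simp
      rw [hDdef]
      ring
  -- Completing the square at the solution. Any other minimizer would have a nonpositive quadratic
  -- form there, so definiteness pins it down.
  have hquad : ∀ b, Φ b = Φ (β₀ + x / γ₀, β₁ + y / γ₁, β₂ + w / γ₂) +
      quadForm m (γ₀ * (b.1 - β₀) - x) (γ₁ * (b.2.1 - β₁) - y) (γ₂ * (b.2.2 - β₂) - w) := by
    intro b
    rw [hΦ b, hΦ (β₀ + x / γ₀, β₁ + y / γ₁, β₂ + w / γ₂)]
    simp only [add_sub_cancel_left, mul_div_cancel₀ _ h₀, mul_div_cancel₀ _ h₁,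
      mul_div_cancel₀ _ h₂]
    rw [← e₀, ← e₁, ← e₂]
    simp only [quadForm]
    ring
  have hnn : ∀ x y w, 0 ≤ quadForm m x y w := by
    intro x y w
    by_contra hneg
    obtain ⟨rfl, rfl, rfl⟩ := eq_zero_of_quadForm_nonpos hm (not_le.1 hneg).le
    simp [quadForm] at hneg
  refine ⟨⟨(β₀ + x / γ₀, β₁ + y / γ₁, β₂ + w / γ₂), fun b _ => ?_⟩, fun b hb => ?_⟩
  · rw [Set.mem_ofPred_eq, hquad b]
    linarith [hnn (γ₀ * (b.1 - β₀) - x) (γ₁ * (b.2.1 - β₁) - y) (γ₂ * (b.2.2 - β₂) - w)]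
  · have h1 : Φ b ≤ Φ (β₀ + x / γ₀, β₁ + y / γ₁, β₂ + w / γ₂) := hb (Set.mem_univ _)
    rw [hquad b] at h1
    have := (eq_zero_of_quadForm_nonpos hm (by linarith)).1
    linarith

end leastSquares

/-! ### The normal equations of the local linear fit -/

section criterion

variable {Ω : Type*} {T Y : ℕ → ℕ → Ω → ℝ} {Z : ℕ → Ω → ℝ} {N : ℕ → ℕ → Ω → ℕ}

lemma totalSum_add (g g' : ℝ → ℝ → ℝ → ℝ) (n : ℕ) (ω : Ω) :
    totalSum T Y Z N (fun s w y => g s w y + g' s w y) n ω =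
      totalSum T Y Z N g n ω + totalSum T Y Z N g' n ω := by
  simp only [totalSum, subjectSum, Finset.sum_add_distrib]

lemma totalSum_const_mul (c : ℝ) (g : ℝ → ℝ → ℝ → ℝ) (n : ℕ) (ω : Ω) :
    totalSum T Y Z N (fun s w y => c * g s w y) n ω = c * totalSum T Y Z N g n ω := by
  simp only [totalSum, subjectSum, Finset.mul_sum]

/-- The kernel multiplied by a monomial. -/
def kernelWindow (K : ℝ → ℝ → ℝ) (k₁ k₂ : ℕ) (s w : ℝ) : ℝ := s ^ k₁ * w ^ k₂ * K s w

/-- The normalized entry of the matrix of the normal equations. -/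
noncomputable def gramEntry (K : ℝ → ℝ → ℝ) (T Y : ℕ → ℕ → Ω → ℝ) (Z : ℕ → Ω → ℝ) (N : ℕ → ℕ → Ω → ℕ)
    (t z a b q : ℝ) (n k₁ k₂ : ℕ) (ω : Ω) : ℝ :=
  q⁻¹ * totalSum T Y Z N (fun s w _ => scaled (kernelWindow K k₁ k₂) t z a b s w) n ω

/-- The normalized remainder term of the right-hand side of the normal equations. -/
noncomputable def biasEntry (K : ℝ → ℝ → ℝ) (f₃ : ℝ → ℝ → ℝ → ℝ) (T Y : ℕ → ℕ → Ω → ℝ)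
    (Z : ℕ → Ω → ℝ) (N : ℕ → ℕ → Ω → ℕ) (t z a b q : ℝ) (n k₁ k₂ : ℕ) (ω : Ω) : ℝ :=
  (√q)⁻¹ * totalSum T Y Z N (fun s w _ =>
      scaled (kernelWindow K k₁ k₂) t z a b s w * linRemainder (condMean f₃) t z s w) n ω

/-- The normalized noise term of the right-hand side of the normal equations. -/
noncomputable def noiseEntry (K : ℝ → ℝ → ℝ) (f₃ : ℝ → ℝ → ℝ → ℝ) (T Y : ℕ → ℕ → Ω → ℝ)
    (Z : ℕ → Ω → ℝ) (N : ℕ → ℕ → Ω → ℕ) (t z a b q : ℝ) (n k₁ k₂ : ℕ) (ω : Ω) : ℝ :=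
  (√q)⁻¹ * totalSum T Y Z N (noise f₃ (kernelWindow K k₁ k₂) t z a b) n ω

/-- The normalized right-hand side of the normal equations. -/
noncomputable def scoreEntry (K : ℝ → ℝ → ℝ) (f₃ : ℝ → ℝ → ℝ → ℝ) (T Y : ℕ → ℕ → Ω → ℝ)
    (Z : ℕ → Ω → ℝ) (N : ℕ → ℕ → Ω → ℕ) (t z a b q : ℝ) (n k₁ k₂ : ℕ) (ω : Ω) : ℝ :=
  biasEntry K f₃ T Y Z N t z a b q n k₁ k₂ ω + noiseEntry K f₃ T Y Z N t z a b q n k₁ k₂ ω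

/-- The matrix of the normal equations. -/
noncomputable def gramMatrix (K : ℝ → ℝ → ℝ) (T Y : ℕ → ℕ → Ω → ℝ) (Z : ℕ → Ω → ℝ) (N : ℕ → ℕ → Ω → ℕ)
    (t z a b q : ℝ) (n : ℕ) (ω : Ω) : Gram :=
  (gramEntry K T Y Z N t z a b q n 0 0 ω, gramEntry K T Y Z N t z a b q n 1 0 ω,
    gramEntry K T Y Z N t z a b q n 0 1 ω, gramEntry K T Y Z N t z a b q n 2 0 ω,
    gramEntry K T Y Z N t z a b q n 1 1 ω, gramEntry K T Y Z N t z a b q n 0 2 ω)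

/-- Each response is the Taylor polynomial of `μ` plus remainder plus residual, so a candidate
enters only through the deviations of its coefficients from those of the polynomial. The two slopes
carry a minus sign because `T - t` is `-h_t` times the kernel argument. -/
lemma localCriterion_eq (K : ℝ → ℝ → ℝ) (f₃ : ℝ → ℝ → ℝ → ℝ) (ht hz : ℕ → ℝ) (t z : ℝ) {q : ℝ}
    (hq : 0 < q) {n : ℕ} (ha : ht n ≠ 0) (hb : hz n ≠ 0) (ω : Ω) (b : ℝ × ℝ × ℝ) :
    localCriterion K T Y Z N ht hz t z n ω b =
      totalSum T Y Z N (fun s w y => scaled K t z (ht n) (hz n) s w *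
        (linRemainder (condMean f₃) t z s w + residual f₃ s w y) ^ 2) n ω -
      2 * (scoreEntry K f₃ T Y Z N t z (ht n) (hz n) q n 0 0 ω *
          (√q * (b.1 - condMean f₃ t z)) +
        scoreEntry K f₃ T Y Z N t z (ht n) (hz n) q n 1 0 ω *
          (-(√q * ht n) * (b.2.1 - pderiv 1 0 (condMean f₃) t z)) +
        scoreEntry K f₃ T Y Z N t z (ht n) (hz n) q n 0 1 ω *
          (-(√q * hz n) * (b.2.2 - pderiv 0 1 (condMean f₃) t z))) +
      quadForm (gramMatrix K T Y Z N t z (ht n) (hz n) q n ω) (√q * (b.1 - condMean f₃ t z))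
        (-(√q * ht n) * (b.2.1 - pderiv 1 0 (condMean f₃) t z))
        (-(√q * hz n) * (b.2.2 - pderiv 0 1 (condMean f₃) t z)) := by
  have hs := (Real.sqrt_pos.2 hq).ne'
  have hsq := Real.sq_sqrt hq.le
  set r := √q with hr
  set c₀ := r * (b.1 - condMean f₃ t z) with hc₀
  set c₁ := -(r * ht n) * (b.2.1 - pderiv 1 0 (condMean f₃) t z) with hc₁
  set c₂ := -(r * hz n) * (b.2.2 - pderiv 0 1 (condMean f₃) t z) with hc₂
  set W : ℕ → ℕ → ℝ → ℝ → ℝ := fun k₁ k₂ s w =>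
    scaled (kernelWindow K k₁ k₂) t z (ht n) (hz n) s w with hW
  -- The square is expanded inside the sum; each coefficient of a monomial in `c₀, c₁, c₂` is then a
  -- total sum over a kernel window.
  have e : localCriterion K T Y Z N ht hz t z n ω b = totalSum T Y Z N (fun s w y =>
      scaled K t z (ht n) (hz n) s w *
        (linRemainder (condMean f₃) t z s w + residual f₃ s w y) ^ 2 +
      -(2 * r⁻¹ * c₀) * (W 0 0 s w * linRemainder (condMean f₃) t z s w) +
      -(2 * r⁻¹ * c₀) * noise f₃ (kernelWindow K 0 0) t z (ht n) (hz n) s w y +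
      -(2 * r⁻¹ * c₁) * (W 1 0 s w * linRemainder (condMean f₃) t z s w) +
      -(2 * r⁻¹ * c₁) * noise f₃ (kernelWindow K 1 0) t z (ht n) (hz n) s w y +
      -(2 * r⁻¹ * c₂) * (W 0 1 s w * linRemainder (condMean f₃) t z s w) +
      -(2 * r⁻¹ * c₂) * noise f₃ (kernelWindow K 0 1) t z (ht n) (hz n) s w y +
      q⁻¹ * c₀ ^ 2 * W 0 0 s w + q⁻¹ * (2 * (c₀ * c₁)) * W 1 0 s w +
      q⁻¹ * (2 * (c₀ * c₂)) * W 0 1 s w + q⁻¹ * c₁ ^ 2 * W 2 0 s w +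
      q⁻¹ * (2 * (c₁ * c₂)) * W 1 1 s w + q⁻¹ * c₂ ^ 2 * W 0 2 s w) n ω := by
    simp only [localCriterion, totalSum, subjectSum]
    refine Finset.sum_congr rfl fun i _ => Finset.sum_congr rfl fun j _ => ?_
    have e1 : Y i j ω - b.1 - b.2.1 * (T i j ω - t) - b.2.2 * (Z i ω - z) =
        linRemainder (condMean f₃) t z (T i j ω) (Z i ω) + residual f₃ (T i j ω) (Z i ω) (Y i j ω) -
        r⁻¹ * (c₀ + c₁ * ((t - T i j ω) / ht n) + c₂ * ((z - Z i ω) / hz n)) := by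
      rw [hc₀, hc₁, hc₂, linRemainder, residual]
      field_simp
      ring
    rw [e1]
    simp only [hW, noise, scaled, kernelWindow, ← hsq]
    field_simp
    ring
  rw [e]
  simp only [totalSum_add, totalSum_const_mul, quadForm, gramMatrix, gramEntry, scoreEntry, biasEntry,
    noiseEntry, hW]
  ring

end criterion


/-! ### The limits of the normal equations -/

/-- Positive definiteness is an open condition, so it holds with probability tending to one once the
matrices converge to a positive definite limit. -/
lemma gramPos_mem_nhds {m : Gram} (hm : GramPos m) : {m | GramPos m} ∈ 𝓝 m := by
  have h2 : Continuous gramMinor := by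
    unfold gramMinor
    fun_prop
  have h3 : Continuous gramDet := by
    unfold gramDet cofactors
    fun_prop
  exact (continuous_fst.continuousAt.eventually_const_lt hm.1).and
    ((h2.continuousAt.eventually_const_lt hm.2.1).and (h3.continuousAt.eventually_const_lt hm.2.2))

/-- The limit of the matrices of the normal equations. -/
noncomputable def limitGram (K : ℝ → ℝ → ℝ) (d : ℝ) : Gram :=
  (d, 0, 0, kernelMoment K 2 0 * d, kernelMoment K 1 1 * d, kernelMoment K 0 2 * d)

lemma IsKernelOfOrderTwo.moment_det {K : ℝ → ℝ → ℝ} (hK : IsKernelOfOrderTwo K) :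
    0 < kernelMoment K 2 0 ∧
      0 < kernelMoment K 2 0 * kernelMoment K 0 2 - kernelMoment K 1 1 ^ 2 := by
  have h1 := hK.second_pos
  have h2 := hK.second_det
  simp only [kernelMoment, pow_zero, pow_one, mul_one, one_mul] at *
  exact ⟨h1, by linarith⟩

lemma IsKernelOfOrderTwo.gramPos_limitGram {K : ℝ → ℝ → ℝ} (hK : IsKernelOfOrderTwo K) {d : ℝ}
    (hd : 0 < d) : GramPos (limitGram K d) := by
  obtain ⟨h1, h2⟩ := hK.moment_det
  refine ⟨hd, ?_, ?_⟩
  · simp only [gramMinor, limitGram]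
    nlinarith [mul_pos (mul_pos hd hd) h1]
  · simp only [gramDet, cofactors, limitGram]
    nlinarith [mul_pos (pow_pos hd 3) h2]

/-- The vanishing first moments decouple the intercept from the slopes in the limit. -/
lemma IsKernelOfOrderTwo.cofactors_div_gramDet {K : ℝ → ℝ → ℝ} (hK : IsKernelOfOrderTwo K) {d : ℝ}
    (hd : 0 < d) : (cofactors (limitGram K d)).1 / gramDet (limitGram K d) = d⁻¹ ∧
      (cofactors (limitGram K d)).2.1 / gramDet (limitGram K d) = 0 ∧
      (cofactors (limitGram K d)).2.2 / gramDet (limitGram K d) = 0 := by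
  have hD := (hK.gramPos_limitGram hd).2.2.ne'
  simp only [gramDet, cofactors, limitGram, zero_mul, mul_zero, sub_zero, add_zero, zero_div,
    and_true] at hD ⊢
  exact div_mul_cancel_right₀ (right_ne_zero_of_mul hD) d

section limits

set_option linter.unusedSectionVars false

variable {Ω : Type*} [MeasurableSpace Ω] {P : Measure Ω} [IsProbabilityMeasure P]
  {K : ℝ → ℝ → ℝ} {T Y : ℕ → ℕ → Ω → ℝ} {Z : ℕ → Ω → ℝ}
  {N : ℕ → ℕ → Ω → ℕ} {f₃ : ℝ → ℝ → ℝ → ℝ} {f₅ : ℝ → ℝ → ℝ → ℝ → ℝ → ℝ} {t z ρ τ : ℝ}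
  {ht hz : ℕ → ℝ}

theorem SamplingModel.tendstoInMeasure_gramMatrix (h : SamplingModel P T Y Z N f₃ f₅)
    (hN : CountMoments P N) (hreg : Regularity f₃ f₅ t z) (hK : IsKernelOfOrderTwo K)
    (hρ : 0 < ρ) (hb : BandwidthConditions P N ht hz ρ τ) :
    TendstoInMeasure P (fun n => gramMatrix K T Y Z N t z (ht n) (hz n) (effSize P N ht hz n) n)
      atTop fun _ => limitGram K (designDensity f₃ t z) := by
  obtain ⟨C, U, hl⟩ := hreg.exists_localFacts
  obtain ⟨R, -, hW⟩ := hK.exists_window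
  have key : ∀ k₁ k₂, TendstoInMeasure P (fun n =>
      gramEntry K T Y Z N t z (ht n) (hz n) (effSize P N ht hz n) n k₁ k₂) atTop
      fun _ => kernelMoment K k₁ k₂ * designDensity f₃ t z := fun k₁ k₂ =>
    h.tendstoInMeasure_weights hN hl hreg hρ hb (hW k₁ k₂)
  have e : limitGram K (designDensity f₃ t z) =
      (kernelMoment K 0 0 * designDensity f₃ t z, kernelMoment K 1 0 * designDensity f₃ t z,
        kernelMoment K 0 1 * designDensity f₃ t z, kernelMoment K 2 0 * designDensity f₃ t z,
        kernelMoment K 1 1 * designDensity f₃ t z, kernelMoment K 0 2 * designDensity f₃ t z) := by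
    have h0 : kernelMoment K 0 0 = 1 := by simpa [kernelMoment] using hK.mass
    have h1 : kernelMoment K 1 0 = 0 := by simpa [kernelMoment] using hK.first_t
    have h2 : kernelMoment K 0 1 = 0 := by simpa [kernelMoment] using hK.first_z
    simp [limitGram, h0, h1, h2]
  rw [e]
  exact tendstoInMeasure_prodMk (key 0 0) (tendstoInMeasure_prodMk (key 1 0)
    (tendstoInMeasure_prodMk (key 0 1) (tendstoInMeasure_prodMk (key 2 0)
      (tendstoInMeasure_prodMk (key 1 1) (key 0 2)))))

lemma SamplingModel.measurable_gramMatrix (h : SamplingModel P T Y Z N f₃ f₅)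
    (hK : IsKernelOfOrderTwo K) (t z a b q : ℝ) (n : ℕ) :
    Measurable (gramMatrix K T Y Z N t z a b q n) := by
  obtain ⟨R, -, hW⟩ := hK.exists_window
  have key : ∀ k₁ k₂, Measurable (gramEntry K T Y Z N t z a b q n k₁ k₂) := fun k₁ k₂ =>
    (h.measurable_totalSum ((hW k₁ k₂).measurable_scaled.comp
      (f := fun p : ℝ × ℝ × ℝ => (p.1, p.2.1)) (by fun_prop)) n).const_mul _
  exact (key 0 0).prodMk ((key 1 0).prodMk ((key 0 1).prodMk ((key 2 0).prodMk
    ((key 1 1).prodMk (key 0 2)))))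

/-- The limit of the remainder terms of the normal equations. -/
noncomputable def limitBias (K : ℝ → ℝ → ℝ) (f₃ : ℝ → ℝ → ℝ → ℝ) (t z ρ τ : ℝ) (k₁ k₂ : ℕ) : ℝ :=
  ∫ s : ℝ × ℝ, kernelWindow K k₁ k₂ s.1 s.2 *
    (limitQuad (condMean f₃) t z ρ τ s * designDensity f₃ t z)

lemma SamplingModel.tendstoInMeasure_biasEntry (h : SamplingModel P T Y Z N f₃ f₅)
    (hN : CountMoments P N) (hreg : Regularity f₃ f₅ t z) (hK : IsKernelOfOrderTwo K)
    (hρ : 0 < ρ) (hτ : 0 < τ) (hb : BandwidthConditions P N ht hz ρ τ) (k₁ k₂ : ℕ) :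
    TendstoInMeasure P (fun n =>
      biasEntry K f₃ T Y Z N t z (ht n) (hz n) (effSize P N ht hz n) n k₁ k₂) atTop
      fun _ => limitBias K f₃ t z ρ τ k₁ k₂ := by
  obtain ⟨C, U, hl⟩ := hreg.exists_localFacts
  obtain ⟨R, -, hW⟩ := hK.exists_window
  exact h.tendstoInMeasure_bias hN hl hreg hρ hτ hb (hW k₁ k₂)

lemma SamplingModel.measurable_biasEntry (h : SamplingModel P T Y Z N f₃ f₅)
    (hK : IsKernelOfOrderTwo K) (t z a b q : ℝ) (n k₁ k₂ : ℕ) :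
    Measurable (biasEntry K f₃ T Y Z N t z a b q n k₁ k₂) := by
  obtain ⟨R, -, hW⟩ := hK.exists_window
  exact (h.measurable_totalSum (((hW k₁ k₂).measurable_scaled.mul
    (h.measurable_linRemainder t z)).comp
      (f := fun p : ℝ × ℝ × ℝ => (p.1, p.2.1)) (by fun_prop)) n).const_mul _

lemma SamplingModel.tendstoInDistribution_noiseEntry (h : SamplingModel P T Y Z N f₃ f₅)
    (hN : CountMoments P N) (hreg : Regularity f₃ f₅ t z) (hK : IsKernelOfOrderTwo K)
    (hρ : 0 < ρ) (hb : BandwidthConditions P N ht hz ρ τ) (k₁ k₂ : ℕ) :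
    TendstoInDistribution (fun n =>
      noiseEntry K f₃ T Y Z N t z (ht n) (hz n) (effSize P N ht hz n) n k₁ k₂) atTop
      (id : ℝ → ℝ) (fun _ => P) (gaussianReal 0
        ((∫ s : ℝ × ℝ, kernelWindow K k₁ k₂ s.1 s.2 ^ 2) * residualMoment f₃ t z).toNNReal) := by
  obtain ⟨C, U, hl⟩ := hreg.exists_localFacts
  obtain ⟨R, -, hW⟩ := hK.exists_window
  exact h.tendstoInDistribution_noise hN hl hreg hρ hb (hW k₁ k₂)

lemma SamplingModel.measurable_noiseEntry (h : SamplingModel P T Y Z N f₃ f₅)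
    (hK : IsKernelOfOrderTwo K) (t z a b q : ℝ) (n k₁ k₂ : ℕ) :
    Measurable (noiseEntry K f₃ T Y Z N t z a b q n k₁ k₂) := by
  obtain ⟨R, -, hW⟩ := hK.exists_window
  exact (h.measurable_totalSum (h.measurable_noise (hW k₁ k₂) t z a b) n).const_mul _

/-- A multiple of a right-hand side with a coefficient that tends to zero is negligible. -/
lemma SamplingModel.tendstoInMeasure_mul_scoreEntry (h : SamplingModel P T Y Z N f₃ f₅)
    (hN : CountMoments P N) (hreg : Regularity f₃ f₅ t z) (hK : IsKernelOfOrderTwo K)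
    (hρ : 0 < ρ) (hτ : 0 < τ) (hb : BandwidthConditions P N ht hz ρ τ) (k₁ k₂ : ℕ)
    {A : ℕ → Ω → ℝ} (hA : TendstoInMeasure P A atTop fun _ => 0)
    (hAm : ∀ n, AEMeasurable (A n) P) :
    TendstoInMeasure P (fun n ω => A n ω *
      scoreEntry K f₃ T Y Z N t z (ht n) (hz n) (effSize P N ht hz n) n k₁ k₂ ω) atTop
      fun _ => 0 := by
  have h1 := tendstoInMeasure_mul hA (h.tendstoInMeasure_biasEntry hN hreg hK hρ hτ hb k₁ k₂)
  have h2 := tendstoInMeasure_mul_of_tendstoInDistribution hA hAm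
    (h.tendstoInDistribution_noiseEntry hN hreg hK hρ hb k₁ k₂)
  have h3 := tendstoInMeasure_add h1 h2
  rw [zero_mul, add_zero] at h3
  refine h3.congr_left fun n => ae_of_all _ fun ω => ?_
  simp only [scoreEntry]
  ring

/-- The factor `√ρ * ρ ^ k` from the rescaled Taylor polynomial is `√(ρ ^ (2 * k + 1))`, and the
design density cancels against the inverse of the limiting matrix. -/
lemma limitBias_eq (hK : IsKernelOfOrderTwo K) (hρ : 0 < ρ) (hd : 0 < designDensity f₃ t z) :
    (designDensity f₃ t z)⁻¹ * limitBias K f₃ t z ρ τ 0 0 = biasL K f₃ ρ τ t z := by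
  obtain ⟨R, -, hW⟩ := hK.exists_window
  have e : ∀ s : ℝ × ℝ, kernelWindow K 0 0 s.1 s.2 *
      (limitQuad (condMean f₃) t z ρ τ s * designDensity f₃ t z) =
      τ * √ρ * designDensity f₃ t z * (pderiv 2 0 (condMean f₃) t z / 2) *
        (s.1 ^ 2 * s.2 ^ 0 * K s.1 s.2) +
      τ * √ρ * designDensity f₃ t z * (ρ * pderiv 1 1 (condMean f₃) t z) *
        (s.1 ^ 1 * s.2 ^ 1 * K s.1 s.2) +
      τ * √ρ * designDensity f₃ t z * (ρ ^ 2 * pderiv 0 2 (condMean f₃) t z / 2) *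
        (s.1 ^ 0 * s.2 ^ 2 * K s.1 s.2) := fun s => by
    rw [kernelWindow, limitQuad, taylorQuad]
    ring
  have hs : ∀ k : ℕ, √(ρ ^ (2 * k + 1)) = √ρ * ρ ^ k := fun k => by
    rw [pow_succ, mul_comm 2 k, pow_mul, Real.sqrt_mul (by positivity), Real.sqrt_sq (by positivity),
      mul_comm]
  have i1 := ((hW 2 0).integrable).const_mul
    (τ * √ρ * designDensity f₃ t z * (pderiv 2 0 (condMean f₃) t z / 2))
  have i2 := ((hW 1 1).integrable).const_mul
    (τ * √ρ * designDensity f₃ t z * (ρ * pderiv 1 1 (condMean f₃) t z))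
  have i3 := ((hW 0 2).integrable).const_mul
    (τ * √ρ * designDensity f₃ t z * (ρ ^ 2 * pderiv 0 2 (condMean f₃) t z / 2))
  rw [limitBias]
  simp_rw [e]
  have j := (integral_add (i1.add i2) i3).trans (congrArg₂ (· + ·) (integral_add i1 i2) rfl)
  simp only [integral_const_mul, Pi.add_apply] at j
  rw [j, biasL, Finset.Nat.sum_antidiagonal_eq_sum_range_succ_mk]
  simp only [kernelMoment, hs, Finset.sum_range_succ, Finset.sum_range_zero, Nat.sub_zero,
    Nat.sub_self, Nat.reduceSub, Nat.factorial, pow_zero, pow_one]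
  push_cast
  field_simp
  ring

end limits


/-! ### Asymptotic normality -/

/-- Slutsky's lemma yields the limit as an affine image of a Gaussian variable; only the law of the
limit matters, so it can be exchanged for the identity under the target Gaussian measure. -/
lemma TendstoInDistribution.of_map_eq {Ω Ω₁ Ω₂ : Type*} [MeasurableSpace Ω] [MeasurableSpace Ω₁]
    [MeasurableSpace Ω₂] {P : Measure Ω} {P₁ : Measure Ω₁} {P₂ : Measure Ω₂}
    [IsProbabilityMeasure P] [IsProbabilityMeasure P₁] [IsProbabilityMeasure P₂]
    {X : ℕ → Ω → ℝ} {G₁ : Ω₁ → ℝ} {G₂ : Ω₂ → ℝ}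
    (hX : TendstoInDistribution X atTop G₁ (fun _ => P) P₁) (hG : AEMeasurable G₂ P₂)
    (he : P₁.map G₁ = P₂.map G₂) : TendstoInDistribution X atTop G₂ (fun _ => P) P₂ where
  forall_aemeasurable := hX.forall_aemeasurable
  aemeasurable_limit := hG
  tendsto := by
    have e : (⟨P₂.map G₂, Measure.isProbabilityMeasure_map hG⟩ : ProbabilityMeasure ℝ) =
        ⟨P₁.map G₁, Measure.isProbabilityMeasure_map hX.aemeasurable_limit⟩ := Subtype.ext he.symm
    rw [e]
    exact hX.tendsto

lemma gaussianReal_map_affine (a b : ℝ) (v : NNReal) :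
    (gaussianReal 0 v).map (fun x => x * a + b) =
      gaussianReal b (NNReal.mk (a ^ 2) (sq_nonneg a) * v) := by
  have h1 : (fun x : ℝ => x * a + b) = (fun x => x + b) ∘ fun x => x * a := rfl
  rw [h1, ← Measure.map_map (by fun_prop) (by fun_prop), gaussianReal_map_mul_const,
    gaussianReal_map_add_const]
  simp

section main

set_option linter.unusedSectionVars false

variable {Ω : Type*} [MeasurableSpace Ω] {P : Measure Ω} [IsProbabilityMeasure P]
  {K : ℝ → ℝ → ℝ} {T Y : ℕ → ℕ → Ω → ℝ} {Z : ℕ → Ω → ℝ}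
  {N : ℕ → ℕ → Ω → ℕ} {f₃ : ℝ → ℝ → ℝ → ℝ} {f₅ : ℝ → ℝ → ℝ → ℝ → ℝ → ℝ} {t z ρ τ : ℝ}
  {ht hz : ℕ → ℝ} {βhat : ℕ → Ω → ℝ × ℝ × ℝ}

/-- The solution of the normal equations by Cramer's rule. -/
lemma IsLocalLinearFit.eq_of_gramPos (hfit : IsLocalLinearFit P K T Y Z N ht hz t z βhat)
    (h : SamplingModel P T Y Z N f₃ f₅) (hN : CountMoments P N)
    (hb : BandwidthConditions P N ht hz ρ τ) {n : ℕ} (hn : 0 < n) : ∀ᵐ ω ∂P,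
    GramPos (gramMatrix K T Y Z N t z (ht n) (hz n) (effSize P N ht hz n) n ω) →
      √(effSize P N ht hz n) * ((βhat n ω).1 - condMean f₃ t z) =
      (cofactors (gramMatrix K T Y Z N t z (ht n) (hz n) (effSize P N ht hz n) n ω)).1 /
          gramDet (gramMatrix K T Y Z N t z (ht n) (hz n) (effSize P N ht hz n) n ω) *
        scoreEntry K f₃ T Y Z N t z (ht n) (hz n) (effSize P N ht hz n) n 0 0 ω +
      (cofactors (gramMatrix K T Y Z N t z (ht n) (hz n) (effSize P N ht hz n) n ω)).2.1 /
          gramDet (gramMatrix K T Y Z N t z (ht n) (hz n) (effSize P N ht hz n) n ω) *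
        scoreEntry K f₃ T Y Z N t z (ht n) (hz n) (effSize P N ht hz n) n 1 0 ω +
      (cofactors (gramMatrix K T Y Z N t z (ht n) (hz n) (effSize P N ht hz n) n ω)).2.2 /
          gramDet (gramMatrix K T Y Z N t z (ht n) (hz n) (effSize P N ht hz n) n ω) *
        scoreEntry K f₃ T Y Z N t z (ht n) (hz n) (effSize P N ht hz n) n 0 1 ω := by
  filter_upwards [hfit.minimizes n] with ω hω hpos
  have hq := effSize_pos h hN hb hn
  have hs := (Real.sqrt_pos.2 hq).ne'
  have ha := (hb.ht_pos n).ne'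
  have hb' := (hb.hz_pos n).ne'
  obtain ⟨hex, hmin⟩ := quadratic_minimizer hpos hs (neg_ne_zero.2 (mul_ne_zero hs ha))
    (neg_ne_zero.2 (mul_ne_zero hs hb')) fun b =>
      localCriterion_eq (T := T) (Y := Y) (Z := Z) (N := N) K f₃ ht hz t z hq ha hb' ω b
  exact hmin _ (hω hex)

/-- Separates the random normalization into a ratio that tends to one and the deterministic `√q`. -/
lemma sqrt_averageN (h : SamplingModel P T Y Z N f₃ f₅) (hN : CountMoments P N)
    (hb : BandwidthConditions P N ht hz ρ τ) (n : ℕ) (ω : Ω) :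
    √((n : ℝ) * averageN N n ω * ht n * hz n) =
      √(averageN N n ω / momentN P N 1 n) * √(effSize P N ht hz n) := by
  have h1 := h.one_le_momentN hN n
  have h2 := (hb.ht_pos n).le
  have h3 := (hb.hz_pos n).le
  have h4 : 0 ≤ effSize P N ht hz n := by
    unfold effSize
    positivity
  rw [← Real.sqrt_mul' _ h4, effSize]
  congr 1
  field_simp

/-- The local linear estimator of the mean surface is asymptotically normal. -/
theorem IsLocalLinearFit.tendstoInDistribution (hK : IsKernelOfOrderTwo K)
    (h : SamplingModel P T Y Z N f₃ f₅) (hN : CountMoments P N) (hreg : Regularity f₃ f₅ t z)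
    (hρ : 0 < ρ) (hτ : 0 < τ) (hb : BandwidthConditions P N ht hz ρ τ)
    (hfit : IsLocalLinearFit P K T Y Z N ht hz t z βhat) :
    TendstoInDistribution
      (fun (n : ℕ) (ω : Ω) => √((n : ℝ) * averageN N n ω * ht n * hz n) *
          ((βhat n ω).1 - condMean f₃ t z))
      atTop (id : ℝ → ℝ) (fun _ => P)
      (gaussianReal (biasL K f₃ ρ τ t z) (Real.toNNReal (varL K f₃ t z))) := by
  have hd := hreg.f₂_pos
  set d := designDensity f₃ t z with hddef
  set M : ℕ → Ω → Gram := fun n =>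
    gramMatrix K T Y Z N t z (ht n) (hz n) (effSize P N ht hz n) n with hM
  set r : ℕ → Ω → ℝ := fun n ω => √(averageN N n ω / momentN P N 1 n) with hr
  set U : ℕ → ℕ → ℕ → Ω → ℝ := fun k₁ k₂ n =>
    scoreEntry K f₃ T Y Z N t z (ht n) (hz n) (effSize P N ht hz n) n k₁ k₂ with hU
  set B : ℕ → Ω → ℝ := fun n =>
    biasEntry K f₃ T Y Z N t z (ht n) (hz n) (effSize P N ht hz n) n 0 0 with hB
  set V : ℕ → Ω → ℝ := fun n =>
    noiseEntry K f₃ T Y Z N t z (ht n) (hz n) (effSize P N ht hz n) n 0 0 with hV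
  have hUe : ∀ n ω, U 0 0 n ω = B n ω + V n ω := fun n ω => rfl
  have cd : Continuous gramDet := by
    unfold gramDet cofactors
    fun_prop
  have cc : Continuous cofactors := by
    unfold cofactors
    fun_prop
  have hpos := hK.gramPos_limitGram hd
  have hMlim := h.tendstoInMeasure_gramMatrix hN hreg hK hρ hb
  obtain ⟨e₀, e₁, e₂⟩ := hK.cofactors_div_gramDet hd
  have hMm : ∀ n, Measurable (M n) := fun n => h.measurable_gramMatrix hK _ _ _ _ _ n
  -- Continuous mapping for the entries of the first row of the inverse, already multiplied by the
  -- random ratio that tends to one. Division is continuous at the limit since its determinant is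
  -- positive.
  have hA : ∀ g : ℝ × ℝ × ℝ → ℝ, Continuous g →
      TendstoInMeasure P (fun n ω => r n ω * (g (cofactors (M n ω)) / gramDet (M n ω))) atTop
        fun _ => g (cofactors (limitGram K d)) / gramDet (limitGram K d) := fun g hg => by
    have h1 := tendstoInMeasure_comp_of_continuousAt hMlim
      (((hg.comp cc).continuousAt).div cd.continuousAt hpos.2.2.ne')
    have h2 := tendstoInMeasure_comp_of_continuousAt (h.tendstoInMeasure_averageN hN)
      (g := Real.sqrt) Real.continuous_sqrt.continuousAt
    have h3 := tendstoInMeasure_mul h2 h1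
    rw [Real.sqrt_one, one_mul] at h3
    exact h3
  have hrm : ∀ n, Measurable (r n) := fun n => by
    have : Measurable (averageN N n) := (Finset.measurable_fun_sum _ fun i _ =>
      measurable_from_nat.comp (h.measurable_N n i)).div_const _
    exact (this.div_const _).sqrt
  have hAm : ∀ g : ℝ × ℝ × ℝ → ℝ, Continuous g → ∀ n,
      Measurable fun ω => r n ω * (g (cofactors (M n ω)) / gramDet (M n ω)) := fun g hg n =>
    (hrm n).mul (((hg.comp cc).measurable.comp (hMm n)).div (cd.measurable.comp (hMm n)))
  have hA₀ := hA (fun p => p.1) continuous_fst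
  have hA₁ := hA (fun p => p.2.1) continuous_snd.fst
  have hA₂ := hA (fun p => p.2.2) continuous_snd.snd
  rw [e₀] at hA₀
  rw [e₁] at hA₁
  rw [e₂] at hA₂
  have hAm₀ := hAm (fun p => p.1) continuous_fst
  have hAm₁ := hAm (fun p => p.2.1) continuous_snd.fst
  have hAm₂ := hAm (fun p => p.2.2) continuous_snd.snd
  set A₀ : ℕ → Ω → ℝ := fun n ω => r n ω * ((cofactors (M n ω)).1 / gramDet (M n ω)) with hA₀def
  set A₁ : ℕ → Ω → ℝ := fun n ω => r n ω * ((cofactors (M n ω)).2.1 / gramDet (M n ω)) with hA₁def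
  set A₂ : ℕ → Ω → ℝ := fun n ω => r n ω * ((cofactors (M n ω)).2.2 / gramDet (M n ω)) with hA₂def
  have hBm : ∀ n, Measurable (B n) := fun n => h.measurable_biasEntry hK _ _ _ _ _ n 0 0
  have hUm : ∀ k₁ k₂ n, Measurable (U k₁ k₂ n) := fun k₁ k₂ n =>
    (h.measurable_biasEntry hK _ _ _ _ _ n k₁ k₂).add (h.measurable_noiseEntry hK _ _ _ _ _ n k₁ k₂)
  -- All terms except the leading noise are collected here. The right-hand sides with slope windows
  -- have coefficients tending to zero and are themselves the sum of a convergent and an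
  -- asymptotically normal sequence.
  have hQ : TendstoInMeasure P (fun n ω => A₀ n ω * B n ω +
      (A₁ n ω * U 1 0 n ω + A₂ n ω * U 0 1 n ω)) atTop fun _ => biasL K f₃ ρ τ t z := by
    have k0 := tendstoInMeasure_mul hA₀ (h.tendstoInMeasure_biasEntry hN hreg hK hρ hτ hb 0 0)
    have k1 := h.tendstoInMeasure_mul_scoreEntry hN hreg hK hρ hτ hb 1 0 hA₁
      fun n => (hAm₁ n).aemeasurable
    have k2 := h.tendstoInMeasure_mul_scoreEntry hN hreg hK hρ hτ hb 0 1 hA₂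
      fun n => (hAm₂ n).aemeasurable
    have k3 := tendstoInMeasure_add k0 (tendstoInMeasure_add k1 k2)
    rw [add_zero, add_zero, limitBias_eq hK hρ hreg.f₂_pos] at k3
    exact k3
  have hQm : ∀ n, Measurable fun ω => A₀ n ω * B n ω +
      (A₁ n ω * U 1 0 n ω + A₂ n ω * U 0 1 n ω) := fun n =>
    ((hAm₀ n).mul (hBm n)).add (((hAm₁ n).mul (hUm 1 0 n)).add ((hAm₂ n).mul (hUm 0 1 n)))
  -- Slutsky for the map `(V, (A, Q)) ↦ V * A + Q`, with `A` tending to `1 / d` and `Q` to the bias.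
  have hslut := (h.tendstoInDistribution_noiseEntry hN hreg hK hρ hb 0
    0).continuous_comp_prodMk_of_tendstoInMeasure_const
    (g := fun p : ℝ × (ℝ × ℝ) => p.1 * p.2.1 + p.2.2) (by fun_prop)
    (tendstoInMeasure_prodMk hA₀ hQ) fun n => ((hAm₀ n).prodMk (hQm n)).aemeasurable
  have hv : NNReal.mk (d⁻¹ ^ 2) (sq_nonneg _) *
      ((∫ s : ℝ × ℝ, kernelWindow K 0 0 s.1 s.2 ^ 2) * residualMoment f₃ t z).toNNReal =
      Real.toNNReal (varL K f₃ t z) := by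
    have e : (∫ s : ℝ × ℝ, kernelWindow K 0 0 s.1 s.2 ^ 2) = kernelNormSq K := by
      simp [kernelWindow, kernelNormSq]
    rw [e, ← Real.toNNReal_of_nonneg (sq_nonneg d⁻¹), ← Real.toNNReal_mul (sq_nonneg _),
      residualMoment_eq hreg.f₂_pos, varL]
    congr 1
    rw [← hddef]
    field_simp
  have hlaw := TendstoInDistribution.of_map_eq hslut (aemeasurable_id (μ := gaussianReal
    (biasL K f₃ ρ τ t z) (Real.toNNReal (varL K f₃ t z)))) (by
      rw [Measure.map_id, ← hv]
      exact gaussianReal_map_affine _ _ _)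
  have hstat : ∀ n : ℕ, AEMeasurable (fun ω => √((n : ℝ) * averageN N n ω * ht n * hz n) *
      ((βhat n ω).1 - condMean f₃ t z)) P := fun n => by
    simp_rw [sqrt_averageN h hN hb]
    exact ((hrm n).mul_const _).aemeasurable.mul ((hfit.aemeasurable n).fst.sub_const _)
  -- The estimator equals the Slutsky expression almost surely whenever the matrix is positive
  -- definite, and the exceptional event has probability tending to zero.
  refine tendstoInDistribution_of_tendstoInMeasure_sub _ _ hlaw ?_ hstat
  refine tendstoInMeasure_zero_of_measure_ne
    (tendsto_measure_notMem hMlim (gramPos_mem_nhds hpos)) ?_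
  filter_upwards [eventually_gt_atTop 0] with n hn
  filter_upwards [hfit.eq_of_gramPos h hN hb hn] with ω hω hmem
  have h1 := hω (not_not.1 hmem)
  rw [sqrt_averageN h hN hb, mul_assoc, h1]
  change r n ω * ((cofactors (M n ω)).1 / gramDet (M n ω) * U 0 0 n ω +
    (cofactors (M n ω)).2.1 / gramDet (M n ω) * U 1 0 n ω +
    (cofactors (M n ω)).2.2 / gramDet (M n ω) * U 0 1 n ω) =
    V n ω * A₀ n ω + (A₀ n ω * B n ω + (A₁ n ω * U 1 0 n ω + A₂ n ω * U 0 1 n ω))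
  rw [hUe, hA₀def, hA₁def, hA₂def]
  ring

end main

end MeanSurface

theorem theorem3p2 {Ω : Type*} [MeasurableSpace Ω] (P : Measure Ω) [IsProbabilityMeasure P]
    (K : ℝ → ℝ → ℝ) (hK : MeanSurface.IsKernelOfOrderTwo K)
    (T Y : ℕ → ℕ → Ω → ℝ) (Z : ℕ → Ω → ℝ) (N : ℕ → ℕ → Ω → ℕ)
    (f₃ : ℝ → ℝ → ℝ → ℝ) (f₅ : ℝ → ℝ → ℝ → ℝ → ℝ → ℝ)
    (hmodel : MeanSurface.SamplingModel P T Y Z N f₃ f₅)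
    (hN : MeanSurface.CountMoments P N)
    (t z : ℝ) (hreg : MeanSurface.Regularity f₃ f₅ t z)
    (ht hz : ℕ → ℝ) (ρ τ : ℝ) (hρ : 0 < ρ) (hτ : 0 < τ)
    (hband : MeanSurface.BandwidthConditions P N ht hz ρ τ)
    (βhat : ℕ → Ω → ℝ × ℝ × ℝ)
    (hfit : MeanSurface.IsLocalLinearFit P K T Y Z N ht hz t z βhat) :
    TendstoInDistribution
      (fun (n : ℕ) (ω : Ω) =>
        √((n : ℝ) * MeanSurface.averageN N n ω * ht n * hz n) *
          ((βhat n ω).1 - MeanSurface.condMean f₃ t z))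
      atTop (id : ℝ → ℝ) (fun _ => P)
      (gaussianReal (MeanSurface.biasL K f₃ ρ τ t z)
        (Real.toNNReal (MeanSurface.varL K f₃ t z))) :=
  hfit.tendstoInDistribution hK hmodel hN hreg hρ hτ hband
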